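/- **Setting.** Let $F$ be a number field with ring of integers $\mathcal O_F$, ideal class group $C$ and adele ring $\mathbb A$ (including the infinite places), and let $n\ge 0$ be an integer. For $\alpha\in \mathrm{GL}_1(\mathbb A)$ let $(\alpha)=\prod_{v\nmid\infty} v^{\mathrm{ord}_v(\alpha_v)}$ be the associated fractional ideal. For subgroups $\Gamma,\Gamma'$ of a group $G$ and a set $\Delta=\Gamma\Delta\Gamma'\subseteq G$ such that $\Gamma$ and $\delta\Gamma'\delta^{-1}$ are commensurable for all $\delta\in\Delta$ (a Hecke triple), $R(\Gamma,\Gamma',\Delta)$ is the group of finite sums $\sum a_j\Gamma\delta_j$ ($a_j\in\mathbb Z$, $\delta_j\in\Delta$) that are invariant under right multiplication by $\Gamma'$. There is a composition $R(\Gamma,\Gamma',\Delta)\times R(\Gamma',\Gamma'',\Delta')\to R(\Gamma,\Gamma'',\Delta\Delta')$, $(\sum a_j\Gamma\delta_j,\sum a_i'\Gamma'\delta_i')\mapsto \sum a_ja_i'\Gamma\delta_j\delta_i'$. If $\Delta$ is a semigroup and $\Gamma=\Gamma'$, then $(\Gamma,\Delta)$ is called a Hecke pair and $R(\Gamma,\Delta)=R(\Gamma,\Gamma,\Delta)$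 is a $\mathbb Z$-algebra (unital if $1\in\Delta$). If $V$ is a right module for a monoid containing $\Gamma,\Gamma',\Delta$, then $T=\sum_j a_j\Gamma\delta_j\in R(\Gamma,\Gamma',\Delta)$ (the $\Gamma\delta_j$ distinct) acts as $H^r(\Gamma,V)\to H^r(\Gamma',V)$, $\xi\mapsto \xi|T$: if $\xi$ is the class of a homogeneous cocycle $f$ (so that $f(\gamma\gamma_0,\dots,\gamma\gamma_r)=f(\gamma_0,\dots,\gamma_r)\gamma^{-1}$), then $\xi|T$ is the class of $f'(\gamma_0',\dots,\gamma_r')=\sum_j a_j f(t_j(\gamma'_0),\dots,t_j(\gamma'_r))\delta_j$, where $t_j(\gamma')\in\Gamma$ is determined by $t_j(\gamma')\delta_i=\delta_j\gamma'$ for some $i$. Let $(K,\Delta)$ be a Hecke pair in $\mathrm{GL}_n(\mathbb A)$ with $K$ open and with $(\det\kappa)$ principal for every $\kappa\in K$. For each $c\in C$ fix $\alpha_c\in \mathrm{GL}_n(\mathbb A)$ with $(\det\alpha_c)\in c^{-1}$. For $c,c'\in C$ put $$\Delta^{(c)}=\{\delta\in\Delta:(\det\delta)\in c\},$$ $$\widetilde\Gamma_c=K\cap\alpha_c\mathrm{GL}_n(F)\alpha_c^{-1},\qquad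 \Gamma_c=\alpha_c^{-1}K\alpha_c\cap \mathrm{GL}_n(F),$$ $$\widetilde\Delta_{c,c'}=\Delta\cap\alpha_c\mathrm{GL}_n(F)\alpha_{c'}^{-1},\qquad \Delta_{c,c'}=\alpha_c^{-1}\Delta\alpha_{c'}\cap \mathrm{GL}_n(F).$$ **Proposition.** Suppose that $\det:\bigcup_{c\in C}\alpha_c\mathrm{GL}_n(F)K\to \mathrm{GL}_1(\mathbb A)$ is surjective. Then $(\widetilde\Gamma_a,\widetilde\Gamma_b,\widetilde\Delta_{a,b})$ and $(\Gamma_a,\Gamma_b,\Delta_{a,b})$ are Hecke triples for all $a,b\in C$, $R(K,\Delta)=\bigoplus_{c}R(K,\Delta^{(c)})$ is a $C$-graded algebra, and the following hold. 1. For all $c,c'\in C$ there are an injection and an isomorphism $$R(K,\Delta^{(c)})\hookrightarrow R(\widetilde\Gamma_{c'},\widetilde\Gamma_{c'c},\widetilde\Delta_{c',c'c})\simeq R(\Gamma_{c'},\Gamma_{c'c},\Delta_{c',c'c}).$$ The first map is $\sum a_jK\delta_j\mapsto\sum a_j\,(K\delta_j\cap\widetilde\Delta_{c',c'c})$, the isomorphism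 is $\widetilde\Gamma_{c'}\delta\mapsto\alpha_{c'}^{-1}\widetilde\Gamma_{c'}\delta\alpha_{c'c}$, and the composite is $\sum a_jK\delta_j\mapsto\sum a_j\,(\alpha_{c'}^{-1}K\delta_j\alpha_{c'c}\cap\Delta_{c',c'c})$. Here, for $\delta\in\Delta^{(c)}$, each of these intersections is a single coset of $\widetilde\Gamma_{c'}$ (resp. $\Gamma_{c'}$). 2. Together these maps form injective algebra homomorphisms $$R(K,\Delta)=\bigoplus_{c}R(K,\Delta^{(c)})\to\bigoplus_{c}\prod_{c'}R(\widetilde\Gamma_{c'},\widetilde\Gamma_{c'c},\widetilde\Delta_{c',c'c})\simeq\bigoplus_{c}\prod_{c'}R(\Gamma_{c'},\Gamma_{c'c},\Delta_{c',c'c}),$$ where the product of $x$ in the component $c$ and $y$ in the component $d$ lies in the component $cd$ and is $(xy)_{c'}=x_{c'}y_{c'c}$. They are unital if $1\in\Delta$. 3. Let $V$ be a right module (over any commutative ring $k$, with $k$-linear action) for a monoid $S\subseteq\mathrm{GL}_n(F)$ containing all $\Delta_{c,c'}$ and all $\Gamma_c$, and let $r\ge0$. There is a unique right action of $\bigoplus_c\prod_{c'}R(\Gamma_{c'},\Gamma_{c'c},\Delta_{c',c'c})$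 on $\bigoplus_cH^r(\Gamma_c,V)$ by $k$-linear maps such that $x=(x_{c'})_{c'}$ in the component $c$ sends $\xi\in H^r(\Gamma_{c'},V)$ to $\xi|x_{c'}\in H^r(\Gamma_{c'c},V)$. Through the homomorphism in 2 it gives a right action of $R(K,\Delta)$ on $\bigoplus_cH^r(\Gamma_c,V)$, which is unital if $1\in\Delta$. -/

import Mathlib

open scoped NumberField nonZeroDivisors

universe u

noncomputable section

namespace AdelicHecke

/-! ### Double coset modules -/

section DoubleCosets

variable {G : Type*} [Group G]

/-- The space `Γ \ G` of cosets `Γ g`. -/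
abbrev CosetSpace (Γ : Subgroup G) : Type _ := Quotient (QuotientGroup.rightRel Γ)

/-- The coset `Γ g`. -/
abbrev coset (Γ : Subgroup G) (g : G) : CosetSpace Γ := Quotient.mk (QuotientGroup.rightRel Γ) g

/-- The coset `Γ g` as a subset of `G`. -/
def cosetSet (Γ : Subgroup G) (g : G) : Set G := {x | ∃ γ ∈ Γ, x = γ * g}

theorem coset_eq {Γ : Subgroup G} {g h : G} : coset Γ g = coset Γ h ↔ h * g⁻¹ ∈ Γ := by
  rw [Quotient.eq, QuotientGroup.rightRel_apply]

theorem coset_mul_left {Γ : Subgroup G} {γ : G} (hγ : γ ∈ Γ) (g : G) :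
    coset Γ (γ * g) = coset Γ g := by
  rw [coset_eq]; simpa using Γ.inv_mem hγ

/-- The commensurability condition on a triple `(Γ, Γ', Δ)`: for every `δ ∈ Δ` the groups `Γ` and
`δ Γ' δ⁻¹` are commensurable. Moreover `Δ = Γ Δ Γ'`. -/
structure IsTriple (Γ Γ' : Subgroup G) (Δ : Set G) : Prop where
  commensurable : ∀ δ ∈ Δ, Subgroup.Commensurable Γ (Γ'.map (MulAut.conj δ).toMonoidHom)
  left_mul_mem : ∀ γ ∈ Γ, ∀ δ ∈ Δ, γ * δ ∈ Δ
  mul_right_mem : ∀ δ ∈ Δ, ∀ γ' ∈ Γ', δ * γ' ∈ Δ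

/-- `R(Γ, Γ', Δ)`: the finite `ℤ`-linear combinations `∑ aⱼ Γ δⱼ` of cosets with `δⱼ ∈ Δ`
(where `Γ Δ = Δ`) which are invariant under right multiplication by `Γ'`. -/
def heckeModule (Γ Γ' : Subgroup G) (Δ : Set G) : Submodule ℤ (CosetSpace Γ →₀ ℤ) where
  carrier := {T | (∀ g, T (coset Γ g) ≠ 0 → g ∈ Δ) ∧
    ∀ g, ∀ γ' ∈ Γ', T (coset Γ (g * γ')) = T (coset Γ g)}
  zero_mem' := by simp
  add_mem' := by
    rintro S T ⟨hS, hS'⟩ ⟨hT, hT'⟩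
    refine ⟨fun g hg => ?_, fun g γ' hγ' => ?_⟩
    · by_cases h : S (coset Γ g) = 0
      · exact hT g (by simpa [h] using hg)
      · exact hS g h
    · simp only [Finsupp.add_apply, hS' g γ' hγ', hT' g γ' hγ']
  smul_mem' := by
    rintro c T ⟨hT, hT'⟩
    refine ⟨fun g hg => hT g fun h => hg (by simp [h]), fun g γ' hγ' => ?_⟩
    simp only [Finsupp.smul_apply, hT' g γ' hγ']

theorem heckeModule_mono {Γ Γ' : Subgroup G} {Δ Δ' : Set G} (h : Δ ⊆ Δ') :
    heckeModule Γ Γ' Δ ≤ heckeModule Γ Γ' Δ' :=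
  fun _ hT => ⟨fun g hg => h (hT.1 g hg), hT.2⟩

/-- The composition `(∑ aⱼ Γ δⱼ, ∑ a'ᵢ Γ' δ'ᵢ) ↦ ∑ aⱼ a'ᵢ Γ δⱼ δ'ᵢ`. -/
def compose {Γ Γ' : Subgroup G} (T : CosetSpace Γ →₀ ℤ) (T' : CosetSpace Γ' →₀ ℤ) :
    CosetSpace Γ →₀ ℤ :=
  T'.sum fun x' a' => T.sum fun x a => Finsupp.single (coset Γ (x.out * x'.out)) (a * a')

section Compose

/-- Right translation of cosets. -/
def mulRight {Γ : Subgroup G} (h : G) (x : CosetSpace Γ) : CosetSpace Γ := coset Γ (x.out * h)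

theorem mulRight_coset {Γ : Subgroup G} (g h : G) :
    mulRight h (coset Γ g) = coset Γ (g * h) := by
  unfold mulRight
  have : coset Γ (coset Γ g).out = coset Γ g := Quotient.out_eq _
  rw [coset_eq] at this ⊢
  simpa [mul_assoc] using this

theorem mulRight_mul {Γ : Subgroup G} (g h : G) (x : CosetSpace Γ) :
    mulRight (g * h) x = mulRight h (mulRight g x) := by
  induction x using Quotient.inductionOn with
  | h k => rw [mulRight_coset, mulRight_coset, mulRight_coset, mul_assoc]

theorem mulRight_injective {Γ : Subgroup G} (h : G) :
    Function.Injective (mulRight (Γ := Γ) h) := by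
  have key : ∀ x : CosetSpace Γ, mulRight h⁻¹ (mulRight h x) = x := by
    intro x
    induction x using Quotient.inductionOn with
    | h k => rw [mulRight_coset, mulRight_coset]; simp
  exact Function.LeftInverse.injective key

/-- Right translation of linear combinations of cosets. -/
def translate {Γ : Subgroup G} (h : G) : (CosetSpace Γ →₀ ℤ) →ₗ[ℤ] (CosetSpace Γ →₀ ℤ) :=
  Finsupp.lmapDomain ℤ ℤ (mulRight h)

theorem translate_single {Γ : Subgroup G} (h : G) (x : CosetSpace Γ) (a : ℤ) :
    translate h (Finsupp.single x a) = Finsupp.single (mulRight h x) a := by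
  simp [translate]

theorem translate_mul {Γ : Subgroup G} (g h : G) (T : CosetSpace Γ →₀ ℤ) :
    translate (g * h) T = translate h (translate g T) := by
  have : translate (Γ := Γ) (g * h) = (translate h).comp (translate g) := by
    ext x : 2
    simp [translate_single, mulRight_mul]
  rw [this]; rfl

theorem translate_coset {Γ : Subgroup G} (h g : G) (T : CosetSpace Γ →₀ ℤ) :
    translate h T (coset Γ (g * h)) = T (coset Γ g) := by
  rw [← mulRight_coset]
  exact Finsupp.mapDomain_apply (mulRight_injective h) T _

theorem translate_eq_self {Γ Γ' : Subgroup G} {Δ : Set G} {T : CosetSpace Γ →₀ ℤ}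
    (hT : T ∈ heckeModule Γ Γ' Δ) {γ : G} (hγ : γ ∈ Γ') : translate γ T = T := by
  ext x
  induction x using Quotient.inductionOn with
  | h k =>
    have := translate_coset γ (k * γ⁻¹) T
    rw [inv_mul_cancel_right] at this
    exact this.trans (hT.2 k γ⁻¹ (Γ'.inv_mem hγ))

theorem translate_congr {Γ Γ' : Subgroup G} {Δ : Set G} {T : CosetSpace Γ →₀ ℤ}
    (hT : T ∈ heckeModule Γ Γ' Δ) {g h : G} (hgh : coset Γ' g = coset Γ' h) :
    translate g T = translate h T := by
  rw [coset_eq] at hgh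
  have : h = h * g⁻¹ * g := by simp
  rw [this, translate_mul, translate_eq_self hT hgh]

theorem compose_eq {Γ Γ' : Subgroup G} (T : CosetSpace Γ →₀ ℤ) (T' : CosetSpace Γ' →₀ ℤ) :
    compose T T' = Finsupp.linearCombination ℤ (fun x' => translate x'.out T) T' := by
  unfold compose
  rw [Finsupp.linearCombination_apply]
  refine Finsupp.sum_congr fun x' _ => ?_
  have : translate x'.out T = T.sum fun x a => Finsupp.single (mulRight x'.out x) a := by
    simp [translate, Finsupp.mapDomain]
  rw [this, Finsupp.smul_sum]
  refine Finsupp.sum_congr fun x _ => ?_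
  rw [Finsupp.smul_single, smul_eq_mul, mul_comm]
  rfl

theorem compose_add {Γ Γ' : Subgroup G} (T : CosetSpace Γ →₀ ℤ) (S S' : CosetSpace Γ' →₀ ℤ) :
    compose T (S + S') = compose T S + compose T S' := by
  simp only [compose_eq, map_add]

theorem add_compose {Γ Γ' : Subgroup G} (S S' : CosetSpace Γ →₀ ℤ) (T : CosetSpace Γ' →₀ ℤ) :
    compose (S + S') T = compose S T + compose S' T := by
  simp only [compose_eq, map_add, Finsupp.linearCombination_apply, smul_add, Finsupp.sum_add]

theorem compose_single {Γ Γ' : Subgroup G} {Δ : Set G} {T : CosetSpace Γ →₀ ℤ}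
    (hT : T ∈ heckeModule Γ Γ' Δ) (g : G) (a : ℤ) :
    compose T (Finsupp.single (coset Γ' g) a) = a • translate g T := by
  rw [compose_eq, Finsupp.linearCombination_single]
  congr 1
  exact translate_congr hT (Quotient.out_eq _)

theorem compose_assoc {Γ Γ' Γ'' : Subgroup G} {Δ : Set G} {T : CosetSpace Γ →₀ ℤ}
    {T' : CosetSpace Γ' →₀ ℤ} (hT : T ∈ heckeModule Γ Γ' Δ)
    (T'' : CosetSpace Γ'' →₀ ℤ) :
    compose (compose T T') T'' = compose T (compose T' T'') := by
  induction T'' using Finsupp.induction_linear with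
  | zero => simp [compose_eq]
  | add S S' hS hS' => simp only [compose_add, hS, hS']
  | single x a =>
    have key : ∀ (h : G) (U : CosetSpace Γ' →₀ ℤ),
        translate h (compose T U) = compose T (translate h U) := by
      intro h U
      induction U using Finsupp.induction_linear with
      | zero => simp [compose_eq]
      | add S S' hS hS' => simp only [compose_add, map_add, hS, hS']
      | single y b =>
        induction y using Quotient.inductionOn with
        | h k =>
          rw [translate_single, mulRight_coset, compose_single hT, compose_single hT,
            translate_mul, map_smul]
    have e1 : compose (compose T T') (Finsupp.single x a)
        = a • translate x.out (compose T T') := by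
      rw [compose_eq, Finsupp.linearCombination_single]
    have e2 : compose T' (Finsupp.single x a) = a • translate x.out T' := by
      rw [compose_eq, Finsupp.linearCombination_single]
    rw [e1, e2, key]
    simp only [compose_eq, map_smul]

theorem compose_mem {Γ Γ' Γ'' : Subgroup G} {Δ Δ' Δ'' : Set G} {T : CosetSpace Γ →₀ ℤ}
    {T' : CosetSpace Γ' →₀ ℤ} (hT : T ∈ heckeModule Γ Γ' Δ) (hT' : T' ∈ heckeModule Γ' Γ'' Δ')
    (h : ∀ δ ∈ Δ, ∀ δ' ∈ Δ', δ * δ' ∈ Δ'') : compose T T' ∈ heckeModule Γ Γ'' Δ'' := by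
  have key : ∀ (h : G) (U : CosetSpace Γ' →₀ ℤ),
      translate h (compose T U) = compose T (translate h U) := by
    intro h U
    induction U using Finsupp.induction_linear with
    | zero => simp [compose_eq]
    | add S S' hS hS' => simp only [compose_add, map_add, hS, hS']
    | single y b =>
      induction y using Quotient.inductionOn with
      | h k =>
        rw [translate_single, mulRight_coset, compose_single hT, compose_single hT,
          translate_mul, map_smul]
  refine ⟨fun g hg => ?_, fun g γ hγ => ?_⟩
  · rw [compose_eq, Finsupp.linearCombination_apply, Finsupp.sum, Finsupp.finsetSum_apply] at hg
    obtain ⟨x', hx', hne⟩ := Finset.exists_ne_zero_of_sum_ne_zero hg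
    rw [Finsupp.smul_apply, smul_eq_mul] at hne
    have h1 := right_ne_zero_of_mul hne
    have h2 : translate x'.out T (coset Γ (g * x'.out⁻¹ * x'.out)) ≠ 0 := by
      simpa using h1
    rw [translate_coset] at h2
    have h3 : x'.out ∈ Δ' := hT'.1 _ (by
      have : coset Γ' x'.out = x' := Quotient.out_eq _
      rw [this]; exact Finsupp.mem_support_iff.1 hx')
    simpa using h _ (hT.1 _ h2) _ h3
  · have h1 : translate γ (compose T T') = compose T T' := by
      rw [key, translate_eq_self hT' hγ]
    calc compose T T' (coset Γ (g * γ)) = translate γ (compose T T') (coset Γ (g * γ)) := by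
          rw [h1]
      _ = compose T T' (coset Γ g) := translate_coset _ _ _

end Compose

end DoubleCosets

/-! ### Hecke pairs and the algebra `R(Γ, Δ)` -/

/-- A Hecke pair `(Γ, Δ)` in a group: `Δ` is a semigroup with `Δ = Γ Δ Γ` such that `Γ` and
`δ Γ δ⁻¹` are commensurable for all `δ ∈ Δ`. The identity need not lie in `Δ`. -/
structure HeckePair (G : Type*) [Group G] where
  Γ : Subgroup G
  Δ : Subsemigroup G
  isTriple : IsTriple Γ Γ (Δ : Set G)

namespace HeckePair

variable {G : Type*} [Group G] (P : HeckePair G)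

/-- The algebra `R(Γ, Δ) = R(Γ, Γ, Δ)` of a Hecke pair. It is unital if `1 ∈ Δ`. -/
def R : Type _ := heckeModule P.Γ P.Γ (P.Δ : Set G)

instance : AddCommGroup P.R := inferInstanceAs (AddCommGroup (heckeModule P.Γ P.Γ (P.Δ : Set G)))

instance : NonUnitalRing P.R where
  mul T T' := ⟨compose T.1 T'.1,
    compose_mem T.2 T'.2 fun _ hδ _ hδ' => P.Δ.mul_mem hδ hδ'⟩
  left_distrib _ _ _ := Subtype.ext (compose_add _ _ _)
  right_distrib _ _ _ := Subtype.ext (add_compose _ _ _)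
  zero_mul x := Subtype.ext (by
    have h := add_compose (0 : CosetSpace P.Γ →₀ ℤ) 0 x.1
    rw [add_zero] at h
    exact left_eq_add.mp h)
  mul_zero x := Subtype.ext (by
    have h := compose_add x.1 (0 : CosetSpace P.Γ →₀ ℤ) 0
    rw [add_zero] at h
    exact left_eq_add.mp h)
  mul_assoc a b c := Subtype.ext (compose_assoc a.2 c.1)

end HeckePair

/-! ### Systems of Hecke triples indexed by a commutative group -/

/-- A family of subgroups `Γ a` and of sets `Δ a b`, indexed by a commutative group `C`, with
`Γ a * Δ a b * Γ b ⊆ Δ a b` and `Δ a b * Δ b c ⊆ Δ a c`. -/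
structure HeckeSystem (C G : Type*) [CommGroup C] [Group G] where
  Γ : C → Subgroup G
  Δ : C → C → Set G
  left_mul_mem : ∀ a b, ∀ γ ∈ Γ a, ∀ δ ∈ Δ a b, γ * δ ∈ Δ a b
  mul_right_mem : ∀ a b, ∀ δ ∈ Δ a b, ∀ γ ∈ Γ b, δ * γ ∈ Δ a b
  mul_mem : ∀ a b c, ∀ δ ∈ Δ a b, ∀ δ' ∈ Δ b c, δ * δ' ∈ Δ a c

namespace HeckeSystem

variable {C G : Type*} [CommGroup C] [Group G] (H : HeckeSystem C G)

/-- `R(Γ_a, Γ_b, Δ_{a,b})`. -/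
abbrev R (a b : C) : Submodule ℤ (CosetSpace (H.Γ a) →₀ ℤ) := heckeModule (H.Γ a) (H.Γ b) (H.Δ a b)

/-- The component `∏_{c'} R(Γ_{c'}, Γ_{c'c}, Δ_{c',c'c})`. -/
abbrev Component (c : C) : Type _ := ∀ c' : C, H.R c' (c' * c)

/-- The algebra `⨁_c ∏_{c'} R(Γ_{c'}, Γ_{c'c}, Δ_{c',c'c})`. -/
def Alg : Type _ := DirectSum C H.Component

instance : AddCommGroup H.Alg := inferInstanceAs (AddCommGroup (DirectSum C H.Component))

open scoped Classical in
/-- The inclusion of the component of index `c`. -/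
def of (c : C) : H.Component c →+ H.Alg := DirectSum.of H.Component c

/-- The product of the components of index `c` and `d`, with values in the one of index `c * d`:
`(x y)_{c'} = x_{c'} y_{c'c}`, composed as
`R(Γ_{c'}, Γ_{c'c}, Δ_{c',c'c}) × R(Γ_{c'c}, Γ_{c'cd}, Δ_{c'c,c'cd}) → R(Γ_{c'}, Γ_{c'cd}, Δ_{c',c'cd})`. -/
def componentMul (c d : C) : H.Component c →+ H.Component d →+ H.Component (c * d) :=
  AddMonoidHom.mk' (fun x => AddMonoidHom.mk' (fun y c' =>
      ⟨compose (x c').1 (y (c' * c)).1, by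
        have := compose_mem (x c').2 (y (c' * c)).2 (H.mul_mem c' (c' * c) (c' * c * d))
        exact (mul_assoc c' c d) ▸ this⟩)
      fun _ _ => funext fun _ => Subtype.ext (compose_add _ _ _))
    fun _ _ => AddMonoidHom.ext fun _ => funext fun _ => Subtype.ext (add_compose _ _ _)

open scoped Classical in
/-- The product of the algebra as a biadditive map. -/
def mulHom : H.Alg →+ H.Alg →+ H.Alg :=
  DirectSum.toAddMonoid fun c => AddMonoidHom.flip <| DirectSum.toAddMonoid fun d =>
    AddMonoidHom.flip <| (AddMonoidHom.compHom (H.of (c * d))).comp (H.componentMul c d)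

theorem mulHom_of (c d : C) (x : H.Component c) (y : H.Component d) :
    H.mulHom (H.of c x) (H.of d y) = H.of (c * d) (H.componentMul c d x y) := by
  classical
  have h := DirectSum.toAddMonoid_of (β := H.Component) (γ := H.Alg →+ H.Alg)
    (fun c => AddMonoidHom.flip <| DirectSum.toAddMonoid fun d =>
      AddMonoidHom.flip <| (AddMonoidHom.compHom (H.of (c * d))).comp (H.componentMul c d)) c x
  exact (DFunLike.congr_fun h (H.of d y)).trans (DFunLike.congr_fun
    (DirectSum.toAddMonoid_of (β := H.Component) (γ := H.Component c →+ H.Alg) (fun d =>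
      AddMonoidHom.flip <| (AddMonoidHom.compHom (H.of (c * d))).comp (H.componentMul c d)) d y) x)

theorem of_congr {c d : C} (h : c = d) (x : H.Component c) (y : H.Component d)
    (hxy : ∀ c', (x c').1 = (y c').1) : H.of c x = H.of d y := by
  subst h
  congr 1
  exact funext fun c' => Subtype.ext (hxy c')

theorem induction {p : H.Alg → Prop} (x : H.Alg) (h0 : p 0) (hof : ∀ c y, p (H.of c y))
    (hadd : ∀ x y, p x → p y → p (x + y)) : p x := by
  classical
  exact DirectSum.induction_on x h0 hof hadd

instance : NonUnitalRing H.Alg where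
  mul x y := H.mulHom x y
  left_distrib x y z := map_add (H.mulHom x) y z
  right_distrib x y z := by
    change H.mulHom (x + y) z = H.mulHom x z + H.mulHom y z
    rw [map_add]; rfl
  zero_mul x := by
    change H.mulHom 0 x = 0
    rw [map_zero]; rfl
  mul_zero x := map_zero (H.mulHom x)
  mul_assoc x y z := by
    change H.mulHom (H.mulHom x y) z = H.mulHom x (H.mulHom y z)
    induction x using H.induction with
    | h0 => simp
    | hadd x x' hx hx' => simp only [map_add, AddMonoidHom.add_apply, hx, hx']
    | hof c x =>
      induction y using H.induction with
      | h0 => simp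
      | hadd y y' hy hy' => simp only [map_add, AddMonoidHom.add_apply, hy, hy']
      | hof d y =>
        induction z using H.induction with
        | h0 => simp
        | hadd z z' hz hz' => simp only [map_add, hz, hz']
        | hof e z =>
          simp only [mulHom_of]
          refine H.of_congr (mul_assoc c d e) _ _ fun c' => ?_
          have h : ∀ a, a = c' * c * d →
              compose (compose (x c').1 (y (c' * c)).1) (z a).1
                = compose (x c').1 (compose (y (c' * c)).1 (z (c' * c * d)).1) := by
            rintro a rfl
            exact compose_assoc (x c').2 _
          exact h (c' * (c * d)) (mul_assoc c' c d).symm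

theorem of_mul_of (c d : C) (x : H.Component c) (y : H.Component d) :
    H.of c x * H.of d y = H.of (c * d) (H.componentMul c d x y) := H.mulHom_of c d x y

end HeckeSystem

/-! ### The systems attached to a Hecke pair -/

section Systems

variable {C G G₀ : Type*} [CommGroup C] [Group G] [Group G₀]

/-- For a Hecke pair `(K, Δ)` in `G`, a homomorphism `ι : G₀ → G` and elements `α c` of `G`:
the groups `K ∩ α_c ι(G₀) α_c⁻¹` and the sets `Δ ∩ α_a ι(G₀) α_b⁻¹`. -/
def tildeSystem (P : HeckePair G) (ι : G₀ →* G) (α : C → G) : HeckeSystem C G where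
  Γ c := P.Γ ⊓ ι.range.map (MulAut.conj (α c)).toMonoidHom
  Δ a b := {δ | δ ∈ P.Δ ∧ ∃ g, δ = α a * ι g * (α b)⁻¹}
  left_mul_mem := by
    rintro a b γ ⟨hγ, _, ⟨g, rfl⟩, rfl⟩ δ ⟨hδ, h, rfl⟩
    exact ⟨P.isTriple.left_mul_mem _ hγ _ hδ, g * h, by simp [mul_assoc]⟩
  mul_right_mem := by
    rintro a b δ ⟨hδ, h, rfl⟩ γ ⟨hγ, _, ⟨g, rfl⟩, rfl⟩
    exact ⟨P.isTriple.mul_right_mem _ hδ _ hγ, h * g, by simp [mul_assoc]⟩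
  mul_mem := by
    rintro a b c δ ⟨hδ, h, rfl⟩ δ' ⟨hδ', h', rfl⟩
    exact ⟨P.Δ.mul_mem hδ hδ', h * h', by simp [mul_assoc]⟩

/-- The groups `α_c⁻¹ K α_c ∩ G₀` and the sets `α_a⁻¹ Δ α_b ∩ G₀`. -/
def system (P : HeckePair G) (ι : G₀ →* G) (α : C → G) : HeckeSystem C G₀ where
  Γ c := P.Γ.comap ((MulAut.conj (α c)).toMonoidHom.comp ι)
  Δ a b := {g | α a * ι g * (α b)⁻¹ ∈ P.Δ}
  left_mul_mem := by
    intro a b γ hγ δ hδ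
    have := P.isTriple.left_mul_mem _ hγ _ hδ
    simpa [mul_assoc] using this
  mul_right_mem := by
    intro a b δ hδ γ hγ
    have := P.isTriple.mul_right_mem _ hδ _ hγ
    simpa [mul_assoc] using this
  mul_mem := by
    intro a b c δ hδ δ' hδ'
    have := P.Δ.mul_mem hδ hδ'
    simpa [mul_assoc] using this

end Systems

/-! ### Adeles -/

section Adeles

variable (F : Type*) [Field F] [NumberField F]

/-- The ring of adeles of `F`, including the infinite places. -/
abbrev Adele : Type _ := NumberField.AdeleRing (𝓞 F) F

/-- The inclusion `GL_n(F) → GL_n(𝔸)`. -/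
def diagonalGL (n : ℕ) : GL (Fin n) F →* GL (Fin n) (Adele F) :=
  Matrix.GeneralLinearGroup.map (algebraMap F (Adele F))

variable {F}

/-- The order at the finite place `v` of an idele. -/
def ideleOrd (x : (Adele F)ˣ) (v : IsDedekindDomain.HeightOneSpectrum (𝓞 F)) : ℤ :=
  -WithZero.log (Valued.v ((x : Adele F).2 v))

/-- The fractional ideal `(x) = ∏_v v ^ ord_v(x)` of an idele. -/
def ideleIdeal (x : (Adele F)ˣ) : (FractionalIdeal (𝓞 F)⁰ F)ˣ :=
  ∏ᶠ v : IsDedekindDomain.HeightOneSpectrum (𝓞 F),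
    (Units.mk0 (v.asIdeal : FractionalIdeal (𝓞 F)⁰ F)
      (FractionalIdeal.coeIdeal_ne_zero.mpr v.ne_bot)) ^ ideleOrd x v

/-- The product defining the ideal of an idele is finite. -/
theorem ideleOrd_finite (x : (Adele F)ˣ) : {v | ideleOrd x v ≠ 0}.Finite := by
  have hx : IsUnit (x : Adele F).2 :=
    (x.isUnit).map (RingHom.snd (NumberField.InfiniteAdeleRing F)
      (IsDedekindDomain.FiniteAdeleRing (𝓞 F) F))
  have h := (IsDedekindDomain.FiniteAdeleRing.isUnit_iff.mp hx).2
  rw [Filter.eventually_cofinite] at h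
  refine h.subset fun v hv hv' => hv ?_
  simp [ideleOrd, hv']

/-- The ideal class of the fractional ideal of an idele. -/
def ideleClass (x : (Adele F)ˣ) : ClassGroup (𝓞 F) := ClassGroup.mk F (ideleIdeal x)

/-- The subset `Δ^(c)` of the elements of `Δ` whose determinant has ideal class `c`. -/
def classPart {n : ℕ} (P : HeckePair (GL (Fin n) (Adele F))) (c : ClassGroup (𝓞 F)) :
    Set (GL (Fin n) (Adele F)) :=
  {δ | δ ∈ P.Δ ∧ ideleClass (Matrix.GeneralLinearGroup.det δ) = c}

/-- `R(K, Δ^(c))`. -/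
abbrev classR {n : ℕ} (P : HeckePair (GL (Fin n) (Adele F))) (c : ClassGroup (𝓞 F)) :
    Submodule ℤ (CosetSpace P.Γ →₀ ℤ) :=
  heckeModule P.Γ P.Γ (classPart P c)

/-- The inclusion `R(K, Δ^(c)) → R(K, Δ)`. -/
def classIncl {n : ℕ} (P : HeckePair (GL (Fin n) (Adele F))) (c : ClassGroup (𝓞 F)) :
    classR P c →+ P.R :=
  (Submodule.inclusion (heckeModule_mono fun _ hδ => hδ.1 :
    classR P c ≤ heckeModule P.Γ P.Γ (P.Δ : Set _))).toAddMonoidHom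

open scoped Classical in
/-- `R(K, Δ) = ⨁_c R(K, Δ^(c))` as an algebra graded by the class group. -/
def IsGradedByClass {n : ℕ} (P : HeckePair (GL (Fin n) (Adele F))) : Prop :=
  DirectSum.IsInternal (fun c : ClassGroup (𝓞 F) => (classIncl P c).range) ∧
  ∀ (c d : ClassGroup (𝓞 F)) (T : classR P c) (T' : classR P d),
    classIncl P c T * classIncl P d T' ∈ (classIncl P (c * d)).range

/-- The system of the `Γ̃_c = K ∩ α_c GL_n(F) α_c⁻¹` and `Δ̃_{c,c'} = Δ ∩ α_c GL_n(F) α_{c'}⁻¹`. -/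
abbrev adelicTilde {n : ℕ} (P : HeckePair (GL (Fin n) (Adele F)))
    (α : ClassGroup (𝓞 F) → GL (Fin n) (Adele F)) :
    HeckeSystem (ClassGroup (𝓞 F)) (GL (Fin n) (Adele F)) :=
  tildeSystem P (diagonalGL F n) α

/-- The system of the `Γ_c = α_c⁻¹ K α_c ∩ GL_n(F)` and `Δ_{c,c'} = α_c⁻¹ Δ α_{c'} ∩ GL_n(F)`. -/
abbrev adelicSystem {n : ℕ} (P : HeckePair (GL (Fin n) (Adele F)))
    (α : ClassGroup (𝓞 F) → GL (Fin n) (Adele F)) :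
    HeckeSystem (ClassGroup (𝓞 F)) (GL (Fin n) F) :=
  system P (diagonalGL F n) α

end Adeles

/-! ### Cohomology and the action of double cosets -/

section Cohomology

variable {k : Type u} [CommRing k] {G : Type u} [Group G] {V : Type u} [AddCommGroup V] [Module k V]
  {S : Submonoid G}

/-- The right action of `g ∈ S` on `V`, where the right `S`-module `V` is given by `σ`.
For `g ∉ S` the value is `0`; it is not used. -/
def ract (σ : S →* (Module.End k V)ᵐᵒᵖ) (v : V) (g : G) : V :=
  open scoped Classical in if hg : g ∈ S then (σ ⟨g, hg⟩).unop v else 0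

/-- The right module `V` as a left module over a group `Γ ⊆ S`, with inverse action
`γ • v = v γ⁻¹`. -/
def leftRep (σ : S →* (Module.End k V)ᵐᵒᵖ) (Γ : Subgroup G) (hΓ : ∀ γ ∈ Γ, γ ∈ S) :
    Rep.{u} k Γ :=
  Rep.of (X := V)
    { toFun := fun γ => (σ ⟨((γ⁻¹ : Γ) : G), hΓ _ (γ⁻¹).2⟩).unop
      map_one' := by
        have : (⟨(((1 : Γ)⁻¹ : Γ) : G), hΓ _ ((1 : Γ)⁻¹).2⟩ : S) = 1 := Subtype.ext (by simp)
        rw [this, map_one, MulOpposite.unop_one]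
      map_mul' := fun γ γ' => by
        have : (⟨(((γ * γ')⁻¹ : Γ) : G), hΓ _ ((γ * γ')⁻¹).2⟩ : S)
            = ⟨((γ'⁻¹ : Γ) : G), hΓ _ (γ'⁻¹).2⟩ * ⟨((γ⁻¹ : Γ) : G), hΓ _ (γ⁻¹).2⟩ :=
          Subtype.ext (by simp)
        rw [this, map_mul, MulOpposite.unop_mul] }

/-- `H^r(Γ, V)`. -/
abbrev cohomology (σ : S →* (Module.End k V)ᵐᵒᵖ) (Γ : Subgroup G) (hΓ : ∀ γ ∈ Γ, γ ∈ S) (r : ℕ) :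
    ModuleCat.{u} k :=
  groupCohomology (leftRep σ Γ hΓ) r

/-- `f : Γ^{r+1} → V` is a homogeneous `r`-cocycle:
`f(g γ₀, …, g γ_r) = f(γ₀, …, γ_r) g⁻¹` and `∑ᵢ (-1)^i f(γ₀, …, γ̂ᵢ, …, γ_{r+1}) = 0`. -/
def IsHomogeneousCocycle (σ : S →* (Module.End k V)ᵐᵒᵖ) (Γ : Subgroup G) {r : ℕ}
    (f : (Fin (r + 1) → Γ) → V) : Prop :=
  (∀ (g : Γ) (γ : Fin (r + 1) → Γ), f (fun i => g * γ i) = ract σ (f γ) ((g : G)⁻¹)) ∧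
  ∀ γ : Fin (r + 2) → Γ, ∑ i : Fin (r + 2), (-1 : ℤ) ^ (i : ℕ) • f (fun j => γ (i.succAbove j)) = 0

/-- `f` is a homogeneous `r`-cocycle lying in the cohomology class `ξ`. The corresponding
inhomogeneous cocycle is `(g₁, …, g_r) ↦ f(1, g₁, g₁g₂, …, g₁⋯g_r)`. -/
def LiesIn (σ : S →* (Module.End k V)ᵐᵒᵖ) (Γ : Subgroup G) (hΓ : ∀ γ ∈ Γ, γ ∈ S) {r : ℕ}
    (f : (Fin (r + 1) → Γ) → V) (ξ : cohomology σ Γ hΓ r) : Prop :=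
  IsHomogeneousCocycle σ Γ f ∧ ∃ z : groupCohomology.cocycles (leftRep σ Γ hΓ) r,
    (∀ g : Fin r → Γ,
      (groupCohomology.iCocycles (leftRep σ Γ hΓ) r z : (Fin r → Γ) → V) g
        = f (Fin.partialProd g)) ∧
    groupCohomology.π (leftRep σ Γ hΓ) r z = ξ

/-- A choice `δ` of a representative of every coset of `Γ`. -/
def IsSection (Γ : Subgroup G) (δ : CosetSpace Γ → G) : Prop := ∀ x, coset Γ (δ x) = x

/-- The map `t_x : Γ' → Γ` of a coset `x = Γ δ_x`: `t_x(γ') δ_y = δ_x γ'` with `Γ δ_y = Γ δ_x γ'`. -/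
def shift (Γ Γ' : Subgroup G) (δ : CosetSpace Γ → G) (hδ : IsSection Γ δ) (x : CosetSpace Γ)
    (γ' : Γ') : Γ :=
  ⟨δ x * γ' * (δ (coset Γ (δ x * γ')))⁻¹, coset_eq.mp (hδ (coset Γ (δ x * γ')))⟩

/-- `f'(γ'₀, …, γ'_r) = ∑_x a_x f(t_x(γ'₀), …, t_x(γ'_r)) δ_x` for `T = ∑_x a_x Γ δ_x`. -/
def heckeCochain (σ : S →* (Module.End k V)ᵐᵒᵖ) (Γ Γ' : Subgroup G) (δ : CosetSpace Γ → G)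
    (hδ : IsSection Γ δ) (T : CosetSpace Γ →₀ ℤ) {r : ℕ} (f : (Fin (r + 1) → Γ) → V) :
    (Fin (r + 1) → Γ') → V :=
  fun γ' => T.sum fun x a => a • ract σ (f fun i => shift Γ Γ' δ hδ x (γ' i)) (δ x)

variable {C : Type*} [CommGroup C]

/-- `⨁_c H^r(Γ_c, V)`. -/
abbrev totalCohomology (H : HeckeSystem C G) (σ : S →* (Module.End k V)ᵐᵒᵖ)
    (hΓ : ∀ c, ∀ γ ∈ H.Γ c, γ ∈ S) (r : ℕ) : Type _ :=
  DirectSum C fun c => cohomology σ (H.Γ c) (hΓ c) r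

open scoped Classical in
/-- `act` is the right action of `⨁_c ∏_{c'} R(Γ_{c'}, Γ_{c'c}, Δ_{c',c'c})` on `⨁_c H^r(Γ_c, V)`
given by double cosets: for `x = (x_{c'})` of index `c`, a class `ξ` in `H^r(Γ_{c'}, V)` is mapped
to the class `ξ | x_{c'}` in `H^r(Γ_{c'c}, V)`, computed on any homogeneous cocycle in `ξ` and
with any representatives of the cosets. -/
def IsDoubleCosetAction (H : HeckeSystem C G) (σ : S →* (Module.End k V)ᵐᵒᵖ)
    (hΓ : ∀ c, ∀ γ ∈ H.Γ c, γ ∈ S) (r : ℕ)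
    (act : H.Alg →ₙ+* (Module.End k (totalCohomology H σ hΓ r))ᵐᵒᵖ) : Prop :=
  ∀ (c : C) (x : H.Component c) (c' : C) (ξ : cohomology σ (H.Γ c') (hΓ c') r)
    (f : (Fin (r + 1) → H.Γ c') → V), LiesIn σ (H.Γ c') (hΓ c') f ξ →
    ∀ (δ : CosetSpace (H.Γ c') → G) (hδ : IsSection (H.Γ c') δ),
      ∃ η : cohomology σ (H.Γ (c' * c)) (hΓ (c' * c)) r,
        LiesIn σ (H.Γ (c' * c)) (hΓ (c' * c))
          (heckeCochain σ (H.Γ c') (H.Γ (c' * c)) δ hδ (x c').1 f) η ∧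
        (act (H.of c x)).unop (DirectSum.of (fun c => cohomology σ (H.Γ c) (hΓ c) r) c' ξ)
          = DirectSum.of (fun c => cohomology σ (H.Γ c) (hΓ c) r) (c' * c) η

end Cohomology

end AdelicHecke

end

open AdelicHecke

noncomputable section

namespace AdelicHecke

/-! ### Generation of the special linear group of a field by transvections -/

section
open Matrix

/-! The arithmetic content is one claim: for `δ` of class `c`, the coset `K δ` meets `Δ̃_{c',c'c}`
in exactly one coset of `Γ̃_{c'}`. Uniqueness is formal: the quotient of two elements `α_{c'} g
α_{c'c}⁻¹` and `α_{c'} h α_{c'c}⁻¹` lies in `α_{c'} GL_n(F) α_{c'}⁻¹`, so if it lies in `K` it lies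
in `Γ̃_{c'}`. For existence, `y = α_{c'}⁻¹ δ α_{c'c}` has determinant of trivial class. The
surjectivity hypothesis gives `g ∈ GL_n(F)` and `κ ∈ K` with `det y = det g · det κ`. What remains
has determinant one and is absorbed by strong approximation: `SL_n(𝔸) ⊆ GL_n(F) U` for every open
subgroup `U` (`toGL_mem_approximable`, `exists_mul_diagonalGL_of_detClass`).

Strong approximation rests on the fact that the elements lying in `GL_n(F) U` for all open `U` form
a group. It contains the adelic transvections, because `F` surjects onto `𝔸` modulo any open
additive subgroup. Since `SL_n` of a field is generated by transvections, a matrix of determinant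
one becomes trivial at any finite set of places after multiplication by adelic transvections, and
then lies in `U` if the set is large.

By the claim, intersecting cosets with `Δ̃` and coarsening `Γ̃ x ↦ K x` undo each other in each
degree. Coarsening commutes with right translation, hence with composition. This makes the map of
part 1 injective and multiplicative (`IsClassMap.tildeMap_compose`). The passage from `Γ̃` to `Γ` is
transport along `g ↦ α_a g α_b⁻¹`, and commensurability survives intersection with a common
subgroup.

For the action on cohomology, cochains on `Γ` are replaced by `Γ`-equivariant cochains on the whole
group `G = GL_n(F)`. There `(F|T)(g) = ∑ aⱼ F(δⱼ g) δⱼ` is independent of representatives, and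
`(F|T)|T'` equals `F|(T T')` on the nose (`heckeOp_heckeOp`). Both kinds of cochains compute the
same cohomology, by an equivariant retraction `G → Γ` and the prism homotopy
(`isCoboundary_comp_sub_comp`). Pulling back a cocycle along the retraction recovers the formula
with the `tⱼ`. -/

theorem diag2n_eq_transvections {ι F : Type*} [Fintype ι] [DecidableEq ι] [Field F] {i j : ι}
    (hij : i ≠ j) {c : F} (hc : c ≠ 0) :
    SpecialLinearGroup.diag2n hij c hc =
      SpecialLinearGroup.transvection hij c * SpecialLinearGroup.transvection hij.symm (-c⁻¹) *
      SpecialLinearGroup.transvection hij c * (SpecialLinearGroup.transvection hij (-1) *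
      SpecialLinearGroup.transvection hij.symm 1 * SpecialLinearGroup.transvection hij (-1)) := by
  have key : (SpecialLinearGroup.diag2n hij c hc).1 =
      1 + single i i (c - 1) + single j j (c⁻¹ - 1) := by
    ext k l
    rw [SpecialLinearGroup.diag2n_coe]
    by_cases hkl : k = l
    · subst hkl
      by_cases hk : k = i
      · subst hk; simp [hij.symm]
      · by_cases hk' : k = j
        · subst hk'; simp [hij, hij.symm]
        · simp [hk, hk', Ne.symm hk, Ne.symm hk']
    · by_cases hk : k = i <;> by_cases hk' : k = j <;>
        simp [hkl, Matrix.single_apply] <;> grind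
  -- With `w(c)` the antidiagonal matrix with entries `c`, `-c⁻¹` in the `i, j` plane, each triple
  -- of transvections is a `w`, and the diagonal matrix is `w(c) w(-1)`.
  have hmul : 1 + single i i (c - 1) + single j j (c⁻¹ - 1) =
      (1 + single i j c) * (1 + single j i (-c⁻¹)) * (1 + single i j c) *
        ((1 + single i j (-1)) * (1 + single j i 1) * (1 + single i j (-1))) := by
    simp only [mul_add, add_mul,
      mul_one, one_mul, single_mul_single_same, single_mul_single_of_ne _ _ _ _ hij,
      single_mul_single_of_ne _ _ _ _ hij.symm, add_zero]
    ext k l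
    simp only [Matrix.add_apply, Matrix.single_apply]
    split_ifs <;> simp_all <;> field_simp <;> ring
  exact Subtype.ext (key.trans hmul)

/-- `SL_n` of a field is generated by transvections. -/
theorem specialLinearGroup_transvection_induction {ι F : Type*} [Fintype ι] [DecidableEq ι]
    [Field F] (p : SpecialLinearGroup ι F → Prop) (h1 : p 1)
    (htransvec : ∀ (i j : ι) (hij : i ≠ j) (a : F), p (SpecialLinearGroup.transvection hij a))
    (hmul : ∀ A B, p A → p B → p (A * B)) (M : SpecialLinearGroup ι F) : p M := by
  rcases subsingleton_or_nontrivial ι with h | h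
  · rwa [Subsingleton.elim M 1]
  · refine SpecialLinearGroup.diagonal_transvection_induction' p M (fun i j hij c hc => ?_)
      htransvec hmul
    rw [diag2n_eq_transvections]
    exact hmul _ _ (hmul _ _ (hmul _ _ (htransvec _ _ _ _) (htransvec _ _ _ _))
      (htransvec _ _ _ _)) (hmul _ _ (hmul _ _ (htransvec _ _ _ _) (htransvec _ _ _ _))
      (htransvec _ _ _ _))

end

/-! ### Strong approximation for the finite adeles -/

section
variable {F : Type*} [Field F] [NumberField F]
open IsDedekindDomain IsDedekindDomain.HeightOneSpectrum NumberField Topology Filter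

theorem exists_exp_neg_lt {x : WithZero (Multiplicative ℤ)} (hx : x ≠ 0) :
    ∃ m : ℕ, ∀ m', m ≤ m' → WithZero.exp (-(m' : ℤ)) < x := by
  refine ⟨(WithZero.log x).natAbs + 1, fun m' hm' => ?_⟩
  rw [← WithZero.exp_log hx, WithZero.exp_lt_exp]
  omega

theorem adicCompletion_nhds_zero (v : HeightOneSpectrum (𝓞 F)) {W : Set (v.adicCompletion F)}
    (hW : W ∈ 𝓝 0) :
    ∃ m : ℕ, ∀ m', m ≤ m' → ∀ a, Valued.v a ≤ WithZero.exp (-(m' : ℤ)) → a ∈ W := by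
  obtain ⟨γ, hγ⟩ := Valued.mem_nhds_zero.mp hW
  obtain ⟨m, hm⟩ := exists_exp_neg_lt
    (x := MonoidWithZeroHom.ValueGroup₀.embedding γ.1) ((map_ne_zero _).mpr γ.ne_zero)
  refine ⟨m, fun m' hm' a ha => hγ ?_⟩
  rw [Set.mem_ofPred_eq, Valuation.restrict_lt_iff_lt_embedding]
  exact ha.trans_lt (hm m' hm')

theorem adicCompletion_ball_mem_nhds (v : HeightOneSpectrum (𝓞 F)) (m : ℕ) :
    {a : v.adicCompletion F | Valued.v a ≤ WithZero.exp (-(m : ℤ))} ∈ 𝓝 0 := by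
  obtain ⟨y, hy⟩ := valuedAdicCompletion_surjective (K := F) v (WithZero.exp (-(m : ℤ)))
  have hy0 : Valued.v.restrict y ≠ 0 := by
    intro h
    have : Valued.v y = 0 := by simpa using h
    simp [hy] at this
  refine Valued.mem_nhds_zero.mpr ⟨Units.mk0 _ hy0, fun a ha => ?_⟩
  rw [Set.mem_ofPred_eq, Units.val_mk0, Valuation.restrict_lt_iff, hy] at ha
  exact ha.le

/-- As the `A i` are open, their product is open in the restricted product, and integral points have
the box neighbourhoods of the product topology. -/
theorem restrictedProduct_exists_of_mem_nhds {ι : Type*} {R : ι → Type*} {A : ∀ i, Set (R i)}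
    [∀ i, TopologicalSpace (R i)] (hA : ∀ i, IsOpen (A i)) (x : ∀ i, A i)
    {W : Set (RestrictedProduct R A cofinite)}
    (hW : W ∈ 𝓝 (RestrictedProduct.structureMap R A cofinite x)) :
    ∃ (I : Finset ι) (t : ∀ i, Set (R i)), (∀ i, t i ∈ 𝓝 (x i : R i)) ∧
      ∀ y : ∀ i, A i, (∀ i ∈ I, (y i : R i) ∈ t i) →
        RestrictedProduct.structureMap R A cofinite y ∈ W := by
  rw [RestrictedProduct.nhds_eq_map_structureMap hA, Filter.mem_map, nhds_pi, Filter.mem_pi] at hW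
  obtain ⟨I, hI, t, ht, hsub⟩ := hW
  have ht' : ∀ i, ∃ s ∈ 𝓝 (x i : R i), Subtype.val ⁻¹' s ⊆ t i := fun i =>
    (mem_nhds_subtype _ _ _).mp (ht i)
  choose s hs hst using ht'
  exact ⟨hI.toFinset, s, hs, fun y hy => hsub fun i hi => hst i (hy i (hI.mem_toFinset.mpr hi))⟩

theorem finiteAdele_nhds_zero {W : Set (FiniteAdeleRing (𝓞 F) F)} (hW : W ∈ 𝓝 0) :
    ∃ (T : Finset (HeightOneSpectrum (𝓞 F))) (m : ℕ), ∀ a : FiniteAdeleRing (𝓞 F) F,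
      (∀ v, Valued.v (a v) ≤ 1) → (∀ v ∈ T, Valued.v (a v) ≤ WithZero.exp (-(m : ℤ))) → a ∈ W := by
  obtain ⟨I, t, ht, hsub⟩ := restrictedProduct_exists_of_mem_nhds
    (R := fun v : HeightOneSpectrum (𝓞 F) => v.adicCompletion F)
    (A := fun v => (v.adicCompletionIntegers F : Set (v.adicCompletion F)))
    (fun _ => Valued.isOpen_valuationSubring _) 0 (W := W) hW
  choose m hm using fun v => adicCompletion_nhds_zero v (ht v)
  exact ⟨I, I.sup m, fun a ha ha' => hsub (fun v => ⟨a v, ha v⟩)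
    fun v hv => hm v _ (Finset.le_sup (f := m) hv) _ (ha' v hv)⟩

/-- The finite adele supported at `v` with component `x`. -/
def finiteSingle (v : HeightOneSpectrum (𝓞 F)) : v.adicCompletion F →+ FiniteAdeleRing (𝓞 F) F :=
  open scoped Classical in
  { toFun := RestrictedProduct.single (fun v => v.adicCompletionIntegers F) v
    map_zero' := RestrictedProduct.single_zero _ v
    map_add' := RestrictedProduct.single_add _ v }

theorem finiteSingle_same (v : HeightOneSpectrum (𝓞 F)) (x : v.adicCompletion F) :
    finiteSingle v x v = x := by
  classical
  exact RestrictedProduct.single_eq_same _ v x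

theorem finiteSingle_of_ne {v w : HeightOneSpectrum (𝓞 F)} (h : w ≠ v) (x : v.adicCompletion F) :
    finiteSingle v x w = 0 := by
  classical
  exact RestrictedProduct.single_eq_of_ne _ x h

theorem finiteAdele_sub_apply (a b : FiniteAdeleRing (𝓞 F) F) (v) : (a - b) v = a v - b v := rfl
theorem finiteAdele_sum_apply {ι : Type*} (s : Finset ι) (f : ι → FiniteAdeleRing (𝓞 F) F) (v) :
    (∑ i ∈ s, f i) v = ∑ i ∈ s, f i v := by
  classical
  induction s using Finset.induction_on with
  | empty => rfl
  | insert i s hi ih => rw [Finset.sum_insert hi, Finset.sum_insert hi, ← ih]; rfl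

/-- Elements of `F` close to a given element at one place and small elsewhere. -/
theorem exists_approx (v : HeightOneSpectrum (𝓞 F)) (f : F) (T : Finset (HeightOneSpectrum (𝓞 F)))
    (m : ℕ) : ∃ g : F, v.valuation F (f - g) ≤ WithZero.exp (-(m : ℤ)) ∧
      (∀ w, w ≠ v → w.valuation F g ≤ 1) ∧
      ∀ w ∈ T, w ≠ v → w.valuation F g ≤ WithZero.exp (-(m : ℤ)) := by
  classical
  obtain ⟨p, d, hd, rfl⟩ := IsFractionRing.div_surjective (A := 𝓞 F) f
  have hd0 : d ≠ 0 := nonZeroDivisors.ne_zero hd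
  have hfin : {w : HeightOneSpectrum (𝓞 F) | w.asIdeal ∣ Ideal.span {d}}.Finite :=
    Ideal.finite_factors (by simpa using hd0)
  -- All places where `g` has to be controlled: `v`, those of `T`, and those dividing the
  -- denominator `d`.
  let T' := insert v (T ∪ hfin.toFinset)
  -- The exponent `e w` has to beat both the required precision `m` and the order of `d` at `w`.
  have he : ∀ w : HeightOneSpectrum (𝓞 F), ∃ e : ℕ,
      WithZero.exp (-(e : ℤ)) ≤ WithZero.exp (-(m : ℤ)) * w.intValuation d := fun w => by
    obtain ⟨e, he⟩ := exists_exp_neg_lt (mul_ne_zero (WithZero.exp_ne_zero (a := -(m : ℤ)))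
      (w.intValuation_ne_zero d hd0))
    exact ⟨e, (he e le_rfl).le⟩
  choose e he using he
  -- Chinese remainder theorem: `u` is close to `1` at `v` and close to `0` at the other places of
  -- `T'`. Then `g = p u / d`.
  obtain ⟨u, hu⟩ := IsDedekindDomain.exists_forall_sub_mem_ideal (s := T')
    (fun w : HeightOneSpectrum (𝓞 F) => w.asIdeal) e (fun w _ => w.prime)
    (fun w _ w' _ hne h => hne (HeightOneSpectrum.ext h)) (fun w => if w.1 = v then 1 else 0)
  have hdv : ∀ w : HeightOneSpectrum (𝓞 F), w.intValuation d ≠ 0 := fun w =>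
    w.intValuation_ne_zero d hd0
  have key : ∀ (w : HeightOneSpectrum (𝓞 F)) (x : 𝓞 F), x ∈ w.asIdeal ^ e w →
      w.valuation F (algebraMap (𝓞 F) F (p * x) / algebraMap (𝓞 F) F d)
        ≤ WithZero.exp (-(m : ℤ)) := by
    intro w x hx
    rw [map_div₀, valuation_of_algebraMap, valuation_of_algebraMap, map_mul]
    rw [div_le_iff₀ (zero_lt_iff.mpr (hdv w))]
    refine le_trans ?_ (he w)
    refine le_trans ?_ ((intValuation_le_pow_iff_mem w x (e w)).mpr hx)
    exact mul_le_of_le_one_left' (w.intValuation_le_one p)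
  have hT : ∀ w ∈ T', w ≠ v → w.valuation F (algebraMap (𝓞 F) F (p * u) / algebraMap (𝓞 F) F d)
      ≤ WithZero.exp (-(m : ℤ)) := by
    intro w hw hwv
    have := hu w hw
    simp only [hwv, if_false, sub_zero] at this
    exact key w u this
  refine ⟨algebraMap (𝓞 F) F (p * u) / algebraMap (𝓞 F) F d, ?_, fun w hwv => ?_,
    fun w hw => hT w (by simp [T', hw])⟩
  · have := hu v (by simp [T'])
    simp only [if_true] at this
    have h2 := key v _ this
    rw [Valuation.map_sub_swap]
    rw [mul_sub, mul_one, map_sub, sub_div] at h2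
    exact h2
  · by_cases hw : w ∈ T'
    · exact (hT w hw hwv).trans (by rw [← WithZero.exp_zero, WithZero.exp_le_exp]; omega)
    · have h1 : w.intValuation d = 1 := by
        by_contra hne
        have := (w.intValuation_lt_one_iff_dvd d).mp (lt_of_le_of_ne (w.intValuation_le_one d) hne)
        exact hw (Finset.mem_insert_of_mem (Finset.mem_union_right _ (hfin.mem_toFinset.mpr this)))
      rw [map_div₀, valuation_of_algebraMap, valuation_of_algebraMap, h1, div_one]
      exact w.intValuation_le_one _

/-- Strong approximation for the finite adeles. -/
theorem exists_sub_algebraMap_mem (V : AddSubgroup (FiniteAdeleRing (𝓞 F) F))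
    (hV : (V : Set (FiniteAdeleRing (𝓞 F) F)) ∈ 𝓝 0) (a : FiniteAdeleRing (𝓞 F) F) :
    ∃ f : F, a - algebraMap F _ f ∈ V := by
  classical
  obtain ⟨T, m, hTm⟩ := finiteAdele_nhds_zero hV
  -- It suffices that `F + V` is everything. As a group it contains finite sums of adeles supported
  -- at a single place, once it contains each of those.
  let V' : AddSubgroup (FiniteAdeleRing (𝓞 F) F) :=
    (algebraMap F (FiniteAdeleRing (𝓞 F) F)).toAddMonoidHom.range ⊔ V
  have hmono : WithZero.exp (-(m : ℤ)) ≤ 1 := by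
    rw [← WithZero.exp_zero, WithZero.exp_le_exp]; omega
  have hsingle : ∀ (v : HeightOneSpectrum (𝓞 F)) (x : v.adicCompletion F),
      finiteSingle v x ∈ V' := by
    intro v x
    have hball := adicCompletion_ball_mem_nhds v m
    have hball' : {y | Valued.v (x - y) ≤ WithZero.exp (-(m : ℤ))} ∈ 𝓝 x := by
      have hc : Tendsto (fun y => x - y) (𝓝 x) (𝓝 0) := by
        have : Continuous fun y : v.adicCompletion F => x - y := by fun_prop
        simpa using this.tendsto x
      exact hc hball
    obtain ⟨f, hf⟩ : ∃ f : F, Valued.v (x - algebraMap F (v.adicCompletion F) f)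
        ≤ WithZero.exp (-(m : ℤ)) := by
      obtain ⟨_, ⟨f, hf'⟩, hf⟩ :=
        (HeightOneSpectrum.denseRange_algebraMap (R := 𝓞 F) F v).inter_nhds_nonempty hball'
      exact ⟨f, by rw [hf']; exact hf⟩
    -- Density at `v` says nothing about `f` elsewhere, so `f` is replaced by a `g` which is as
    -- close to `x` at `v`, integral at the other places and small at those of `T`.
    obtain ⟨g, hg1, hg2, hg3⟩ := exists_approx v f T m
    have : finiteSingle v x - algebraMap F _ g ∈ V := by
      have hval : ∀ w, Valued.v ((finiteSingle v x - algebraMap F _ g) w) ≤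
          if w = v ∨ w ∈ T then WithZero.exp (-(m : ℤ)) else 1 := by
        intro w
        rw [finiteAdele_sub_apply, FiniteAdeleRing.algebraMap_apply]
        by_cases hw : w = v
        · subst hw
          rw [finiteSingle_same, if_pos (Or.inl rfl)]
          have : x - (g : w.adicCompletion F) =
              (x - algebraMap F _ f) + ((f - g : F) : w.adicCompletion F) := by
            rw [HeightOneSpectrum.algebraMap_adicCompletion]
            have : ((f - g : F) : w.adicCompletion F) = (f : w.adicCompletion F) - (g : w.adicCompletion F) :=
              map_sub (algebraMap F (w.adicCompletion F)) f g
            rw [this]; simp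
          rw [this]
          refine (Valuation.map_add _ _ _).trans (max_le hf ?_)
          rw [valuedAdicCompletion_eq_valuation']
          exact hg1
        · rw [finiteSingle_of_ne hw, zero_sub, Valuation.map_neg, valuedAdicCompletion_eq_valuation']
          split_ifs with h
          · exact hg3 w (h.resolve_left hw) hw
          · exact hg2 w hw
      refine hTm _ (fun w => (hval w).trans ?_) (fun w hw => (hval w).trans ?_)
      · split_ifs
        · exact hmono
        · exact le_rfl
      · rw [if_pos (Or.inr hw)]
    have h2 := V'.add_mem (show algebraMap F _ g ∈ V' from AddSubgroup.mem_sup_left ⟨g, rfl⟩)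
      (show _ ∈ V' from AddSubgroup.mem_sup_right this)
    simpa using h2
  -- The places where `a` is not integral are split off together with those of `T`. The rest is
  -- integral, and zero on `T`, so it lies in `V`.
  have hfin : {v | ¬ Valued.v (a v) ≤ 1}.Finite := by
    have := a.2
    rw [Filter.eventually_cofinite] at this
    exact this
  let T' := T ∪ hfin.toFinset
  have hsum : ∑ v ∈ T', finiteSingle v (a v) ∈ V' := V'.sum_mem fun v _ => hsingle v _
  have hrest : a - ∑ v ∈ T', finiteSingle v (a v) ∈ V := by
    have hval : ∀ w, (a - ∑ v ∈ T', finiteSingle v (a v)) w = if w ∈ T' then 0 else a w := by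
      intro w
      rw [finiteAdele_sub_apply, finiteAdele_sum_apply]
      split_ifs with h
      · rw [Finset.sum_eq_single_of_mem w h fun v _ hv => finiteSingle_of_ne (Ne.symm hv) _,
          finiteSingle_same, sub_self]
      · rw [Finset.sum_eq_zero, sub_zero]
        intro v hv
        exact finiteSingle_of_ne (by rintro rfl; exact h hv) _
    refine hTm _ (fun w => ?_) (fun w hw => ?_)
    · rw [hval]
      split_ifs with h
      · simp
      · by_contra hc
        exact h (Finset.mem_union_right _ (hfin.mem_toFinset.mpr hc))
    · rw [hval, if_pos (by simp [T', hw])]; simp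
  have ha : a ∈ V' := by
    have := V'.add_mem hsum (show _ ∈ V' from AddSubgroup.mem_sup_right hrest)
    simpa using this
  obtain ⟨_, ⟨f, rfl⟩, y, hy, hxy⟩ := AddSubgroup.mem_sup.mp ha
  exact ⟨f, by rw [← hxy]; simpa using hy⟩
end

/-! ### Approximation in the full adele ring -/

section
variable {F : Type u} [Field F]
open IsDedekindDomain IsDedekindDomain.HeightOneSpectrum NumberField Topology Filter Matrix

theorem infinitePlace_norm_natCast (v : InfinitePlace F) (m : ℕ) : ‖(m : v.Completion)‖ = m := by
  have h := (InfinitePlace.Completion.isometry_extensionEmbedding v).dist_eq (m : v.Completion) 0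
  rw [dist_eq_norm, dist_eq_norm, map_natCast, map_zero, sub_zero, sub_zero] at h
  rw [← h, Complex.norm_natCast]

/-- Every neighbourhood of zero contains a fraction of a given infinite adele. -/
theorem exists_nsmul_eq_of_mem_nhds {W : Set (InfiniteAdeleRing F)} (hW : W ∈ 𝓝 0)
    (x : InfiniteAdeleRing F) : ∃ (m : ℕ) (y : InfiniteAdeleRing F), y ∈ W ∧ m • y = x := by
  have hne : ∀ (v : InfinitePlace F) (m : ℕ), ((m + 1 : ℕ) : v.Completion) ≠ 0 := by
    intro v m h
    have := infinitePlace_norm_natCast v (m + 1)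
    rw [h, norm_zero] at this
    have h2 : ((m + 1 : ℕ) : ℝ) ≠ 0 := by positivity
    exact h2 this.symm
  -- The fractions `x / (m + 1)` tend to zero at every infinite place. The shift by one avoids
  -- division by zero.
  let y : ℕ → InfiniteAdeleRing F := fun m v => ((m + 1 : ℕ) : v.Completion)⁻¹ * x v
  have hy : Tendsto y atTop (𝓝 0) := by
    refine tendsto_pi_nhds.mpr fun v => ?_
    change Tendsto (fun m : ℕ => ((m + 1 : ℕ) : v.Completion)⁻¹ * x v) atTop (𝓝 0)
    rw [tendsto_zero_iff_norm_tendsto_zero]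
    have : (fun m : ℕ => ‖((m + 1 : ℕ) : v.Completion)⁻¹ * x v‖) =
        fun m : ℕ => (1 / ((m : ℝ) + 1)) * ‖x v‖ := by
      funext m
      rw [norm_mul, norm_inv, infinitePlace_norm_natCast]
      simp
    rw [this]
    simpa using tendsto_one_div_add_atTop_nhds_zero_nat.mul_const ‖x v‖
  obtain ⟨m, hm⟩ := (hy.eventually hW).exists
  refine ⟨m + 1, y m, hm, ?_⟩
  funext v
  change (m + 1) • (((m + 1 : ℕ) : v.Completion)⁻¹ * x v) = x v
  rw [nsmul_eq_mul, mul_inv_cancel_left₀ (hne v m)]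

variable [NumberField F]

theorem exists_mem_nhds_of_adele {W : Set (Adele F)} (hW : W ∈ 𝓝 0) :
    ∃ W₁ ∈ 𝓝 (0 : InfiniteAdeleRing F), ∃ W₂ ∈ 𝓝 (0 : FiniteAdeleRing (𝓞 F) F),
      ∀ a : Adele F, a.1 ∈ W₁ → a.2 ∈ W₂ → a ∈ W := by
  obtain ⟨W₁, h₁, W₂, h₂, h⟩ := (mem_nhds_prod_iff (x := (0 : InfiniteAdeleRing F))
    (y := (0 : FiniteAdeleRing (𝓞 F) F)) (s := W)).mp hW
  exact ⟨W₁, h₁, W₂, h₂, fun a ha hb => h (Set.mk_mem_prod ha hb)⟩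

/-- `F` is dense modulo any open additive subgroup of the adeles. -/
theorem exists_sub_algebraMap_mem_adele (V : AddSubgroup (Adele F))
    (hV : (V : Set (Adele F)) ∈ 𝓝 0) (a : Adele F) :
    ∃ f : F, a - algebraMap F (Adele F) f ∈ V := by
  obtain ⟨W₁, h₁, W₂, h₂, h⟩ := exists_mem_nhds_of_adele hV
  let i₁ : InfiniteAdeleRing F →+ Adele F := AddMonoidHom.inl _ (FiniteAdeleRing (𝓞 F) F)
  let i₂ : FiniteAdeleRing (𝓞 F) F →+ Adele F := AddMonoidHom.inr (InfiniteAdeleRing F) _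
  -- An open subgroup swallows the whole archimedean part, since every infinite adele is a multiple
  -- of a small one. Only the finite part needs approximation.
  have hinf : ∀ x, i₁ x ∈ V := by
    intro x
    obtain ⟨m, y, hy, rfl⟩ := exists_nsmul_eq_of_mem_nhds h₁ x
    rw [map_nsmul]
    exact V.nsmul_mem (h _ hy (mem_of_mem_nhds h₂)) m
  obtain ⟨f, hf⟩ := exists_sub_algebraMap_mem (V.comap i₂)
    (Filter.mem_of_superset h₂ fun x hx => h (i₂ x) (mem_of_mem_nhds h₁) hx) a.2
  refine ⟨f, ?_⟩
  have : a - algebraMap F (Adele F) f =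
      i₁ (a.1 - algebraMap F _ f) + i₂ (a.2 - algebraMap F _ f) := by
    refine Prod.ext ?_ ?_
    · exact (add_zero _).symm
    · exact (zero_add _).symm
  rw [this]
  exact V.add_mem (hinf _) hf

end

/-! ### Adelic transvections and neighbourhoods of the identity in the general linear group -/

section
open Matrix Topology Filter

/-- The transvection as an element of the general linear group. -/
def transvectionGL {ι R : Type*} [Fintype ι] [DecidableEq ι] [CommRing R] {i j : ι} (hij : i ≠ j)
    (a : R) : GL ι R :=
  SpecialLinearGroup.toGL (SpecialLinearGroup.transvection hij a)

theorem transvectionGL_add {ι R : Type*} [Fintype ι] [DecidableEq ι] [CommRing R] {i j : ι}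
    (hij : i ≠ j) (a b : R) :
    transvectionGL hij (a + b) = transvectionGL hij a * transvectionGL hij b := by
  rw [transvectionGL, SpecialLinearGroup.transvection_add, map_mul]; rfl

theorem transvectionGL_neg {ι R : Type*} [Fintype ι] [DecidableEq ι] [CommRing R] {i j : ι}
    (hij : i ≠ j) (a : R) : transvectionGL hij (-a) = (transvectionGL hij a)⁻¹ := by
  rw [transvectionGL, ← SpecialLinearGroup.transvection_inv, map_inv]; rfl

theorem transvectionGL_zero {ι R : Type*} [Fintype ι] [DecidableEq ι] [CommRing R] {i j : ι}
    (hij : i ≠ j) : transvectionGL hij (0 : R) = 1 := by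
  rw [transvectionGL, SpecialLinearGroup.transvection_coeff_zero, map_one]

theorem transvectionGL_coe {ι R : Type*} [Fintype ι] [DecidableEq ι] [CommRing R] {i j : ι}
    (hij : i ≠ j) (a : R) :
    (transvectionGL hij a : Matrix ι ι R) = 1 + Matrix.single i j a := rfl

theorem map_transvectionGL {ι R R' : Type*} [Fintype ι] [DecidableEq ι] [CommRing R] [CommRing R']
    (f : R →+* R') {i j : ι} (hij : i ≠ j) (a : R) :
    GeneralLinearGroup.map f (transvectionGL hij a) = transvectionGL hij (f a) := by
  ext k l
  rw [GeneralLinearGroup.map_apply, transvectionGL_coe, transvectionGL_coe]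
  simp only [Matrix.add_apply, map_add, Matrix.one_apply, Matrix.single_apply]
  split_ifs <;> simp

theorem continuous_transvectionGL {ι R : Type*} [Fintype ι] [DecidableEq ι] [CommRing R]
    [TopologicalSpace R] [IsTopologicalRing R] {i j : ι} (hij : i ≠ j) :
    Continuous (transvectionGL hij : R → GL ι R) := by
  have h : Continuous fun a : R => (1 : Matrix ι ι R) + Matrix.single i j a := by
    refine continuous_const.add (continuous_matrix fun k l => ?_)
    simp only [Matrix.single_apply]
    split_ifs
    · exact continuous_id
    · exact continuous_const
  refine Units.continuous_iff.mpr ⟨h, ?_⟩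
  have : (fun a : R => ((transvectionGL hij a)⁻¹ : GL ι R).1) =
      (fun a : R => (1 : Matrix ι ι R) + Matrix.single i j a) ∘ fun a => -a := by
    funext a
    rw [← transvectionGL_neg, transvectionGL_coe]; rfl
  rw [this]
  exact h.comp continuous_neg

/-- The elements which lie in `ι(G₀) U` for every open subgroup `U`. -/
def approximable {G G₀ : Type*} [Group G] [Group G₀] [TopologicalSpace G] [IsTopologicalGroup G]
    (ι : G₀ →* G) : Subgroup G where
  carrier := {s | ∀ U : Subgroup G, IsOpen (U : Set G) → ∃ g, (ι g)⁻¹ * s ∈ U}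
  one_mem' U _ := ⟨1, by simp⟩
  mul_mem' := by
    intro s t hs ht U hU
    obtain ⟨g, hg⟩ := ht U hU
    -- The factor `s` is approximated after `t`, with respect to the conjugate of `U` by `ι g`, so
    -- that `ι g` can be moved past it.
    obtain ⟨g', hg'⟩ := hs (U.comap (MulAut.conj (ι g)⁻¹).toMonoidHom)
      (hU.preimage (by simpa using! IsTopologicalGroup.continuous_conj (ι g)⁻¹))
    refine ⟨g' * g, ?_⟩
    have := U.mul_mem (Subgroup.mem_comap.mp hg') hg
    simpa [mul_assoc] using this
  inv_mem' := by
    intro s hs U hU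
    obtain ⟨g, hg⟩ := hs (U.comap (MulAut.conj s).toMonoidHom)
      (hU.preimage (by simpa using! IsTopologicalGroup.continuous_conj s))
    refine ⟨g⁻¹, ?_⟩
    have := U.inv_mem (Subgroup.mem_comap.mp hg)
    simpa [mul_assoc] using this

/-- Realization of local matrices by products of transvections supported at one place. -/
theorem exists_closure_transvection {ι : Type*} [Fintype ι] [DecidableEq ι] {A K : Type u}
    [CommRing A] [Field K] (e : K → A) (p : A →+* K) (hp : ∀ a, p (e a) = a)
    (X : Subgroup (SpecialLinearGroup ι A))
    (hX : ∀ (i j : ι) (hij : i ≠ j) (a : A), SpecialLinearGroup.transvection hij a ∈ X)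
    (M : SpecialLinearGroup ι K) :
    ∃ x ∈ X, SpecialLinearGroup.map p x = M ∧
      ∀ (L : Type u) [CommRing L] (q : A →+* L), (∀ a, q (e a) = 0) →
        SpecialLinearGroup.map q x = 1 := by
  have hmap : ∀ (L : Type u) [CommRing L] (q : A →+* L) (i j : ι) (hij : i ≠ j) (a : A),
      SpecialLinearGroup.map q (SpecialLinearGroup.transvection hij a) =
        SpecialLinearGroup.transvection hij (q a) := by
    intro L _ q i j hij a
    apply Subtype.ext
    change q.mapMatrix (1 + Matrix.single i j a) = 1 + Matrix.single i j (q a)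
    rw [map_add, map_one]
    congr 1
    ext k l
    simp only [RingHom.mapMatrix_apply, Matrix.map_apply, Matrix.single_apply]
    split_ifs <;> simp
  -- The section `e` need not be a homomorphism: a word in transvections over `K` is lifted letter
  -- by letter, and `p` sends the lifted word back to the original one.
  induction M using specialLinearGroup_transvection_induction with
  | h1 => exact ⟨1, X.one_mem, map_one _, fun L _ q _ => map_one _⟩
  | htransvec i j hij a =>
    refine ⟨_, hX i j hij (e a), ?_, fun L _ q hq => ?_⟩
    · rw [hmap, hp]
    · rw [hmap, hq, SpecialLinearGroup.transvection_coeff_zero]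
  | hmul M N hM hN =>
    obtain ⟨x, hx, hx1, hx2⟩ := hM
    obtain ⟨y, hy, hy1, hy2⟩ := hN
    exact ⟨x * y, X.mul_mem hx hy, by rw [map_mul, hx1, hy1], fun L _ q hq => by
      rw [map_mul, hx2 L q hq, hy2 L q hq, one_mul]⟩

theorem exists_nhds_zero_of_mem_nhds_pi {ι R : Type*} [Finite ι] [Zero R]
    [TopologicalSpace R] {W : Set (ι → ι → R)} (hW : W ∈ 𝓝 0) :
    ∃ W' ∈ 𝓝 (0 : R), ∀ f : ι → ι → R, (∀ i j, f i j ∈ W') → f ∈ W := by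
  rw [nhds_pi, Filter.mem_pi'] at hW
  obtain ⟨I, t, ht, hsub⟩ := hW
  have ht' : ∀ i, ∃ W' ∈ 𝓝 (0 : R), ∀ x : ι → R, (∀ j, x j ∈ W') → x ∈ t i := by
    intro i
    have := ht i
    rw [nhds_pi, Filter.mem_pi'] at this
    obtain ⟨J, s, hs, hsub⟩ := this
    exact ⟨⋂ j, s j, Filter.iInter_mem.mpr hs, fun x hx => hsub fun j _ => Set.mem_iInter.mp (hx j) j⟩
  choose W' hW' hx using ht'
  exact ⟨⋂ i, W' i, Filter.iInter_mem.mpr hW', fun f hf =>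
    hsub fun i _ => hx i _ fun j => Set.mem_iInter.mp (hf i j) i⟩

/-- A neighbourhood of `1` in `GL_n` contains all matrices `g` with `g - 1` and `g⁻¹ - 1` small. -/
theorem exists_nhds_zero_of_mem_nhds_one {ι R : Type*} [Fintype ι] [DecidableEq ι] [CommRing R]
    [TopologicalSpace R] [IsTopologicalRing R] {U : Set (GL ι R)} (hU : U ∈ 𝓝 1) :
    ∃ W ∈ 𝓝 (0 : R), ∀ g : GL ι R, (∀ i j, (g.1 - 1) i j ∈ W) → (∀ i j, (g⁻¹.1 - 1) i j ∈ W) →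
      g ∈ U := by
  have hM : ∀ W ∈ 𝓝 (1 : Matrix ι ι R), ∃ W' ∈ 𝓝 (0 : R),
      ∀ M : Matrix ι ι R, (∀ i j, (M - 1) i j ∈ W') → M ∈ W := by
    intro W hW
    have hc : Tendsto (fun M : Matrix ι ι R => M + 1) (𝓝 0) (𝓝 1) := by
      have : Continuous fun M : Matrix ι ι R => M + 1 := by fun_prop
      simpa using this.tendsto 0
    have h0 := hc hW
    obtain ⟨W', hW', h⟩ := exists_nhds_zero_of_mem_nhds_pi (R := R) (ι := ι)
      (W := (fun M : Matrix ι ι R => M + 1) ⁻¹' W) h0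
    exact ⟨W', hW', fun M hM => by
      have h2 : (M - 1) + 1 ∈ W := h (show Matrix ι ι R from M - 1) hM
      rwa [sub_add_cancel] at h2⟩
  -- The topology of the unit group is induced by `g ↦ (g, g⁻¹)`, whence conditions on both `g` and
  -- `g⁻¹`.
  rw [Units.isInducing_embedProduct.nhds_eq_comap, Filter.mem_comap] at hU
  obtain ⟨T, hT, hTU⟩ := hU
  rw [map_one, mem_nhds_prod_iff] at hT
  obtain ⟨u, hu, v, hv, huv⟩ := hT
  have hv' : MulOpposite.op ⁻¹' v ∈ 𝓝 (1 : Matrix ι ι R) :=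
    MulOpposite.continuous_op.continuousAt.preimage_mem_nhds hv
  obtain ⟨W₁, h₁, hW₁⟩ := hM u hu
  obtain ⟨W₂, h₂, hW₂⟩ := hM _ hv'
  refine ⟨W₁ ∩ W₂, Filter.inter_mem h₁ h₂, fun g hg hg' => hTU ?_⟩
  exact huv ⟨hW₁ _ fun i j => (hg i j).1, hW₂ _ fun i j => (hg' i j).2⟩

end

/-! ### Strong approximation for the special linear group -/

section
variable {F : Type u} [Field F] [NumberField F]
open IsDedekindDomain IsDedekindDomain.HeightOneSpectrum NumberField Topology Filter Matrix

variable (F) in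
/-- The projection of the adeles to a finite component. -/
def finiteProj (v : HeightOneSpectrum (𝓞 F)) : Adele F →+* v.adicCompletion F where
  toFun a := a.2 v
  map_zero' := rfl
  map_one' := rfl
  map_add' _ _ := rfl
  map_mul' _ _ := rfl

variable (F) in
/-- The projection of the adeles to an infinite component. -/
def infiniteProj (v : InfinitePlace F) : Adele F →+* v.Completion where
  toFun a := a.1 v
  map_zero' := rfl
  map_one' := rfl
  map_add' _ _ := rfl
  map_mul' _ _ := rfl

/-- The `a` whose transvection lies in `U` form an open additive subgroup of the adeles, and every
adele is congruent to an element of `F` modulo it. -/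
theorem transvectionGL_mem_approximable {n : ℕ} {i j : Fin n} (hij : i ≠ j) (a : Adele F) :
    transvectionGL hij a ∈ approximable (diagonalGL F n) := by
  intro U hU
  let V : AddSubgroup (Adele F) :=
    { carrier := {a | transvectionGL hij a ∈ U}
      zero_mem' := by
        rw [Set.mem_ofPred_eq, transvectionGL_zero]; exact U.one_mem
      add_mem' := fun {a b} ha hb => by
        rw [Set.mem_ofPred_eq, transvectionGL_add]; exact U.mul_mem ha hb
      neg_mem' := fun {a} ha => by
        rw [Set.mem_ofPred_eq, transvectionGL_neg]; exact U.inv_mem ha }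
  have hV : IsOpen (V : Set (Adele F)) := hU.preimage (continuous_transvectionGL hij)
  obtain ⟨f, hf⟩ := exists_sub_algebraMap_mem_adele V (hV.mem_nhds V.zero_mem) a
  refine ⟨transvectionGL hij f, ?_⟩
  rw [diagonalGL, map_transvectionGL, ← transvectionGL_neg, ← transvectionGL_add, neg_add_eq_sub]
  exact hf

/-- One place is corrected at a time. The inverse of the local component at `v` is a product of
transvections over the local field, and their lifts with entries supported at `v` are trivial at all
other places. -/
theorem exists_mem_map_finiteProj_eq_one {n : ℕ} (X : Subgroup (SpecialLinearGroup (Fin n) (Adele F)))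
    (hX : ∀ (i j : Fin n) (hij : i ≠ j) (a : Adele F), SpecialLinearGroup.transvection hij a ∈ X)
    (y : SpecialLinearGroup (Fin n) (Adele F)) (T : Finset (HeightOneSpectrum (𝓞 F))) :
    ∃ x ∈ X, (∀ v ∈ T, SpecialLinearGroup.map (finiteProj F v) (x * y) = 1) ∧
      (∀ v ∉ T, SpecialLinearGroup.map (finiteProj F v) (x * y) =
        SpecialLinearGroup.map (finiteProj F v) y) := by
  classical
  induction T using Finset.induction_on with
  | empty => exact ⟨1, X.one_mem, by simp, by simp⟩
  | insert v T hv ih =>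
    obtain ⟨x, hx, h1, h2⟩ := ih
    obtain ⟨z, hz, hz1, hz2⟩ := exists_closure_transvection (A := Adele F)
      (fun a => ((0, finiteSingle v a) : InfiniteAdeleRing F × FiniteAdeleRing (𝓞 F) F))
      (finiteProj F v) (fun a => finiteSingle_same v a) X hX
      (SpecialLinearGroup.map (finiteProj F v) (x * y))⁻¹
    have hz3 : ∀ w, w ≠ v → SpecialLinearGroup.map (finiteProj F w) z = 1 := fun w hw =>
      hz2 _ _ fun a => finiteSingle_of_ne hw a
    refine ⟨z * x, X.mul_mem hz hx, fun w hw => ?_, fun w hw => ?_⟩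
    · rw [mul_assoc, map_mul]
      by_cases hwv : w = v
      · subst hwv
        rw [hz1, inv_mul_cancel]
      · rw [hz3 w hwv, one_mul, h1 w (Finset.mem_of_mem_insert_of_ne hw hwv)]
    · rw [Finset.mem_insert, not_or] at hw
      rw [mul_assoc, map_mul, hz3 w hw.1, one_mul, h2 w hw.2]

/-- The same correction at infinite places; the lifts have zero finite entries, so the finite
components already arranged are kept. -/
theorem exists_mem_map_infiniteProj_eq_one {n : ℕ} (X : Subgroup (SpecialLinearGroup (Fin n) (Adele F)))
    (hX : ∀ (i j : Fin n) (hij : i ≠ j) (a : Adele F), SpecialLinearGroup.transvection hij a ∈ X)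
    (y : SpecialLinearGroup (Fin n) (Adele F)) (T : Finset (InfinitePlace F)) :
    ∃ x ∈ X, (∀ v ∈ T, SpecialLinearGroup.map (infiniteProj F v) (x * y) = 1) ∧
      (∀ v, SpecialLinearGroup.map (finiteProj F v) (x * y) =
        SpecialLinearGroup.map (finiteProj F v) y) := by
  classical
  induction T using Finset.induction_on with
  | empty => exact ⟨1, X.one_mem, by simp, by simp⟩
  | insert v T hv ih =>
    obtain ⟨x, hx, h1, h2⟩ := ih
    obtain ⟨z, hz, hz1, hz2⟩ := exists_closure_transvection (A := Adele F)
      (fun a => ((Pi.single v a, 0) : InfiniteAdeleRing F × FiniteAdeleRing (𝓞 F) F))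
      (infiniteProj F v) (fun a => Pi.single_eq_same v a) X hX
      (SpecialLinearGroup.map (infiniteProj F v) (x * y))⁻¹
    have hz3 : ∀ w, w ≠ v → SpecialLinearGroup.map (infiniteProj F w) z = 1 := fun w hw =>
      hz2 _ _ fun a => Pi.single_eq_of_ne hw a
    refine ⟨z * x, X.mul_mem hz hx, fun w hw => ?_, fun w => ?_⟩
    · rw [mul_assoc, map_mul]
      by_cases hwv : w = v
      · subst hwv
        rw [hz1, inv_mul_cancel]
      · rw [hz3 w hwv, one_mul, h1 w (Finset.mem_of_mem_insert_of_ne hw hwv)]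
    · rw [mul_assoc, map_mul, hz2 _ (finiteProj F w) fun a => rfl, one_mul, h2 w]

/-- Strong approximation for the special linear group. -/
theorem toGL_mem_approximable {n : ℕ} (y : SpecialLinearGroup (Fin n) (Adele F)) :
    SpecialLinearGroup.toGL y ∈ approximable (diagonalGL F n) := by
  classical
  intro U hU
  let X : Subgroup (SpecialLinearGroup (Fin n) (Adele F)) :=
    (approximable (diagonalGL F n)).comap SpecialLinearGroup.toGL
  have hX : ∀ (i j : Fin n) (hij : i ≠ j) (a : Adele F), SpecialLinearGroup.transvection hij a ∈ X :=
    fun i j hij a => transvectionGL_mem_approximable hij a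
  obtain ⟨W, hW, hWU⟩ := exists_nhds_zero_of_mem_nhds_one (hU.mem_nhds U.one_mem)
  obtain ⟨W₁, h₁, W₂, h₂, hW₁₂⟩ := exists_mem_nhds_of_adele hW
  obtain ⟨T, m, hT⟩ := finiteAdele_nhds_zero h₂
  have hfin : ∀ (s : SpecialLinearGroup (Fin n) (Adele F)),
      {v : HeightOneSpectrum (𝓞 F) | ∃ i j, ¬ Valued.v ((s.1 i j).2 v) ≤ 1}.Finite := by
    intro s
    have : {v : HeightOneSpectrum (𝓞 F) | ∃ i j, ¬ Valued.v ((s.1 i j).2 v) ≤ 1} =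
        ⋃ i, ⋃ j, {v | ¬ Valued.v ((s.1 i j).2 v) ≤ 1} := by
      ext v; simp
    rw [this]
    refine Set.finite_iUnion fun i => Set.finite_iUnion fun j => ?_
    have := (s.1 i j).2.2
    rw [Filter.eventually_cofinite] at this
    exact this
  -- Besides the places where the neighbourhood imposes smallness, `T'` contains those where `y` or
  -- `y⁻¹` is not integral. Off `T'` the finite components of `z` are those of `y`, hence integral
  -- together with their inverses.
  let T' := T ∪ ((hfin y).toFinset ∪ (hfin y⁻¹).toFinset)
  obtain ⟨x₁, hx₁, h1, h2⟩ := exists_mem_map_finiteProj_eq_one X hX y T'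
  obtain ⟨x₂, hx₂, h3, h4⟩ := exists_mem_map_infiniteProj_eq_one X hX (x₁ * y) Finset.univ
  set z := x₂ * (x₁ * y) with hz
  have hsmall : ∀ s : SpecialLinearGroup (Fin n) (Adele F),
      (∀ v, SpecialLinearGroup.map (infiniteProj F v) s = 1) →
      (∀ v ∈ T', SpecialLinearGroup.map (finiteProj F v) s = 1) →
      (∀ v ∉ T', ∀ i j, Valued.v ((s.1 i j).2 v) ≤ 1) →
      ∀ i j, (s.1 - 1) i j ∈ W := by
    intro s hs1 hs2 hs3 i j
    have hinf : ((s.1 - 1) i j).1 = 0 := by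
      funext v
      have h := congrArg (fun M => M.1 i j) (hs1 v)
      have h' : infiniteProj F v ((s.1 - 1) i j) = 0 := by
        rw [Matrix.sub_apply, map_sub]
        have h5 : infiniteProj F v (s.1 i j) = (1 : Matrix (Fin n) (Fin n) _) i j := h
        rw [h5, Matrix.one_apply, Matrix.one_apply]
        split_ifs <;> simp
      exact h'
    have hfinv : ∀ v, Valued.v (((s.1 - 1) i j).2 v) ≤ if v ∈ T' then 0 else 1 := by
      intro v
      change Valued.v (finiteProj F v ((s.1 - 1) i j)) ≤ _
      rw [Matrix.sub_apply, map_sub]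
      have hone : finiteProj F v ((1 : Matrix (Fin n) (Fin n) (Adele F)) i j) =
          (1 : Matrix (Fin n) (Fin n) (v.adicCompletion F)) i j := by
        rw [Matrix.one_apply, Matrix.one_apply]
        split_ifs <;> simp
      rw [hone]
      split_ifs with hv
      · have h5 : finiteProj F v (s.1 i j) = (1 : Matrix (Fin n) (Fin n) _) i j :=
          congrArg (fun M => M.1 i j) (hs2 v hv)
        rw [h5, sub_self, map_zero]
      · refine (Valuation.map_sub _ _ _).trans (max_le (hs3 v hv i j) ?_)
        rw [Matrix.one_apply]
        split_ifs <;> simp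
    refine hW₁₂ _ (by rw [hinf]; exact mem_of_mem_nhds h₁) (hT _ (fun v => ?_) fun v hv => ?_)
    · refine (hfinv v).trans ?_
      split_ifs <;> simp
    · refine (hfinv v).trans ?_
      rw [if_pos (Finset.mem_union_left _ hv)]
      exact zero_le
  have hz1 : ∀ v, SpecialLinearGroup.map (infiniteProj F v) z = 1 := fun v => h3 v (Finset.mem_univ v)
  have hz2 : ∀ v ∈ T', SpecialLinearGroup.map (finiteProj F v) z = 1 := fun v hv => by
    rw [hz, h4, h1 v hv]
  have hz3 : ∀ v ∉ T', SpecialLinearGroup.map (finiteProj F v) z =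
      SpecialLinearGroup.map (finiteProj F v) y := fun v hv => by
    rw [hz, h4, h2 v hv]
  have hzU : SpecialLinearGroup.toGL z ∈ U := by
    refine hWU _ (hsmall z hz1 hz2 fun v hv i j => ?_) ?_
    · have h5 : finiteProj F v (z.1 i j) = finiteProj F v (y.1 i j) :=
          congrArg (fun M => M.1 i j) (hz3 v hv)
      change Valued.v (finiteProj F v (z.1 i j)) ≤ 1
      rw [h5]
      by_contra hc
      exact hv (Finset.mem_union_right _ (Finset.mem_union_left _
        ((hfin y).mem_toFinset.mpr ⟨i, j, hc⟩)))
    · have : (SpecialLinearGroup.toGL z)⁻¹.1 = (z⁻¹).1 := by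
        rw [← map_inv]; rfl
      rw [this]
      refine hsmall z⁻¹ (fun v => by rw [map_inv, hz1, inv_one])
        (fun v hv => by rw [map_inv, hz2 v hv, inv_one]) fun v hv i j => ?_
      have h5 : finiteProj F v ((z⁻¹).1 i j) = finiteProj F v ((y⁻¹).1 i j) :=
          congrArg (fun M => M.1 i j) (show SpecialLinearGroup.map (finiteProj F v) z⁻¹ =
            SpecialLinearGroup.map (finiteProj F v) y⁻¹ by rw [map_inv, map_inv, hz3 v hv])
      change Valued.v (finiteProj F v ((z⁻¹).1 i j)) ≤ 1
      rw [h5]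
      by_contra hc
      exact hv (Finset.mem_union_right _ (Finset.mem_union_right _
        ((hfin y⁻¹).mem_toFinset.mpr ⟨i, j, hc⟩)))
  obtain ⟨g, hg⟩ := X.inv_mem (X.mul_mem hx₂ hx₁) U hU
  refine ⟨g, ?_⟩
  -- The factor `(x₂ * x₁)⁻¹` is approximable, being in `X`, and `z` already lies in `U`.
  have hyz : y = (x₂ * x₁)⁻¹ * z := by rw [hz]; group
  rw [hyz, map_mul, ← mul_assoc]
  exact U.mul_mem hg hzU

/-- Every element of determinant one lies in `GL_n(F) U`. -/
theorem mem_approximable_of_det {n : ℕ} (y : GL (Fin n) (Adele F))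
    (hy : Matrix.GeneralLinearGroup.det y = 1) : y ∈ approximable (diagonalGL F n) := by
  have h : y = SpecialLinearGroup.toGL ⟨y.1, congrArg Units.val hy⟩ := Units.ext rfl
  rw [h]
  exact toGL_mem_approximable _

end

/-! ### Ideal classes of determinants -/

section
variable {F : Type u} [Field F] [NumberField F]
open IsDedekindDomain IsDedekindDomain.HeightOneSpectrum NumberField Topology Filter Matrix

theorem idele_valued_ne_zero (x : (Adele F)ˣ) (v : HeightOneSpectrum (𝓞 F)) :
    Valued.v ((x : Adele F).2 v) ≠ 0 :=
  (Valuation.ne_zero_iff _).mpr ((x.isUnit.map (finiteProj F v)).ne_zero)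

theorem ideleOrd_mul (x y : (Adele F)ˣ) (v : HeightOneSpectrum (𝓞 F)) :
    ideleOrd (x * y) v = ideleOrd x v + ideleOrd y v := by
  have h : Valued.v (((x * y : (Adele F)ˣ) : Adele F).2 v) =
      Valued.v ((x : Adele F).2 v) * Valued.v ((y : Adele F).2 v) := map_mul Valued.v _ _
  rw [ideleOrd, ideleOrd, ideleOrd, h,
    WithZero.log_mul (idele_valued_ne_zero x v) (idele_valued_ne_zero y v)]
  ring

theorem ideleIdeal_mul (x y : (Adele F)ˣ) : ideleIdeal (x * y) = ideleIdeal x * ideleIdeal y := by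
  have hfin : ∀ x : (Adele F)ˣ, (Function.mulSupport fun v : HeightOneSpectrum (𝓞 F) =>
      (Units.mk0 (v.asIdeal : FractionalIdeal (𝓞 F)⁰ F)
        (FractionalIdeal.coeIdeal_ne_zero.mpr v.ne_bot)) ^ ideleOrd x v).Finite := fun x =>
    (ideleOrd_finite x).subset fun v hv h0 => hv (by simp [h0])
  rw [ideleIdeal, ideleIdeal, ideleIdeal, ← finprod_mul_distrib (hfin x) (hfin y)]
  exact finprod_congr fun v => by rw [ideleOrd_mul, _root_.zpow_add]

variable (F) in
/-- The class of the ideal of an idele, as a homomorphism. -/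
def ideleClassHom : (Adele F)ˣ →* ClassGroup (𝓞 F) :=
  MonoidHom.mk' ideleClass fun x y => by
    rw [ideleClass, ideleClass, ideleClass, ideleIdeal_mul, map_mul]

/-- For a fraction `p / d` the order at each `v` is the difference of the multiplicities of `v` in
`p` and `d`, so the product is the prime factorization of the principal fractional ideal. -/
theorem ideleIdeal_algebraMap (f : Fˣ) :
    (ideleIdeal (Units.map (algebraMap F (Adele F)).toMonoidHom f) : FractionalIdeal (𝓞 F)⁰ F) =
      FractionalIdeal.spanSingleton (𝓞 F)⁰ (f : F) := by
  classical
  obtain ⟨p, d, hpd⟩ := IsLocalization.exists_mk'_eq (𝓞 F)⁰ (f : F)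
  have hp : p ≠ 0 := by
    rintro rfl
    rw [IsLocalization.mk'_zero] at hpd
    exact f.ne_zero hpd.symm
  have hd : (d : 𝓞 F) ≠ 0 := nonZeroDivisors.coe_ne_zero d
  rw [← hpd, ← FractionalIdeal.finprod_heightOneSpectrum_factorization_principal_fraction hp d,
    ideleIdeal]
  have hfin : (Function.mulSupport fun v : HeightOneSpectrum (𝓞 F) =>
      (Units.mk0 (v.asIdeal : FractionalIdeal (𝓞 F)⁰ F)
        (FractionalIdeal.coeIdeal_ne_zero.mpr v.ne_bot)) ^
          ideleOrd (Units.map (algebraMap F (Adele F)).toMonoidHom f) v).Finite :=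
    (ideleOrd_finite (Units.map (algebraMap F (Adele F)).toMonoidHom f)).subset
      fun v hv h0 => hv (by simp only [h0, zpow_zero])
  rw [← Units.coeHom_apply, MonoidHom.map_finprod _ hfin]
  refine finprod_congr fun v => ?_
  rw [Units.coeHom_apply, Units.val_zpow_eq_zpow_val, Units.val_mk0]
  congr 1
  have hv : Valued.v (((Units.map (algebraMap F (Adele F)).toMonoidHom f : (Adele F)ˣ) : Adele F).2 v)
      = v.valuation F (f : F) := valuedAdicCompletion_eq_valuation' v (f : F)
  rw [ideleOrd, hv, ← hpd, valuation_of_mk', WithZero.log_div (v.intValuation_ne_zero p hp)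
    (v.intValuation_ne_zero d hd), v.intValuation_if_neg hp, v.intValuation_if_neg hd,
    WithZero.log_exp, WithZero.log_exp]
  ring

theorem ideleClass_algebraMap (f : Fˣ) :
    ideleClass (Units.map (algebraMap F (Adele F)).toMonoidHom f) = 1 := by
  rw [ideleClass, ClassGroup.mk_eq_one_iff]
  exact ⟨⟨(f : F), by rw [ideleIdeal_algebraMap, FractionalIdeal.coe_spanSingleton]⟩⟩

variable (F) in
/-- The class of the determinant. -/
def detClass (n : ℕ) : GL (Fin n) (Adele F) →* ClassGroup (𝓞 F) :=
  (ideleClassHom F).comp Matrix.GeneralLinearGroup.det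

theorem detClass_diagonalGL {n : ℕ} (g : GL (Fin n) F) : detClass F n (diagonalGL F n g) = 1 := by
  have : Matrix.GeneralLinearGroup.det (diagonalGL F n g) =
      Units.map (algebraMap F (Adele F)).toMonoidHom (Matrix.GeneralLinearGroup.det g) :=
    Matrix.GeneralLinearGroup.map_det _ g
  change ideleClass (Matrix.GeneralLinearGroup.det (diagonalGL F n g)) = 1
  rw [this, ideleClass_algebraMap]

/-- An element of `GL_n(F)` with given determinant, if that is the determinant of one. -/
theorem exists_mul_diagonalGL_of_detClass {n : ℕ} {α : ClassGroup (𝓞 F) → GL (Fin n) (Adele F)}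
    (hα : ∀ c, detClass F n (α c) = c⁻¹) {K : Subgroup (GL (Fin n) (Adele F))}
    (hopen : IsOpen (K : Set (GL (Fin n) (Adele F)))) (hK : ∀ κ ∈ K, detClass F n κ = 1)
    (hdet : ∀ x : (Adele F)ˣ, ∃ (c : ClassGroup (𝓞 F)) (g : GL (Fin n) F), ∃ κ ∈ K,
      Matrix.GeneralLinearGroup.det (α c * diagonalGL F n g * κ) = x)
    (β y : GL (Fin n) (Adele F)) (hy : detClass F n y = 1) :
    ∃ κ ∈ K, ∃ g, β * y = κ * β * diagonalGL F n g := by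
  have hcase : ∀ y, detClass F n y = 1 → ∃ g, ∃ κ ∈ K, y = diagonalGL F n g * (β⁻¹ * κ * β) := by
    intro y hy
    -- The determinant of `α 1` need not be one, so the hypothesis is applied to `α 1 * y`.
    -- Comparing classes forces `c = 1`, and the determinant of `α 1` cancels.
    obtain ⟨c, g, κ, hκ, h⟩ := hdet (Matrix.GeneralLinearGroup.det (α 1 * y))
    have hc : c = 1 := by
      have := congrArg (ideleClassHom F) h
      change detClass F n _ = detClass F n _ at this
      rw [map_mul, map_mul, map_mul, hα, hα, detClass_diagonalGL, hK κ hκ, hy] at this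
      simpa using this
    subst hc
    have h1 : Matrix.GeneralLinearGroup.det ((diagonalGL F n g)⁻¹ * y * (β⁻¹ * κ * β)⁻¹) = 1 := by
      simp only [map_mul, map_inv] at h ⊢
      have h2 : Matrix.GeneralLinearGroup.det y = 
        Matrix.GeneralLinearGroup.det (diagonalGL F n g) * Matrix.GeneralLinearGroup.det κ := by
        rw [mul_assoc] at h
        exact (mul_left_cancel h).symm
      rw [h2, inv_mul_cancel_left, mul_right_comm _ (Matrix.GeneralLinearGroup.det κ),
        inv_mul_cancel, one_mul, mul_inv_cancel]
    -- What is left has determinant one and is approximated with respect to the open subgroup `β⁻¹ K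
    -- β`.
    obtain ⟨g', hg'⟩ := mem_approximable_of_det _ h1 (K.comap (MulAut.conj β).toMonoidHom)
      (hopen.preimage (by simpa using! IsTopologicalGroup.continuous_conj β))
    have hg2 : β * ((diagonalGL F n g')⁻¹ * ((diagonalGL F n g)⁻¹ * y * (β⁻¹ * κ * β)⁻¹)) * β⁻¹ ∈ K :=
      hg'
    refine ⟨g * g', _, K.mul_mem hg2 hκ, ?_⟩
    rw [map_mul]
    group
  -- The case above has the rational factor on the left. Passing through `y⁻¹` puts it on the right.
  obtain ⟨g, κ, hκ, h⟩ := hcase y⁻¹ (by rw [map_inv, hy, inv_one])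
  refine ⟨κ⁻¹, K.inv_mem hκ, g⁻¹, ?_⟩
  have : y = (diagonalGL F n g * (β⁻¹ * κ * β))⁻¹ := by rw [← h, inv_inv]
  rw [this, map_inv]
  group

end

/-! ### Homogeneous cochains and homotopies -/

section Cochains

variable {V X Y : Type*} [AddCommGroup V]

/-- The differential of homogeneous cochains. -/
def coboundary (n : ℕ) (f : (Fin n → X) → V) : (Fin (n + 1) → X) → V := fun x =>
  ∑ i : Fin (n + 1), (-1 : ℤ) ^ (i : ℕ) • f (fun j => x (i.succAbove j))

theorem coboundary_add (n : ℕ) (f g : (Fin n → X) → V) :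
    coboundary n (f + g) = coboundary n f + coboundary n g := by
  funext x
  simp [coboundary, Finset.sum_add_distrib]

theorem coboundary_neg (n : ℕ) (f : (Fin n → X) → V) :
    coboundary n (-f) = -coboundary n f := by
  funext x
  simp [coboundary]

theorem coboundary_zero (n : ℕ) : coboundary n (0 : (Fin n → X) → V) = 0 := by
  funext x
  simp [coboundary]

theorem coboundary_sub (n : ℕ) (f g : (Fin n → X) → V) :
    coboundary n (f - g) = coboundary n f - coboundary n g := by
  rw [sub_eq_add_neg, coboundary_add, coboundary_neg, sub_eq_add_neg]

theorem coboundary_comp (n : ℕ) (f : (Fin n → Y) → V) (p : X → Y) :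
    coboundary n (fun x => f (p ∘ x)) = fun x => coboundary n f (p ∘ x) := rfl

/-- Omitting the first vertex returns `f x`; every other face keeps `a` and has its index, hence its
sign, shifted by one. This recursion drives the induction for the prism homotopy. -/
theorem coboundary_cons (n : ℕ) (f : (Fin (n + 1) → X) → V) (a : X) (x : Fin (n + 1) → X) :
    coboundary (n + 1) f (Fin.cons a x : Fin (n + 2) → X) =
      f x - coboundary n (fun z => f (Fin.cons a z : Fin (n + 1) → X)) x := by
  rw [coboundary, Fin.sum_univ_succ, sub_eq_add_neg, coboundary, ← Finset.sum_neg_distrib]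
  congr 1
  · simp
  · refine Finset.sum_congr rfl fun i _ => ?_
    have : (fun j => (Fin.cons a x : Fin (n + 2) → X) (i.succ.succAbove j)) =
        (Fin.cons a fun j => x (i.succAbove j) : Fin (n + 1) → X) := by
      funext j
      induction j using Fin.cases with
      | zero => simp
      | succ j => simp [Fin.succ_succAbove_succ]
    rw [this, Fin.val_succ, pow_succ, mul_neg, mul_one, neg_smul]

/-- The homotopy between the pullbacks under two maps. -/
def prism (p q : X → Y) : (n : ℕ) → ((Fin (n + 1) → Y) → V) → (Fin n → X) → V
  | 0, _, _ => 0
  | n + 1, f, x => f (Fin.cons (p (x 0)) (Fin.cons (q (x 0)) (q ∘ Fin.tail x) : Fin (n + 1) → Y)) -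
      prism p q n (fun z => f (Fin.cons (p (x 0)) z : Fin (n + 2) → Y)) (Fin.tail x)

theorem prism_cons (p q : X → Y) (n : ℕ) (f : (Fin (n + 2) → Y) → V) (a : X) (x : Fin n → X) :
    prism p q (n + 1) f (Fin.cons a x : Fin (n + 1) → X) =
      f (Fin.cons (p a) (Fin.cons (q a) (q ∘ x) : Fin (n + 1) → Y)) -
        prism p q n (fun z => f (Fin.cons (p a) z : Fin (n + 2) → Y)) x := by
  rw [prism, Fin.cons_zero, Fin.tail_cons]

/-- With `tX`, `tY` the translations by `γ`, `A` the action of `γ⁻¹` and `f = g` this is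
equivariance of the prism. Two functions are needed for the induction, since fixing the first vertex
of `f` destroys its equivariance and relates two different functions instead. -/
theorem prism_map (p q : X → Y) (A : V →+ V) (tX : X → X) (tY : Y → Y)
    (hp : ∀ x, p (tX x) = tY (p x)) (hq : ∀ x, q (tX x) = tY (q x)) (n : ℕ)
    (f g : (Fin (n + 1) → Y) → V) (h : ∀ y, g (tY ∘ y) = A (f y)) (x : Fin n → X) :
    prism p q n g (tX ∘ x) = A (prism p q n f x) := by
  induction n with
  | zero => simp [prism]
  | succ n ih =>
    rw [prism, prism, map_sub]
    congr 1
    · rw [← h]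
      congr 1
      funext i
      induction i using Fin.cases with
      | zero => simp [hp]
      | succ i =>
        induction i using Fin.cases with
        | zero => simp [hq]
        | succ i => simp [hq, Fin.tail]
    · refine ih _ _ (fun y => ?_) (Fin.tail x)
      rw [← h]
      congr 1
      funext i
      induction i using Fin.cases with
      | zero => simp [hp]
      | succ i => simp

theorem prism_sub (p q : X → Y) (n : ℕ) (f g : (Fin (n + 1) → Y) → V) (x : Fin n → X) :
    prism p q n (fun y => f y - g y) x = prism p q n f x - prism p q n g x := by
  induction n with
  | zero => simp [prism]
  | succ n ih =>
    rw [prism, prism, prism, ih]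
    abel

theorem prism_zero (p q : X → Y) (n : ℕ) (x : Fin n → X) :
    prism p q n (0 : (Fin (n + 1) → Y) → V) x = 0 := by
  have := prism_sub p q n (0 : (Fin (n + 1) → Y) → V) 0 x
  rw [sub_self] at this
  rw [← this]
  congr 1
  funext y
  simp

/-- The usual identity `d h + h d = q^* - p^*`, by induction after splitting off the first vertex:
the terms with vertices `p a, q a` cancel, and the rest is the case of `f(p a, ·)`. -/
theorem prism_homotopy (p q : X → Y) (n : ℕ) (f : (Fin (n + 1) → Y) → V) (x : Fin (n + 1) → X) :
    coboundary n (prism p q n f) x + prism p q (n + 1) (coboundary (n + 1) f) x =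
      f (q ∘ x) - f (p ∘ x) := by
  induction n with
  | zero =>
    obtain ⟨a, x, rfl⟩ : ∃ a, ∃ x' : Fin 0 → X, x = Fin.cons a x' :=
      ⟨x 0, Fin.tail x, (Fin.cons_self_tail x).symm⟩
    rw [prism_cons, coboundary_cons]
    have h1 : coboundary 0 (prism p q 0 f) (Fin.cons a x : Fin 1 → X) = 0 := by
      simp [coboundary, prism]
    rw [h1, coboundary, prism, zero_add, sub_zero, Fin.sum_univ_one]
    congr 1
    · congr 1
      funext i
      induction i using Fin.cases with
      | zero => simp
      | succ i => exact i.elim0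
    · rw [Fin.val_zero, pow_zero, one_smul]
      congr 1
      funext i
      induction i using Fin.cases with
      | zero => simp
      | succ i => exact i.elim0
  | succ n ih =>
    obtain ⟨a, x, rfl⟩ : ∃ a, ∃ x' : Fin (n + 1) → X, x = Fin.cons a x' :=
      ⟨x 0, Fin.tail x, (Fin.cons_self_tail x).symm⟩
    have hcons : ∀ (r : X → Y), r ∘ (Fin.cons a x : Fin (n + 2) → X) =
        (Fin.cons (r a) (r ∘ x) : Fin (n + 2) → Y) := fun r => by
      funext i
      induction i using Fin.cases <;> simp
    let g : (Fin n → Y) → V := fun y =>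
      f (Fin.cons (p a) (Fin.cons (q a) y : Fin (n + 1) → Y) : Fin (n + 2) → Y)
    have h1 : (fun z => prism p q (n + 1) f (Fin.cons a z : Fin (n + 1) → X)) =
        (fun z => g (q ∘ z)) - prism p q n (fun z => f (Fin.cons (p a) z : Fin (n + 2) → Y)) := by
      funext z
      rw [prism_cons]; rfl
    have h2 : (fun z => coboundary (n + 2) f (Fin.cons (p a) z : Fin (n + 3) → Y)) =
        fun z => f z - coboundary (n + 1) (fun z => f (Fin.cons (p a) z : Fin (n + 2) → Y)) z := by
      funext z
      rw [coboundary_cons]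
    rw [coboundary_cons, h1, coboundary_sub, coboundary_comp n g q, prism_cons, h2, prism_sub,
      coboundary_cons, coboundary_cons, hcons, hcons]
    have h3 := ih (fun z => f (Fin.cons (p a) z : Fin (n + 2) → Y)) x
    simp only [Pi.sub_apply, g]
    rw [eq_sub_iff_add_eq] at h3 ⊢
    rw [← h3]
    abel

end Cochains

/-! ### Equivariant cochains -/

section Equivariant

variable {k : Type u} [CommRing k] {G : Type u} [Group G] {V : Type u} [AddCommGroup V] [Module k V]
  {S : Submonoid G} (σ : S →* (Module.End k V)ᵐᵒᵖ)

/-- The right action of an element as a linear map. -/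
def ractHom (g : G) : Module.End k V :=
  open scoped Classical in if hg : g ∈ S then (σ ⟨g, hg⟩).unop else 0

theorem ract_eq (v : V) (g : G) : ract σ v g = ractHom σ g v := by
  unfold ract ractHom
  split_ifs <;> rfl

theorem ractHom_of_mem {g : G} (hg : g ∈ S) : ractHom σ g = (σ ⟨g, hg⟩).unop := dif_pos hg

theorem ractHom_one : ractHom σ (1 : G) = 1 := by
  rw [ractHom_of_mem σ S.one_mem]
  have : (⟨1, S.one_mem⟩ : S) = 1 := rfl
  rw [this, map_one, MulOpposite.unop_one]

theorem ractHom_mul {g h : G} (hg : g ∈ S) (hh : h ∈ S) (v : V) :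
    ractHom σ (g * h) v = ractHom σ h (ractHom σ g v) := by
  rw [ractHom_of_mem σ hg, ractHom_of_mem σ hh, ractHom_of_mem σ (S.mul_mem hg hh)]
  have : (⟨g * h, S.mul_mem hg hh⟩ : S) = ⟨g, hg⟩ * ⟨h, hh⟩ := rfl
  rw [this, map_mul, MulOpposite.unop_mul]
  rfl

variable (Γ : Subgroup G)

/-- `f(γ x₁, …, γ xₙ) = f(x₁, …, xₙ) γ⁻¹` for `γ ∈ Γ`. -/
def IsEquivariant {X : Type*} [SMul Γ X] {n : ℕ} (f : (Fin n → X) → V) : Prop :=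
  ∀ (γ : Γ) (x : Fin n → X), f (fun i => γ • x i) = ractHom σ (γ : G)⁻¹ (f x)

variable {σ Γ}

theorem IsEquivariant.add {X : Type*} [SMul Γ X] {n : ℕ} {f g : (Fin n → X) → V}
    (hf : IsEquivariant σ Γ f) (hg : IsEquivariant σ Γ g) : IsEquivariant σ Γ (f + g) := fun γ x => by
  rw [Pi.add_apply, Pi.add_apply, hf, hg, map_add]

theorem IsEquivariant.zero {X : Type*} [SMul Γ X] {n : ℕ} :
    IsEquivariant σ Γ (0 : (Fin n → X) → V) := fun γ x => by
  rw [Pi.zero_apply, Pi.zero_apply, map_zero]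

theorem IsEquivariant.smul {X : Type*} [SMul Γ X] {n : ℕ} {f : (Fin n → X) → V}
    (hf : IsEquivariant σ Γ f) (c : k) : IsEquivariant σ Γ (c • f) := fun γ x => by
  rw [Pi.smul_apply, Pi.smul_apply, hf, map_smul]

theorem IsEquivariant.coboundary {X : Type*} [SMul Γ X] {n : ℕ} {f : (Fin n → X) → V}
    (hf : IsEquivariant σ Γ f) : IsEquivariant σ Γ (coboundary n f) := fun γ x => by
  rw [AdelicHecke.coboundary, AdelicHecke.coboundary, map_sum]
  refine Finset.sum_congr rfl fun i _ => ?_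
  rw [hf γ fun j => x (i.succAbove j), map_zsmul]

theorem IsEquivariant.comp {X Y : Type*} [SMul Γ X] [SMul Γ Y] {n : ℕ} {f : (Fin n → Y) → V}
    (hf : IsEquivariant σ Γ f) {p : X → Y} (hp : ∀ (γ : Γ) x, p (γ • x) = γ • p x) :
    IsEquivariant σ Γ fun x => f (p ∘ x) := fun γ x =>
  (congrArg f (funext fun i => hp γ (x i))).trans (hf γ (p ∘ x))

variable (σ Γ)

/-- The homogeneous cocycles on `X` with respect to `Γ`. -/
def homCocycles (X : Type*) [SMul Γ X] (r : ℕ) : Submodule k ((Fin (r + 1) → X) → V) where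
  carrier := {f | IsEquivariant σ Γ f ∧ coboundary (r + 1) f = 0}
  zero_mem' := ⟨IsEquivariant.zero, coboundary_zero _⟩
  add_mem' := fun hf hg => ⟨hf.1.add hg.1, by rw [coboundary_add, hf.2, hg.2, add_zero]⟩
  smul_mem' := fun c f hf => ⟨hf.1.smul c, by
    have : coboundary (r + 1) (c • f) = c • coboundary (r + 1) f := by
      funext x
      simp only [coboundary, Pi.smul_apply, Finset.smul_sum]
      exact Finset.sum_congr rfl fun i _ => smul_comm _ _ _
    rw [this, hf.2, smul_zero]⟩

/-- The homogeneous coboundaries on `X` with respect to `Γ`. -/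
def IsCoboundary {X : Type*} [SMul Γ X] (r : ℕ) (f : (Fin (r + 1) → X) → V) : Prop :=
  -- For `r = 0` the map `coboundary 0` is the augmentation from constants, which is not part of the
  -- cochain complex. Requiring `h = 0` removes it.
  ∃ h : (Fin r → X) → V, IsEquivariant σ Γ h ∧ (r = 0 → h = 0) ∧ f = coboundary r h

variable {σ Γ}

theorem IsCoboundary.add {X : Type*} [SMul Γ X] {r : ℕ} {f g : (Fin (r + 1) → X) → V}
    (hf : IsCoboundary σ Γ r f) (hg : IsCoboundary σ Γ r g) : IsCoboundary σ Γ r (f + g) := by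
  obtain ⟨h, h1, h2, rfl⟩ := hf
  obtain ⟨h', h1', h2', rfl⟩ := hg
  exact ⟨h + h', h1.add h1', fun hr => by rw [h2 hr, h2' hr, add_zero], (coboundary_add _ _ _).symm⟩

theorem IsCoboundary.comp {X Y : Type*} [SMul Γ X] [SMul Γ Y] {r : ℕ} {f : (Fin (r + 1) → Y) → V}
    (hf : IsCoboundary σ Γ r f) {p : X → Y} (hp : ∀ (γ : Γ) x, p (γ • x) = γ • p x) :
    IsCoboundary σ Γ r fun x => f (p ∘ x) := by
  obtain ⟨h, h1, h2, rfl⟩ := hf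
  exact ⟨fun x => h (p ∘ x), h1.comp hp, fun hr => by rw [h2 hr]; rfl, (coboundary_comp _ _ _).symm⟩

theorem homCocycles_comp {X Y : Type*} [SMul Γ X] [SMul Γ Y] {r : ℕ} {f : (Fin (r + 1) → Y) → V}
    (hf : f ∈ homCocycles σ Γ Y r) {p : X → Y} (hp : ∀ (γ : Γ) x, p (γ • x) = γ • p x) :
    (fun x => f (p ∘ x)) ∈ homCocycles σ Γ X r :=
  ⟨hf.1.comp hp, by rw [coboundary_comp, hf.2]; rfl⟩

/-- Pullbacks of a cocycle under two equivariant maps are cohomologous. -/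
theorem isCoboundary_comp_sub_comp {X Y : Type*} [SMul Γ X] [SMul Γ Y] {r : ℕ}
    {f : (Fin (r + 1) → Y) → V} (hf : f ∈ homCocycles σ Γ Y r) {p q : X → Y}
    (hp : ∀ (γ : Γ) x, p (γ • x) = γ • p x) (hq : ∀ (γ : Γ) x, q (γ • x) = γ • q x) :
    IsCoboundary σ Γ r ((fun x => f (q ∘ x)) - fun x => f (p ∘ x)) := by
  refine ⟨prism p q r f, fun γ x => ?_, fun hr => ?_, ?_⟩
  · exact prism_map p q (ractHom σ (γ : G)⁻¹).toAddMonoidHom (γ • ·) (γ • ·) (hp γ) (hq γ) r f f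
      (fun y => hf.1 γ y) x
  · subst hr; rfl
  · funext x
    have := prism_homotopy p q r f x
    rw [hf.2, prism_zero, add_zero] at this
    exact this.symm

end Equivariant

/-! ### Comparison of homogeneous cocycles with group cohomology -/

section Classes

variable {k : Type u} [CommRing k] {G : Type u} [Group G] {V : Type u} [AddCommGroup V] [Module k V]
  {S : Submonoid G} (σ : S →* (Module.End k V)ᵐᵒᵖ) (Γ : Subgroup G)

theorem leftRep_apply (hΓ : ∀ γ ∈ Γ, γ ∈ S) (g : Γ) (v : V) :
    (leftRep σ Γ hΓ).ρ g v = ractHom σ (g : G)⁻¹ v := by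
  rw [ractHom_of_mem σ (hΓ _ (Γ.inv_mem g.2))]; rfl

variable {Γ}

theorem ractHom_inv_ractHom (hΓ : ∀ γ ∈ Γ, γ ∈ S) {γ : G} (hγ : γ ∈ Γ) (v : V) :
    ractHom σ γ⁻¹ (ractHom σ γ v) = v := by
  rw [← ractHom_mul σ (hΓ _ hγ) (hΓ _ (Γ.inv_mem hγ)), mul_inv_cancel, ractHom_one]; rfl

/-- The inhomogeneous cochain attached to a homogeneous one. -/
def inhomogeneous {n : ℕ} (f : (Fin (n + 1) → Γ) → V) : (Fin n → Γ) → V :=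
  fun g => f (Fin.partialProd g)

/-- The homogeneous cochain attached to an inhomogeneous one. -/
def homogeneous {n : ℕ} (w : (Fin n → Γ) → V) : (Fin (n + 1) → Γ) → V :=
  fun γ => ractHom σ (γ 0 : G)⁻¹ (w fun i => (γ i.castSucc)⁻¹ * γ i.succ)

theorem homogeneous_isEquivariant (hΓ : ∀ γ ∈ Γ, γ ∈ S) {n : ℕ} (w : (Fin n → Γ) → V) :
    IsEquivariant σ Γ (homogeneous σ w) := fun γ x => by
  rw [homogeneous, homogeneous, ← ractHom_mul σ (hΓ _ (Γ.inv_mem (x 0).2)) (hΓ _ (Γ.inv_mem γ.2))]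
  have h1 : ((γ • x 0 : Γ) : G)⁻¹ = (x 0 : G)⁻¹ * (γ : G)⁻¹ := by
    rw [smul_eq_mul, Subgroup.coe_mul, mul_inv_rev]
  have h2 : (fun i : Fin n => (γ • x i.castSucc)⁻¹ * (γ • x i.succ)) =
      fun i => (x i.castSucc)⁻¹ * x i.succ := by
    funext i
    rw [smul_eq_mul, smul_eq_mul]
    group
  rw [h1, h2]

theorem inhomogeneous_homogeneous {n : ℕ} (w : (Fin n → Γ) → V) :
    inhomogeneous (homogeneous σ w) = w := by
  funext g
  rw [inhomogeneous, homogeneous, Fin.partialProd_zero, OneMemClass.coe_one, inv_one, ractHom_one]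
  change w _ = w g
  congr 1
  funext i
  exact Fin.partialProd_right_inv g i

variable {σ}

/-- Equivariance moves the first argument to `1`, and a tuple starting with `1` is the sequence of
partial products of its successive quotients. -/
theorem IsEquivariant.eq_of_inhomogeneous {n : ℕ} {f f' : (Fin (n + 1) → Γ) → V}
    (hf : IsEquivariant σ Γ f) (hf' : IsEquivariant σ Γ f')
    (h : inhomogeneous f = inhomogeneous f') : f = f' := by
  funext γ
  have hγ : γ = fun i => γ 0 • Fin.partialProd (fun i => (γ (Fin.castSucc i))⁻¹ * γ i.succ) i :=
    (Fin.partialProd_left_inv γ).symm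
  rw [hγ, hf, hf']
  exact congrArg _ (congrFun h _)

variable (hΓ : ∀ γ ∈ Γ, γ ∈ S)

/-- Omitting the initial `1` leaves `g 0` times partial products, and equivariance turns this into
the action of `g 0`. Omitting a later vertex multiplies two neighbouring entries, or drops the last
one. -/
theorem inhomogeneous_coboundary {n : ℕ} {f : (Fin (n + 1) → Γ) → V} (hf : IsEquivariant σ Γ f) :
    inhomogeneous (coboundary (n + 1) f) =
      inhomogeneousCochains.d (leftRep σ Γ hΓ) n (inhomogeneous f) := by
  funext g
  have h1 : inhomogeneousCochains.d (leftRep σ Γ hΓ) n (inhomogeneous f) g =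
      ractHom σ ((g 0 : Γ) : G)⁻¹ (inhomogeneous f fun i => g i.succ) +
        Finset.univ.sum fun j : Fin (n + 1) =>
          (-1 : k) ^ ((j : ℕ) + 1) • inhomogeneous f (Fin.contractNth j (· * ·) g) := by
    rw [← leftRep_apply σ Γ hΓ]
    rfl
  refine Eq.trans ?_ h1.symm
  rw [inhomogeneous, coboundary, Fin.sum_univ_succ]
  congr 1
  · rw [Fin.val_zero, pow_zero, one_smul, inhomogeneous, ← hf]
    congr 1
    funext j
    rw [Fin.zero_succAbove, Fin.partialProd_succ']
    rfl
  · refine Finset.sum_congr rfl fun j _ => ?_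
    have h2 : inhomogeneous f (Fin.contractNth j (· * ·) g) =
        f fun i => Fin.partialProd g (j.succ.succAbove i) := by
      rw [inhomogeneous, Fin.partialProd_contractNth]
      rfl
    rw [h2, Fin.val_succ]
    rcases Nat.even_or_odd ((j : ℕ) + 1) with h | h
    · rw [h.neg_one_pow, h.neg_one_pow, one_smul, one_smul]
    · rw [h.neg_one_pow, h.neg_one_pow, neg_smul, neg_smul, one_smul, one_smul]

theorem inhomogeneous_coboundary_homogeneous {n : ℕ} (w : (Fin n → Γ) → V) :
    inhomogeneous (coboundary (n + 1) (homogeneous σ w)) =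
      inhomogeneousCochains.d (leftRep σ Γ hΓ) n w :=
  (inhomogeneous_coboundary hΓ (homogeneous_isEquivariant σ hΓ w)).trans
    (congrArg (inhomogeneousCochains.d (leftRep σ Γ hΓ) n) (inhomogeneous_homogeneous σ w))

theorem inhomogeneous_mem {r : ℕ} {f : (Fin (r + 1) → Γ) → V} (hf : f ∈ homCocycles σ Γ Γ r) :
    inhomogeneousCochains.d (leftRep σ Γ hΓ) r (inhomogeneous f) = 0 := by
  rw [← inhomogeneous_coboundary hΓ hf.1, hf.2]
  rfl

theorem iCocycles_injective (A : Rep.{u} k Γ) (r : ℕ) :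
    Function.Injective (groupCohomology.iCocycles A r) :=
  (ModuleCat.mono_iff_injective _).mp inferInstance

/-- The cohomology class of a homogeneous cocycle. -/
def classOf (r : ℕ) : homCocycles σ Γ Γ r →ₗ[k] cohomology σ Γ hΓ r where
  toFun f := groupCohomology.π (leftRep σ Γ hΓ) r
    (groupCohomology.cocyclesMk (inhomogeneous f.1) (inhomogeneous_mem hΓ f.2))
  map_add' f g := by
    rw [← map_add]
    congr 1
    apply iCocycles_injective
    rw [map_add, groupCohomology.iCocycles_mk, groupCohomology.iCocycles_mk,
      groupCohomology.iCocycles_mk]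
    rfl
  map_smul' c f := by
    rw [RingHom.id_apply, ← map_smul]
    congr 1
    apply iCocycles_injective
    rw [map_smul, groupCohomology.iCocycles_mk, groupCohomology.iCocycles_mk]
    rfl

theorem isHomogeneousCocycle_iff {r : ℕ} (f : (Fin (r + 1) → Γ) → V) :
    IsHomogeneousCocycle σ Γ f ↔ f ∈ homCocycles σ Γ Γ r := by
  refine and_congr ?_ ?_
  · simp only [ract_eq]; rfl
  · exact ⟨fun h => funext h, fun h => congrFun h⟩

/-- The cocycle in `LiesIn` is determined by its underlying cochain, so the class of `f` is unique
and depends linearly on `f`. -/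
theorem liesIn_iff {r : ℕ} (f : (Fin (r + 1) → Γ) → V) (ξ : cohomology σ Γ hΓ r) :
    LiesIn σ Γ hΓ f ξ ↔ ∃ h : f ∈ homCocycles σ Γ Γ r, classOf hΓ r ⟨f, h⟩ = ξ := by
  rw [LiesIn, isHomogeneousCocycle_iff]
  constructor
  · rintro ⟨h, z, hz, rfl⟩
    refine ⟨h, ?_⟩
    change groupCohomology.π _ _ _ = _
    congr 1
    apply iCocycles_injective
    rw [groupCohomology.iCocycles_mk]
    exact funext fun g => (hz g).symm
  · rintro ⟨h, rfl⟩
    exact ⟨h, _, fun g => congrFun (groupCohomology.iCocycles_mk (inhomogeneous f)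
      (inhomogeneous_mem hΓ h)) g, rfl⟩

theorem classOf_surjective (r : ℕ) : Function.Surjective (classOf (σ := σ) hΓ r) := by
  intro ξ
  induction ξ using groupCohomology_induction_on with
  | h z =>
    let w : (Fin r → Γ) → V := groupCohomology.iCocycles (leftRep σ Γ hΓ) r z
    have hw : inhomogeneousCochains.d (leftRep σ Γ hΓ) r w = 0 := by
      have h := (groupCohomology.inhomogeneousCochains (leftRep σ Γ hΓ)).iCycles_d r (r + 1)
      rw [groupCohomology.inhomogeneousCochains.d_def] at h
      exact congrArg (fun φ => φ.hom z) h
    have he := homogeneous_isEquivariant σ hΓ w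
    have hmem : homogeneous σ w ∈ homCocycles σ Γ Γ r := by
      refine ⟨he, he.coboundary.eq_of_inhomogeneous IsEquivariant.zero ?_⟩
      exact (inhomogeneous_coboundary_homogeneous hΓ w).trans hw
    refine ⟨⟨_, hmem⟩, ?_⟩
    change groupCohomology.π _ _ _ = _
    congr 1
    apply iCocycles_injective
    rw [groupCohomology.iCocycles_mk]
    exact inhomogeneous_homogeneous σ w

/-- Homology is the cokernel of the map from the preceding cochains to the cocycles, so this
sequence is exact at the cocycles. -/
theorem π_eq_zero_iff (A : Rep.{u} k Γ) (r : ℕ) (z : groupCohomology.cocycles A r) :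
    groupCohomology.π A r z = 0 ↔
      ∃ w, groupCohomology.toCocycles A ((ComplexShape.up ℕ).prev r) r w = z := by
  have h := CategoryTheory.ShortComplex.exact_of_g_is_cokernel
    (CategoryTheory.ShortComplex.mk _ _
      ((groupCohomology.inhomogeneousCochains A).toCycles_comp_homologyπ
        ((ComplexShape.up ℕ).prev r) r))
    ((groupCohomology.inhomogeneousCochains A).homologyIsCokernel _ r rfl)
  rw [CategoryTheory.ShortComplex.moduleCat_exact_iff] at h
  refine ⟨fun hz => h z hz, ?_⟩
  rintro ⟨w, rfl⟩
  exact congrArg (fun φ => φ.hom w) ((groupCohomology.inhomogeneousCochains A).toCycles_comp_homologyπ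
        ((ComplexShape.up ℕ).prev r) r)

theorem classOf_eq_zero_iff {r : ℕ} (f : homCocycles σ Γ Γ r) :
    classOf hΓ r f = 0 ↔ IsCoboundary σ Γ r f.1 := by
  change groupCohomology.π _ _ _ = 0 ↔ _
  rw [π_eq_zero_iff]
  have hcomp : ∀ i w, groupCohomology.iCocycles (leftRep σ Γ hΓ) r
      (groupCohomology.toCocycles (leftRep σ Γ hΓ) i r w) =
      (groupCohomology.inhomogeneousCochains (leftRep σ Γ hΓ)).d i r w := fun i w =>
    congrArg (fun φ => φ.hom w)
      ((groupCohomology.inhomogeneousCochains (leftRep σ Γ hΓ)).toCycles_i i r)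
  cases r with
  | zero =>
    constructor
    · rintro ⟨w, hw⟩
      have h1 := congrArg (groupCohomology.iCocycles (leftRep σ Γ hΓ) 0) hw
      -- No degree precedes `0`, so the differential into degree `0` is zero.
      rw [hcomp, (groupCohomology.inhomogeneousCochains (leftRep σ Γ hΓ)).shape _ _ (by simp),
        groupCohomology.iCocycles_mk] at h1
      refine ⟨0, IsEquivariant.zero, fun _ => rfl, ?_⟩
      rw [coboundary_zero]
      exact f.2.1.eq_of_inhomogeneous IsEquivariant.zero h1.symm
    · rintro ⟨h, -, h0, hf⟩
      rw [h0 rfl, coboundary_zero] at hf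
      refine ⟨0, ?_⟩
      apply iCocycles_injective
      rw [groupCohomology.iCocycles_mk, hf, map_zero, map_zero]
      rfl
  | succ s =>
    rw [show (ComplexShape.up ℕ).prev (s + 1) = s from CochainComplex.prev_nat_succ s]
    constructor
    · rintro ⟨w, hw⟩
      have h1 := congrArg (groupCohomology.iCocycles (leftRep σ Γ hΓ) (s + 1)) hw
      rw [hcomp, groupCohomology.inhomogeneousCochains.d_def, groupCohomology.iCocycles_mk] at h1
      have he := homogeneous_isEquivariant σ hΓ (w : (Fin s → Γ) → V)
      refine ⟨homogeneous σ (w : (Fin s → Γ) → V), he, fun h => by omega, ?_⟩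
      refine f.2.1.eq_of_inhomogeneous he.coboundary ?_
      exact h1.symm.trans (inhomogeneous_coboundary_homogeneous hΓ w).symm
    · rintro ⟨h, he, -, hf⟩
      refine ⟨inhomogeneous h, ?_⟩
      apply iCocycles_injective
      rw [hcomp, groupCohomology.inhomogeneousCochains.d_def, groupCohomology.iCocycles_mk, hf]
      exact (inhomogeneous_coboundary hΓ he).symm

end Classes

/-! ### Hecke operators on cochains -/

section HeckeOperators

variable {k : Type u} [CommRing k] {G : Type u} [Group G] {V : Type u} [AddCommGroup V] [Module k V]
  {S : Submonoid G} (σ : S →* (Module.End k V)ᵐᵒᵖ) {Γ Γ' : Subgroup G}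

/-- The contribution `F(δ g) δ` of a coset `Γ δ`, computed with the standard representative. -/
def heckeTerm {n : ℕ} (F : (Fin n → G) → V) (g : Fin n → G) (x : CosetSpace Γ) : V :=
  ractHom σ x.out (F fun i => x.out * g i)

/-- The cochain `F | T` on `G`. -/
def heckeOp {n : ℕ} (T : CosetSpace Γ →₀ ℤ) (F : (Fin n → G) → V) : (Fin n → G) → V := fun g =>
  Finsupp.linearCombination ℤ (heckeTerm σ F g) T

variable {σ}

theorem out_mem {Δ : Set G} (hΔ : ∀ δ ∈ Δ, δ ∈ S) {T : CosetSpace Γ →₀ ℤ}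
    (hT : T ∈ heckeModule Γ Γ' Δ) {x : CosetSpace Γ} (hx : x ∈ T.support) : x.out ∈ S := by
  refine hΔ _ (hT.1 _ ?_)
  have : coset Γ x.out = x := Quotient.out_eq _
  rw [this]
  exact Finsupp.mem_support_iff.mp hx

/-- If `d` is replaced by `γ d`, equivariance contributes `γ⁻¹`, which cancels against the action of
`γ d`. Hence any representative computes the term. -/
theorem heckeTerm_coset (hΓ : ∀ γ ∈ Γ, γ ∈ S) {n : ℕ} {F : (Fin n → G) → V}
    (hF : IsEquivariant σ Γ F) (g : Fin n → G) {d : G} (hd : d ∈ S) :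
    heckeTerm σ F g (coset Γ d) = ractHom σ d (F fun i => d * g i) := by
  have h1 : coset Γ (coset Γ d).out = coset Γ d := Quotient.out_eq _
  have hγ := coset_eq.mp h1.symm
  have h2 : (coset Γ d).out = (coset Γ d).out * d⁻¹ * d := by simp
  rw [heckeTerm]
  generalize (coset Γ d).out * d⁻¹ = γ at hγ h2
  rw [h2]
  have h3 : (fun i => γ * d * g i) = fun i => (⟨γ, hγ⟩ : Γ) • (d * g i) := by
    funext i
    rw [mul_assoc]; rfl
  rw [h3, hF, ractHom_mul σ (hΓ _ hγ) hd]
  congr 1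
  have := ractHom_inv_ractHom σ hΓ (Γ.inv_mem hγ) (F fun i => d * g i)
  rwa [inv_inv] at this

/-- The identity `(F|T)(h g) h = (F|T h)(g)`. For `h ∈ Γ'` and `T` invariant it gives equivariance
of `F|T`; summed over the cosets of a second operator it gives composition. -/
theorem ractHom_heckeOp (hΓ : ∀ γ ∈ Γ, γ ∈ S) {n : ℕ} {F : (Fin n → G) → V}
    (hF : IsEquivariant σ Γ F) {T : CosetSpace Γ →₀ ℤ} (hT : ∀ x ∈ T.support, x.out ∈ S)
    {h : G} (hh : h ∈ S) (g : Fin n → G) :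
    ractHom σ h (heckeOp σ T F fun i => h * g i) = heckeOp σ (translate h T) F g := by
  rw [heckeOp, heckeOp, translate, Finsupp.lmapDomain_apply, Finsupp.linearCombination_mapDomain,
    Finsupp.linearCombination_apply, Finsupp.linearCombination_apply, Finsupp.sum, Finsupp.sum,
    map_sum]
  refine Finset.sum_congr rfl fun x hx => ?_
  rw [map_zsmul]
  congr 1
  have h1 := heckeTerm_coset hΓ hF g (S.mul_mem (hT x hx) hh)
  rw [ractHom_mul σ (hT x hx) hh] at h1
  refine Eq.trans ?_ h1.symm
  rw [heckeTerm]
  simp only [mul_assoc]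

theorem heckeOp_isEquivariant (hΓ : ∀ γ ∈ Γ, γ ∈ S) (hΓ' : ∀ γ ∈ Γ', γ ∈ S) {Δ : Set G}
    (hΔ : ∀ δ ∈ Δ, δ ∈ S) {T : CosetSpace Γ →₀ ℤ} (hT : T ∈ heckeModule Γ Γ' Δ) {n : ℕ}
    {F : (Fin n → G) → V} (hF : IsEquivariant σ Γ F) : IsEquivariant σ Γ' (heckeOp σ T F) :=
  fun γ g => by
  have h1 := ractHom_heckeOp hΓ hF (fun x hx => out_mem hΔ hT hx) (hΓ' _ γ.2) g
  rw [translate_eq_self hT γ.2] at h1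
  rw [← h1, ractHom_inv_ractHom σ hΓ' γ.2]
  rfl

theorem coboundary_heckeOp {n : ℕ} (T : CosetSpace Γ →₀ ℤ) (F : (Fin n → G) → V) :
    coboundary n (heckeOp σ T F) = heckeOp σ T (coboundary n F) := by
  funext g
  simp only [coboundary, heckeOp, Finsupp.linearCombination_apply, Finsupp.sum, heckeTerm, map_sum,
    map_zsmul, Finset.smul_sum]
  rw [Finset.sum_comm]
  exact Finset.sum_congr rfl fun _ _ => Finset.sum_congr rfl fun _ _ => smul_comm _ _ _

/-- An equality of cochains, not just of classes: this is the gain from working with cochains on all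
of `G`, where no maps `tⱼ` intervene. -/
theorem heckeOp_heckeOp (hΓ : ∀ γ ∈ Γ, γ ∈ S) {n : ℕ} {F : (Fin n → G) → V}
    (hF : IsEquivariant σ Γ F) {T : CosetSpace Γ →₀ ℤ} (hT : ∀ x ∈ T.support, x.out ∈ S)
    {T' : CosetSpace Γ' →₀ ℤ} (hT' : ∀ x ∈ T'.support, x.out ∈ S) :
    heckeOp σ T' (heckeOp σ T F) = heckeOp σ (compose T T') F := by
  funext g
  rw [compose_eq]
  conv_rhs => rw [heckeOp, Finsupp.linearCombination_apply ℤ T', Finsupp.sum, map_sum]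
  conv_lhs => rw [heckeOp, Finsupp.linearCombination_apply, Finsupp.sum]
  refine Finset.sum_congr rfl fun x hx => ?_
  rw [map_zsmul]
  congr 1
  exact ractHom_heckeOp hΓ hF hT (hT' x hx) g

theorem heckeOp_one (hΓ : ∀ γ ∈ Γ, γ ∈ S) {n : ℕ} {F : (Fin n → G) → V}
    (hF : IsEquivariant σ Γ F) : heckeOp σ (Finsupp.single (coset Γ 1) 1) F = F := by
  funext g
  rw [heckeOp, Finsupp.linearCombination_single, one_smul, heckeTerm_coset hΓ hF g S.one_mem,
    ractHom_one]
  simp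

theorem heckeOp_zero {n : ℕ} (T : CosetSpace Γ →₀ ℤ) :
    heckeOp σ T (0 : (Fin n → G) → V) = 0 := by
  funext g
  simp [heckeOp, Finsupp.linearCombination_apply, Finsupp.sum, heckeTerm]

theorem heckeOp_mem (hΓ : ∀ γ ∈ Γ, γ ∈ S) (hΓ' : ∀ γ ∈ Γ', γ ∈ S) {Δ : Set G}
    (hΔ : ∀ δ ∈ Δ, δ ∈ S) {T : CosetSpace Γ →₀ ℤ} (hT : T ∈ heckeModule Γ Γ' Δ) {r : ℕ}
    {F : (Fin (r + 1) → G) → V} (hF : F ∈ homCocycles σ Γ G r) :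
    heckeOp σ T F ∈ homCocycles σ Γ' G r :=
  ⟨heckeOp_isEquivariant hΓ hΓ' hΔ hT hF.1, by rw [coboundary_heckeOp, hF.2, heckeOp_zero]⟩

theorem IsCoboundary.heckeOp (hΓ : ∀ γ ∈ Γ, γ ∈ S) (hΓ' : ∀ γ ∈ Γ', γ ∈ S) {Δ : Set G}
    (hΔ : ∀ δ ∈ Δ, δ ∈ S) {T : CosetSpace Γ →₀ ℤ} (hT : T ∈ heckeModule Γ Γ' Δ) {r : ℕ}
    {F : (Fin (r + 1) → G) → V} (hF : IsCoboundary σ Γ r F) :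
    IsCoboundary σ Γ' r (heckeOp σ T F) := by
  obtain ⟨h, h1, h2, rfl⟩ := hF
  exact ⟨AdelicHecke.heckeOp σ T h, heckeOp_isEquivariant hΓ hΓ' hΔ hT h1,
    fun hr => by rw [h2 hr, heckeOp_zero], (coboundary_heckeOp T h).symm⟩

variable (σ) in
/-- The Hecke operator on cocycles. -/
def heckeLin (hΓ : ∀ γ ∈ Γ, γ ∈ S) (hΓ' : ∀ γ ∈ Γ', γ ∈ S) {Δ : Set G}
    (hΔ : ∀ δ ∈ Δ, δ ∈ S) (T : heckeModule Γ Γ' Δ) (r : ℕ) :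
    homCocycles σ Γ G r →ₗ[k] homCocycles σ Γ' G r where
  toFun F := ⟨heckeOp σ T.1 F.1, heckeOp_mem hΓ hΓ' hΔ T.2 F.2⟩
  map_add' F F' := Subtype.ext (funext fun g => by
    simp [heckeOp, Finsupp.linearCombination_apply, Finsupp.sum, heckeTerm,
      Finset.sum_add_distrib])
  map_smul' c F := Subtype.ext (funext fun g => by
    simp only [heckeOp, Finsupp.linearCombination_apply, Finsupp.sum, heckeTerm,
      Finset.smul_sum, RingHom.id_apply, Submodule.coe_smul, Pi.smul_apply, map_smul]
    exact Finset.sum_congr rfl fun _ _ => smul_comm _ _ _)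

/-! ### Classes of cocycles on the ambient group -/

/-- The retraction `g ↦ g δ(Γ g)⁻¹` of `G` to `Γ`. -/
def retraction (δ : CosetSpace Γ → G) (hδ : IsSection Γ δ) (g : G) : Γ :=
  ⟨g * (δ (coset Γ g))⁻¹, coset_eq.mp (hδ (coset Γ g))⟩

theorem retraction_smul (δ : CosetSpace Γ → G) (hδ : IsSection Γ δ) (γ : Γ) (g : G) :
    retraction δ hδ (γ • g) = γ • retraction δ hδ g := by
  apply Subtype.ext
  change (γ : G) * g * (δ (coset Γ (γ * g)))⁻¹ = γ * (g * (δ (coset Γ g))⁻¹)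
  rw [coset_mul_left γ.2, mul_assoc]

theorem isSection_out (Γ : Subgroup G) : IsSection Γ fun x => x.out := fun x => Quotient.out_eq x

variable (σ Γ) in
/-- The restriction of cocycles on `G` to `Γ`. -/
def restrictCocycle (r : ℕ) : homCocycles σ Γ G r →ₗ[k] homCocycles σ Γ Γ r where
  toFun F := ⟨fun γ => F.1 ((fun g : Γ => (g : G)) ∘ γ), homCocycles_comp F.2 fun _ _ => rfl⟩
  map_add' _ _ := rfl
  map_smul' _ _ := rfl

/-- The cohomology class of a cocycle on `G`. -/
def classOn (hΓ : ∀ γ ∈ Γ, γ ∈ S) (r : ℕ) : homCocycles σ Γ G r →ₗ[k] cohomology σ Γ hΓ r :=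
  (classOf hΓ r).comp (restrictCocycle σ Γ r)

theorem classOf_sub_eq_zero (hΓ : ∀ γ ∈ Γ, γ ∈ S) {r : ℕ} (f f' : homCocycles σ Γ Γ r)
    (h : IsCoboundary σ Γ r (f.1 - f'.1)) : classOf hΓ r f = classOf hΓ r f' := by
  rw [← sub_eq_zero, ← map_sub]
  exact (classOf_eq_zero_iff hΓ _).mpr h

/-- A section need not take the value `1` on the trivial coset, so the retraction restricted to `Γ`
may differ from the identity. Both are equivariant self-maps of `Γ`, hence homotopic. -/
theorem classOn_retraction (hΓ : ∀ γ ∈ Γ, γ ∈ S) {r : ℕ} (δ : CosetSpace Γ → G)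
    (hδ : IsSection Γ δ) (f : homCocycles σ Γ Γ r) :
    classOn hΓ r ⟨fun g => f.1 (retraction δ hδ ∘ g),
      homCocycles_comp f.2 (retraction_smul δ hδ)⟩ = classOf hΓ r f :=
  classOf_sub_eq_zero hΓ (restrictCocycle σ Γ r _) f (isCoboundary_comp_sub_comp (p := id)
    (q := fun γ : Γ => retraction δ hδ (γ : G)) f.2 (fun _ _ => rfl)
    fun γ x => retraction_smul δ hδ γ x)

theorem classOn_surjective (hΓ : ∀ γ ∈ Γ, γ ∈ S) (r : ℕ) :
    Function.Surjective (classOn (σ := σ) hΓ r) := fun ξ => by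
  obtain ⟨f, rfl⟩ := classOf_surjective hΓ r ξ
  exact ⟨_, classOn_retraction hΓ _ (isSection_out Γ) f⟩

/-- The composite `G → Γ → G` is equivariantly homotopic to the identity, so `F` differs by a
coboundary from the pullback of its restriction, itself a coboundary. -/
theorem isCoboundary_of_classOn_eq_zero (hΓ : ∀ γ ∈ Γ, γ ∈ S) {r : ℕ} {F : homCocycles σ Γ G r}
    (hF : classOn hΓ r F = 0) : IsCoboundary σ Γ r F.1 := by
  have h1 := (classOf_eq_zero_iff hΓ (restrictCocycle σ Γ r F)).mp hF
  have h2 := h1.comp (retraction_smul _ (isSection_out Γ))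
  have h3 := isCoboundary_comp_sub_comp (q := id)
    (p := fun g : G => ((retraction _ (isSection_out Γ) g : Γ) : G)) F.2
    (fun γ x => congrArg Subtype.val (retraction_smul _ (isSection_out Γ) γ x)) fun _ _ => rfl
  have h4 := h3.add h2
  rwa [show F.1 = _ from (sub_add_cancel F.1 _).symm]

theorem classOn_eq_zero_of_isCoboundary (hΓ : ∀ γ ∈ Γ, γ ∈ S) {r : ℕ} {F : homCocycles σ Γ G r}
    (hF : IsCoboundary σ Γ r F.1) : classOn hΓ r F = 0 :=
  (classOf_eq_zero_iff hΓ (restrictCocycle σ Γ r F)).mpr (hF.comp (p := fun g : Γ => (g : G)) fun _ _ => rfl)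

/-! ### Hecke operators on cohomology -/

variable (σ) in
/-- The action `ξ ↦ ξ | T` of a double coset operator on cohomology. -/
def heckeMap (hΓ : ∀ γ ∈ Γ, γ ∈ S) (hΓ' : ∀ γ ∈ Γ', γ ∈ S) {Δ : Set G}
    (hΔ : ∀ δ ∈ Δ, δ ∈ S) (r : ℕ) (T : heckeModule Γ Γ' Δ) :
    cohomology σ Γ hΓ r →ₗ[k] cohomology σ Γ' hΓ' r :=
  ((LinearMap.ker (classOn (σ := σ) hΓ r)).liftQ
    ((classOn hΓ' r).comp (heckeLin σ hΓ hΓ' hΔ T r)) fun _ hF =>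
      classOn_eq_zero_of_isCoboundary hΓ'
        ((isCoboundary_of_classOn_eq_zero hΓ hF).heckeOp hΓ hΓ' hΔ T.2)).comp
    ((classOn (σ := σ) hΓ r).quotKerEquivOfSurjective (classOn_surjective hΓ r)).symm.toLinearMap

theorem heckeMap_classOn (hΓ : ∀ γ ∈ Γ, γ ∈ S) (hΓ' : ∀ γ ∈ Γ', γ ∈ S) {Δ : Set G}
    (hΔ : ∀ δ ∈ Δ, δ ∈ S) (r : ℕ) (T : heckeModule Γ Γ' Δ) (F : homCocycles σ Γ G r) :
    heckeMap σ hΓ hΓ' hΔ r T (classOn hΓ r F) = classOn hΓ' r (heckeLin σ hΓ hΓ' hΔ T r F) := by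
  have h : ((classOn (σ := σ) hΓ r).quotKerEquivOfSurjective (classOn_surjective hΓ r)).symm
      (classOn hΓ r F) = Submodule.Quotient.mk F := by
    rw [LinearEquiv.symm_apply_eq]
    rfl
  rw [heckeMap, LinearMap.comp_apply, LinearEquiv.coe_coe, h]
  rfl

theorem heckeMap_add (hΓ : ∀ γ ∈ Γ, γ ∈ S) (hΓ' : ∀ γ ∈ Γ', γ ∈ S) {Δ : Set G}
    (hΔ : ∀ δ ∈ Δ, δ ∈ S) (r : ℕ) (T T' : heckeModule Γ Γ' Δ) :
    heckeMap σ hΓ hΓ' hΔ r (T + T') = heckeMap σ hΓ hΓ' hΔ r T + heckeMap σ hΓ hΓ' hΔ r T' := by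
  refine LinearMap.ext fun ξ => ?_
  obtain ⟨F, rfl⟩ := classOn_surjective hΓ r ξ
  rw [LinearMap.add_apply, heckeMap_classOn, heckeMap_classOn, heckeMap_classOn, ← map_add]
  congr 1
  exact Subtype.ext (funext fun g => map_add (Finsupp.linearCombination ℤ _) _ _)

theorem heckeMap_compose {Γ'' : Subgroup G} (hΓ : ∀ γ ∈ Γ, γ ∈ S) (hΓ' : ∀ γ ∈ Γ', γ ∈ S)
    (hΓ'' : ∀ γ ∈ Γ'', γ ∈ S) {Δ Δ' Δ'' : Set G} (hΔ : ∀ δ ∈ Δ, δ ∈ S) (hΔ' : ∀ δ ∈ Δ', δ ∈ S)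
    (hΔ'' : ∀ δ ∈ Δ'', δ ∈ S) (r : ℕ) (T : heckeModule Γ Γ' Δ) (T' : heckeModule Γ' Γ'' Δ')
    (T'' : heckeModule Γ Γ'' Δ'') (h : T''.1 = compose T.1 T'.1) (ξ : cohomology σ Γ hΓ r) :
    heckeMap σ hΓ' hΓ'' hΔ' r T' (heckeMap σ hΓ hΓ' hΔ r T ξ) =
      heckeMap σ hΓ hΓ'' hΔ'' r T'' ξ := by
  obtain ⟨F, rfl⟩ := classOn_surjective hΓ r ξ
  rw [heckeMap_classOn, heckeMap_classOn, heckeMap_classOn]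
  congr 1
  apply Subtype.ext
  change heckeOp σ T'.1 (heckeOp σ T.1 F.1) = heckeOp σ T''.1 F.1
  rw [h]
  exact heckeOp_heckeOp hΓ F.2.1 (fun x hx => out_mem hΔ T.2 hx) fun x hx => out_mem hΔ' T'.2 hx

theorem heckeMap_one (hΓ : ∀ γ ∈ Γ, γ ∈ S) {Δ : Set G} (hΔ : ∀ δ ∈ Δ, δ ∈ S) (r : ℕ)
    (T : heckeModule Γ Γ Δ) (h : T.1 = Finsupp.single (coset Γ 1) 1) (ξ : cohomology σ Γ hΓ r) :
    heckeMap σ hΓ hΓ hΔ r T ξ = ξ := by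
  obtain ⟨F, rfl⟩ := classOn_surjective hΓ r ξ
  rw [heckeMap_classOn]
  congr 1
  apply Subtype.ext
  change heckeOp σ T.1 F.1 = F.1
  rw [h, heckeOp_one hΓ F.2.1]

/-- The action on cohomology is computed by `heckeCochain` on homogeneous cocycles. -/
theorem liesIn_heckeCochain (hΓ : ∀ γ ∈ Γ, γ ∈ S) (hΓ' : ∀ γ ∈ Γ', γ ∈ S) {Δ : Set G}
    (hΔ : ∀ δ ∈ Δ, δ ∈ S) {r : ℕ} (T : heckeModule Γ Γ' Δ) (δ : CosetSpace Γ → G)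
    (hδ : IsSection Γ δ) {f : (Fin (r + 1) → Γ) → V} {ξ : cohomology σ Γ hΓ r}
    (hf : LiesIn σ Γ hΓ f ξ) :
    LiesIn σ Γ' hΓ' (heckeCochain σ Γ Γ' δ hδ T.1 f) (heckeMap σ hΓ hΓ' hΔ r T ξ) := by
  obtain ⟨hc, rfl⟩ := (liesIn_iff hΓ f ξ).mp hf
  -- The extension uses the given section `δ`, so that `t_x(γ')` is the retraction of `δ x * γ'`.
  -- The prescribed cochain is then exactly the restriction of `F|T` to `Γ'`.
  let F : homCocycles σ Γ G r := ⟨fun g => f (retraction δ hδ ∘ g),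
      homCocycles_comp hc (retraction_smul δ hδ)⟩
  have h1 : heckeCochain σ Γ Γ' δ hδ T.1 f =
      fun γ => heckeOp σ T.1 F.1 ((fun g : Γ' => (g : G)) ∘ γ) := by
    funext γ
    refine Finset.sum_congr rfl fun x hx => ?_
    have hx' : δ x ∈ S := by
      refine hΔ _ (T.2.1 _ ?_)
      rw [hδ x]
      exact Finsupp.mem_support_iff.mp hx
    have h2 := heckeTerm_coset hΓ F.2.1 ((fun g : Γ' => (g : G)) ∘ γ) hx'
    rw [hδ x] at h2
    change T.1 x • ract σ _ _ = T.1 x • heckeTerm σ F.1 _ x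
    rw [h2, ract_eq]
    rfl
  rw [liesIn_iff, h1]
  refine ⟨homCocycles_comp (heckeLin σ hΓ hΓ' hΔ T r F).2 fun _ _ => rfl, ?_⟩
  have h3 : classOf hΓ r ⟨f, hc⟩ = classOn hΓ r F := (classOn_retraction hΓ δ hδ ⟨f, hc⟩).symm
  rw [h3, heckeMap_classOn]
  rfl

end HeckeOperators

/-! ### The action on the total cohomology -/

section Action

variable {k : Type u} [CommRing k] {G : Type u} [Group G] {V : Type u} [AddCommGroup V] [Module k V]
  {S : Submonoid G} (σ : S →* (Module.End k V)ᵐᵒᵖ)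

theorem LiesIn.unique {σ : S →* (Module.End k V)ᵐᵒᵖ} {Γ : Subgroup G} (hΓ : ∀ γ ∈ Γ, γ ∈ S) {r : ℕ}
    {f : (Fin (r + 1) → Γ) → V} {ξ η : cohomology σ Γ hΓ r} (hξ : LiesIn σ Γ hΓ f ξ)
    (hη : LiesIn σ Γ hΓ f η) : ξ = η := by
  obtain ⟨h, rfl⟩ := (liesIn_iff hΓ f ξ).mp hξ
  obtain ⟨h', rfl⟩ := (liesIn_iff hΓ f η).mp hη
  rfl

theorem exists_liesIn {Γ : Subgroup G} (hΓ : ∀ γ ∈ Γ, γ ∈ S) {r : ℕ} (ξ : cohomology σ Γ hΓ r) :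
    ∃ f, LiesIn σ Γ hΓ f ξ := by
  obtain ⟨f, rfl⟩ := classOf_surjective hΓ r ξ
  exact ⟨f.1, (liesIn_iff hΓ _ _).mpr ⟨f.2, rfl⟩⟩

variable {C : Type*} [CommGroup C] (H : HeckeSystem C G) (hΔ : ∀ a b, ∀ δ ∈ H.Δ a b, δ ∈ S)
  (hΓ : ∀ c, ∀ γ ∈ H.Γ c, γ ∈ S) (r : ℕ)

open scoped Classical in
/-- The inclusion of `H^r(Γ_c, V)`. -/
def cohomologyIncl (c : C) : cohomology σ (H.Γ c) (hΓ c) r →ₗ[k] totalCohomology H σ hΓ r :=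
  DirectSum.lof k C (fun c => cohomology σ (H.Γ c) (hΓ c) r) c

open scoped Classical in
/-- The action of the component of index `c`. -/
def actComponent (c : C) : H.Component c →+ Module.End k (totalCohomology H σ hΓ r) :=
  AddMonoidHom.mk' (fun x => DirectSum.toModule k C _ fun c' =>
      (cohomologyIncl σ H hΓ r (c' * c)).comp
        (heckeMap σ (hΓ c') (hΓ (c' * c)) (hΔ c' (c' * c)) r (x c')))
    fun x y => by
      refine DirectSum.linearMap_ext k fun c' => LinearMap.ext fun ξ => ?_
      simp only [LinearMap.comp_apply, LinearMap.add_apply, DirectSum.toModule_lof, Pi.add_apply,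
        heckeMap_add, map_add]

open scoped Classical in
/-- The action of the whole algebra. -/
def actHom : H.Alg →+ Module.End k (totalCohomology H σ hΓ r) :=
  DirectSum.toAddMonoid (actComponent σ H hΔ hΓ r)

theorem actHom_of (c : C) (x : H.Component c) (c' : C) (ξ : cohomology σ (H.Γ c') (hΓ c') r) :
    actHom σ H hΔ hΓ r (H.of c x) (cohomologyIncl σ H hΓ r c' ξ) =
      cohomologyIncl σ H hΓ r (c' * c)
        (heckeMap σ (hΓ c') (hΓ (c' * c)) (hΔ c' (c' * c)) r (x c') ξ) := by
  classical
  have h := DirectSum.toAddMonoid_of (β := H.Component) (actComponent σ H hΔ hΓ r) c x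
  refine (LinearMap.congr_fun h _).trans ?_
  exact DirectSum.toModule_lof (M := fun c => cohomology σ (H.Γ c) (hΓ c) r) k c' ξ

theorem end_ext {A B : Module.End k (totalCohomology H σ hΓ r)}
    (h : ∀ c ξ, A (cohomologyIncl σ H hΓ r c ξ) = B (cohomologyIncl σ H hΓ r c ξ)) : A = B := by
  classical
  exact DirectSum.linearMap_ext k fun c => LinearMap.ext fun ξ => h c ξ

variable {σ H} in
-- Needed because `c' * (c * d)` and `c' * c * d` index different types, although they are equal.
theorem cohomologyIncl_congr (a : C) {b b' : C} (h : b = b') (T : H.R a b) (T' : H.R a b')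
    (hT : T.1 = T'.1) (ξ : cohomology σ (H.Γ a) (hΓ a) r) :
    cohomologyIncl σ H hΓ r b (heckeMap σ (hΓ a) (hΓ b) (hΔ a b) r T ξ) =
      cohomologyIncl σ H hΓ r b' (heckeMap σ (hΓ a) (hΓ b') (hΔ a b') r T' ξ) := by
  subst h
  rw [Subtype.ext hT]

/-- The order is reversed, as `x` acts first in a right action. On the summands this is
compatibility of Hecke operators with composition. -/
theorem actHom_mul (x y : H.Alg) :
    actHom σ H hΔ hΓ r (x * y) = actHom σ H hΔ hΓ r y * actHom σ H hΔ hΓ r x := by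
  induction x using H.induction with
  | h0 => rw [zero_mul, map_zero, mul_zero]
  | hadd x x' hx hx' => rw [add_mul, map_add, map_add, mul_add, hx, hx']
  | hof c x =>
    induction y using H.induction with
    | h0 => rw [mul_zero, map_zero, zero_mul]
    | hadd y y' hy hy' => rw [mul_add, map_add, map_add, add_mul, hy, hy']
    | hof d y =>
      refine end_ext σ H hΓ r fun c' ξ => ?_
      rw [H.of_mul_of, actHom_of, Module.End.mul_apply, actHom_of, actHom_of]
      rw [heckeMap_compose (hΓ c') (hΓ (c' * c)) (hΓ (c' * c * d)) (hΔ _ _) (hΔ _ _) (hΔ _ _) r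
        (x c') (y (c' * c)) ⟨compose (x c').1 (y (c' * c)).1,
          compose_mem (x c').2 (y (c' * c)).2 (H.mul_mem _ _ _)⟩ rfl]
      exact cohomologyIncl_congr hΔ hΓ r c' (mul_assoc c' c d).symm _ _ rfl ξ

/-- The right action of the algebra on the total cohomology. -/
def act : H.Alg →ₙ+* (Module.End k (totalCohomology H σ hΓ r))ᵐᵒᵖ where
  toFun x := MulOpposite.op (actHom σ H hΔ hΓ r x)
  map_zero' := by rw [map_zero, MulOpposite.op_zero]
  map_add' x y := by rw [map_add, MulOpposite.op_add]
  map_mul' x y := by rw [actHom_mul, MulOpposite.op_mul]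

theorem act_isDoubleCosetAction : IsDoubleCosetAction H σ hΓ r (act σ H hΔ hΓ r) :=
  fun c x c' ξ _ hf δ hδ => ⟨_, liesIn_heckeCochain (hΓ c') (hΓ (c' * c)) (hΔ c' (c' * c)) (x c')
    δ hδ hf, actHom_of σ H hΔ hΓ r c x c' ξ⟩

variable {σ H hΓ r} in
theorem IsDoubleCosetAction.unique
    {act act' : H.Alg →ₙ+* (Module.End k (totalCohomology H σ hΓ r))ᵐᵒᵖ}
    (h : IsDoubleCosetAction H σ hΓ r act) (h' : IsDoubleCosetAction H σ hΓ r act') :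
    act = act' := by
  refine NonUnitalRingHom.ext fun x => ?_
  induction x using H.induction with
  | h0 => rw [map_zero, map_zero]
  | hadd x y hx hy => rw [map_add, map_add, hx, hy]
  | hof c x =>
    apply MulOpposite.unop_injective
    refine end_ext σ H hΓ r fun c' ξ => ?_
    obtain ⟨f, hf⟩ := exists_liesIn σ (hΓ c') ξ
    obtain ⟨η, h1, h2⟩ := h c x c' ξ f hf _ (isSection_out _)
    obtain ⟨η', h1', h2'⟩ := h' c x c' ξ f hf _ (isSection_out _)
    exact h2.trans ((congrArg _ (h1.unique _ h1')).trans h2'.symm)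

theorem act_of_one (x : H.Component 1)
    (hx : ∀ c, (x c).1 = Finsupp.single (coset (H.Γ c) 1) 1) :
    act σ H hΔ hΓ r (H.of 1 x) = 1 := by
  apply MulOpposite.unop_injective
  refine end_ext σ H hΓ r fun c ξ => ?_
  refine (actHom_of σ H hΔ hΓ r 1 x c ξ).trans ?_
  have key : ∀ (b : C) (_ : b = c) (T : H.R c b), T.1 = Finsupp.single (coset (H.Γ c) 1) 1 →
      cohomologyIncl σ H hΓ r b (heckeMap σ (hΓ c) (hΓ b) (hΔ c b) r T ξ) =
        cohomologyIncl σ H hΓ r c ξ := by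
    rintro b rfl T hT
    rw [heckeMap_one (hΓ b) (hΔ b b) r T hT]
  exact key _ (mul_one c) _ (hx c)

end Action

/-! ### Pushforward of compositions -/

section Pushforward

variable {G G₁ : Type*} [Group G] [Group G₁]

theorem translate_one {Γ : Subgroup G} (T : CosetSpace Γ →₀ ℤ) : translate 1 T = T := by
  ext x
  induction x using Quotient.inductionOn with
  | h g =>
    have := translate_coset 1 g T
    rwa [mul_one] at this

theorem compose_one {Γ Γ' : Subgroup G} {Δ : Set G} {T : CosetSpace Γ →₀ ℤ}
    (hT : T ∈ heckeModule Γ Γ' Δ) : compose T (Finsupp.single (coset Γ' 1) 1) = T := by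
  rw [compose_single hT, one_smul, translate_one]

theorem single_one_mem {Γ : Subgroup G} {Δ : Set G} (hΔ : ∀ γ ∈ Γ, γ ∈ Δ) :
    Finsupp.single (coset Γ 1) 1 ∈ heckeModule Γ Γ Δ := by
  classical
  have key : ∀ g, (coset Γ 1 = coset Γ g) = (g ∈ Γ) := fun g => by
    rw [coset_eq, inv_one, mul_one]
  refine ⟨fun g hg => hΔ g ?_, fun g γ hγ => ?_⟩
  · rw [← key g]
    by_contra h
    exact hg (Finsupp.single_eq_of_ne' h)
  · simp only [Finsupp.single_apply, key, Γ.mul_mem_cancel_right hγ]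

theorem one_compose {Γ : Subgroup G} (T : CosetSpace Γ →₀ ℤ) :
    compose (Finsupp.single (coset Γ 1) 1) T = T := by
  rw [compose_eq]
  have : (fun x : CosetSpace Γ => translate x.out (Finsupp.single (coset Γ 1) (1 : ℤ))) =
      fun x => Finsupp.single x 1 := by
    funext x
    rw [translate_single, mulRight_coset, one_mul]
    congr 1
    exact Quotient.out_eq x
  rw [this]
  simp [Finsupp.linearCombination_apply]

/-- Maps of coset spaces that intertwine right translations respect composition. This serves both
the passage from `Γ` to `Γ̃`, where `j` and `j''` differ because they depend on the target index,
and the passage from `Γ̃` to `K`. -/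
theorem mapDomain_compose {Γ Γ' : Subgroup G} {L L' : Subgroup G₁}
    (j j'' : CosetSpace Γ → CosetSpace L) (j' : CosetSpace Γ' → CosetSpace L')
    {U : CosetSpace Γ →₀ ℤ} (U' : CosetSpace Γ' →₀ ℤ)
    (h : ∀ x', Finsupp.mapDomain j'' (translate x'.out U) =
      translate (j' x').out (Finsupp.mapDomain j U)) :
    Finsupp.mapDomain j'' (compose U U') =
      compose (Finsupp.mapDomain j U) (Finsupp.mapDomain j' U') := by
  rw [compose_eq, compose_eq, Finsupp.linearCombination_mapDomain]
  induction U' using Finsupp.induction_linear with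
  | zero => simp
  | add S S' hS hS' => rw [map_add, Finsupp.mapDomain_add, hS, hS', map_add]
  | single x a =>
    rw [Finsupp.linearCombination_single, Finsupp.linearCombination_single, Finsupp.mapDomain_smul,
      h]
    rfl

theorem mapDomain_translate {Γ : Subgroup G} {L : Subgroup G₁}
    (j j'' : CosetSpace Γ → CosetSpace L) {h : G} {h' : G₁}
    (hj : ∀ x, j'' (mulRight h x) = mulRight h' (j x)) (U : CosetSpace Γ →₀ ℤ) :
    Finsupp.mapDomain j'' (translate h U) = translate h' (Finsupp.mapDomain j U) := by
  change Finsupp.mapDomain _ (Finsupp.mapDomain _ U) = Finsupp.mapDomain _ (Finsupp.mapDomain _ U)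
  rw [← Finsupp.mapDomain_comp, ← Finsupp.mapDomain_comp]
  congr 1
  exact funext hj

end Pushforward

/-! ### The systems attached to a Hecke pair consist of Hecke triples -/

section Triples

variable {C G G₀ : Type*} [CommGroup C] [Group G] [Group G₀] (P : HeckePair G) (ι : G₀ →* G)
  (α : C → G)

theorem tildeSystem_mem_Γ {a : C} {γ : G} :
    γ ∈ (tildeSystem P ι α).Γ a ↔ γ ∈ P.Γ ∧ ∃ g, γ = α a * ι g * (α a)⁻¹ := by
  refine and_congr Iff.rfl ⟨?_, ?_⟩
  · rintro ⟨_, ⟨g, rfl⟩, rfl⟩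
    exact ⟨g, rfl⟩
  · rintro ⟨g, rfl⟩
    exact ⟨_, ⟨g, rfl⟩, rfl⟩

theorem system_mem_Γ {a : C} {g : G₀} :
    g ∈ (system P ι α).Γ a ↔ α a * ι g * (α a)⁻¹ ∈ P.Γ := Iff.rfl

theorem system_mem {a b : C} {g : G₀} :
    g ∈ (system P ι α).Δ a b ↔ α a * ι g * (α b)⁻¹ ∈ P.Δ := Iff.rfl

theorem mem_map_conj {L : Type*} [Group L] {H : Subgroup L} {δ x : L} :
    x ∈ H.map (MulAut.conj δ).toMonoidHom ↔ δ⁻¹ * x * δ ∈ H := by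
  constructor
  · rintro ⟨y, hy, rfl⟩
    have : δ⁻¹ * (δ * y * δ⁻¹) * δ = y := by group
    exact this.symm ▸ hy
  · intro h
    refine ⟨_, h, ?_⟩
    change δ * (δ⁻¹ * x * δ) * δ⁻¹ = x
    group

/-- For `δ = α_a g α_b⁻¹` the group `δ Γ̃_b δ⁻¹` is the intersection of `δ K δ⁻¹` with `α_a G₀
α_a⁻¹`. So both groups arise from the commensurable `K` and `δ K δ⁻¹` by intersection with the same
subgroup. -/
theorem tildeSystem_isTriple (a b : C) : IsTriple ((tildeSystem P ι α).Γ a)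
    ((tildeSystem P ι α).Γ b) ((tildeSystem P ι α).Δ a b) where
  commensurable := by
    rintro δ ⟨hδ, g, hg⟩
    have h1 : ((tildeSystem P ι α).Γ b).map (MulAut.conj δ).toMonoidHom =
        P.Γ.map (MulAut.conj δ).toMonoidHom ⊓ ι.range.map (MulAut.conj (α a)).toMonoidHom := by
      ext x
      rw [mem_map_conj, Subgroup.mem_inf, mem_map_conj, tildeSystem_mem_Γ, mem_map_conj]
      refine and_congr Iff.rfl ⟨?_, ?_⟩
      · rintro ⟨y, hy⟩
        refine ⟨g * y * g⁻¹, ?_⟩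
        have : x = δ * (α b * ι y * (α b)⁻¹) * δ⁻¹ := by rw [← hy]; group
        rw [this, hg, map_mul, map_mul, map_inv]
        group
      · rintro ⟨y, hy⟩
        refine ⟨g⁻¹ * y * g, ?_⟩
        have : x = α a * ι y * (α a)⁻¹ := by rw [hy]; group
        rw [this, hg, map_mul, map_mul, map_inv]
        group
    rw [h1]
    have h2 := P.isTriple.commensurable δ hδ
    exact ⟨Subgroup.relIndex_inter_ne_zero h2.1 _, Subgroup.relIndex_inter_ne_zero h2.2 _⟩
  left_mul_mem := (tildeSystem P ι α).left_mul_mem a b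
  mul_right_mem := (tildeSystem P ι α).mul_right_mem a b

theorem system_isTriple (a b : C) : IsTriple ((system P ι α).Γ a)
    ((system P ι α).Γ b) ((system P ι α).Δ a b) where
  commensurable := by
    intro g hg
    have h1 : ((system P ι α).Γ b).map (MulAut.conj g).toMonoidHom =
        (P.Γ.map (MulAut.conj (α a * ι g * (α b)⁻¹)).toMonoidHom).comap
          ((MulAut.conj (α a)).toMonoidHom.comp ι) := by
      ext x
      rw [mem_map_conj, Subgroup.mem_comap, mem_map_conj, system_mem_Γ, map_mul, map_mul, map_inv]
      have : α b * ((ι g)⁻¹ * ι x * ι g) * (α b)⁻¹ = (α a * ι g * (α b)⁻¹)⁻¹ *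
          ((MulAut.conj (α a)).toMonoidHom.comp ι) x * (α a * ι g * (α b)⁻¹) := by
        change _ = (α a * ι g * (α b)⁻¹)⁻¹ * (α a * ι x * (α a)⁻¹) * (α a * ι g * (α b)⁻¹)
        group
      rw [this]
    rw [h1]
    have h2 := P.isTriple.commensurable _ hg
    exact ⟨Subgroup.relIndex_comap_ne_zero _ h2.1, Subgroup.relIndex_comap_ne_zero _ h2.2⟩
  left_mul_mem := (system P ι α).left_mul_mem a b
  mul_right_mem := (system P ι α).mul_right_mem a b

end Triples

/-! ### The isomorphisms between the two systems -/

section Isomorphism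

variable {C G G₀ : Type*} [CommGroup C] [Group G] [Group G₀] (P : HeckePair G) (ι : G₀ →* G)
  (α : C → G)

/-- The map `Γ_a g ↦ Γ̃_a α_a g α_b⁻¹`. -/
def cosetMap (a b : C) :
    CosetSpace ((system P ι α).Γ a) → CosetSpace ((tildeSystem P ι α).Γ a) :=
  Quotient.lift (fun g => coset ((tildeSystem P ι α).Γ a) (α a * ι g * (α b)⁻¹)) fun g h hgh => by
    have h1 := coset_eq.mp (Quotient.sound hgh : coset ((system P ι α).Γ a) g = coset _ h)
    rw [coset_eq, tildeSystem_mem_Γ]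
    have h2 : α a * ι h * (α b)⁻¹ * (α a * ι g * (α b)⁻¹)⁻¹ =
        α a * ι (h * g⁻¹) * (α a)⁻¹ := by
      rw [map_mul, map_inv]; group
    rw [h2]
    exact ⟨h1, _, rfl⟩

theorem cosetMap_coset (a b : C) (g : G₀) : cosetMap P ι α a b (coset _ g) =
    coset ((tildeSystem P ι α).Γ a) (α a * ι g * (α b)⁻¹) := rfl

theorem cosetMap_injective (a b : C) : Function.Injective (cosetMap P ι α a b) := by
  intro x y hxy
  induction x using Quotient.inductionOn with
  | h g =>
    induction y using Quotient.inductionOn with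
    | h h =>
      have h1 := coset_eq.mp (hxy : coset ((tildeSystem P ι α).Γ a) (α a * ι g * (α b)⁻¹) =
        coset _ (α a * ι h * (α b)⁻¹))
      have h2 : α a * ι h * (α b)⁻¹ * (α a * ι g * (α b)⁻¹)⁻¹ =
          α a * ι (h * g⁻¹) * (α a)⁻¹ := by
        rw [map_mul, map_inv]; group
      rw [h2] at h1
      exact coset_eq.mpr ((tildeSystem_mem_Γ P ι α).mp h1).1

theorem cosetMap_mulRight (a b c : C) (h : G₀) (x : CosetSpace ((system P ι α).Γ a)) :
    cosetMap P ι α a c (mulRight h x) =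
      mulRight (α b * ι h * (α c)⁻¹) (cosetMap P ι α a b x) := by
  induction x using Quotient.inductionOn with
  | h g =>
    have h1 : α a * ι (g * h) * (α c)⁻¹ =
        α a * ι g * (α b)⁻¹ * (α b * ι h * (α c)⁻¹) := by
      rw [map_mul]; group
    have h2 := cosetMap_coset P ι α a c (g * h)
    rw [h1, ← mulRight_coset, ← mulRight_coset, ← cosetMap_coset] at h2
    exact h2

theorem mapDomain_cosetMap_translate (a b c : C) (h : G₀)
    (U : CosetSpace ((system P ι α).Γ a) →₀ ℤ) :
    Finsupp.mapDomain (cosetMap P ι α a c) (translate h U) =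
      translate (α b * ι h * (α c)⁻¹) (Finsupp.mapDomain (cosetMap P ι α a b) U) :=
  mapDomain_translate _ _ (cosetMap_mulRight P ι α a b c h) U

theorem mem_range_cosetMap {a b : C} {T : (tildeSystem P ι α).R a b}
    {x : CosetSpace ((tildeSystem P ι α).Γ a)} (hx : x ∈ T.1.support) :
    x ∈ Set.range (cosetMap P ι α a b) := by
  induction x using Quotient.inductionOn with
  | h δ =>
    obtain ⟨-, g, rfl⟩ := T.2.1 δ (Finsupp.mem_support_iff.mp hx)
    exact ⟨coset _ g, rfl⟩

theorem comapDomain_cosetMap_mem {a b : C} (T : (tildeSystem P ι α).R a b) :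
    Finsupp.comapDomain (cosetMap P ι α a b) T.1 (cosetMap_injective P ι α a b).injOn ∈
      (system P ι α).R a b := by
  refine ⟨fun g hg => (T.2.1 _ hg).1, fun g γ hγ => ?_⟩
  have h1 := T.2.2 (α a * ι g * (α b)⁻¹) (α b * ι γ * (α b)⁻¹)
    ((tildeSystem_mem_Γ P ι α).mpr ⟨hγ, γ, rfl⟩)
  have h2 : α a * ι g * (α b)⁻¹ * (α b * ι γ * (α b)⁻¹) = α a * ι (g * γ) * (α b)⁻¹ := by
    rw [map_mul]; group
  rw [h2] at h1
  exact h1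

theorem mapDomain_cosetMap_mem {a b : C} (U : (system P ι α).R a b) :
    Finsupp.mapDomain (cosetMap P ι α a b) U.1 ∈ (tildeSystem P ι α).R a b := by
  refine ⟨fun g hg => ?_, fun g γ hγ => ?_⟩
  · classical
    obtain ⟨x, hx, hxg⟩ := Finset.mem_image.mp
      (Finsupp.mapDomain_support (Finsupp.mem_support_iff.mpr hg))
    induction x using Quotient.inductionOn with
    | h h =>
      have h1 := U.2.1 h (Finsupp.mem_support_iff.mp hx)
      have h2 := coset_eq.mp (hxg : coset _ (α a * ι h * (α b)⁻¹) = coset _ g)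
      have h3 := (tildeSystem P ι α).left_mul_mem a b _ h2 _ ⟨h1, h, rfl⟩
      rwa [inv_mul_cancel_right] at h3
  · obtain ⟨-, h, rfl⟩ := (tildeSystem_mem_Γ P ι α).mp hγ
    have hh : h ∈ (system P ι α).Γ b := ((tildeSystem_mem_Γ P ι α).mp hγ).1
    have h1 := mapDomain_cosetMap_translate P ι α a b b h U.1
    rw [translate_eq_self U.2 hh] at h1
    calc _ = translate (α b * ι h * (α b)⁻¹) (Finsupp.mapDomain (cosetMap P ι α a b) U.1)
          (coset _ (g * (α b * ι h * (α b)⁻¹))) := by rw [← h1]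
      _ = _ := translate_coset _ _ _

/-- The isomorphism `Γ̃_a δ ↦ Γ_a α_a⁻¹ δ α_b`. -/
def tildeEquiv (a b : C) : (tildeSystem P ι α).R a b ≃ₗ[ℤ] (system P ι α).R a b where
  toFun T := ⟨_, comapDomain_cosetMap_mem P ι α T⟩
  map_add' _ _ := Subtype.ext (Finsupp.ext fun _ => rfl)
  map_smul' _ _ := Subtype.ext (Finsupp.ext fun _ => rfl)
  invFun U := ⟨_, mapDomain_cosetMap_mem P ι α U⟩
  left_inv T := Subtype.ext (Finsupp.mapDomain_comapDomain _ (cosetMap_injective P ι α a b) T.1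
    fun _ hx => mem_range_cosetMap P ι α hx)
  right_inv U := Subtype.ext (Finsupp.comapDomain_mapDomain _ (cosetMap_injective P ι α a b) U.1)

theorem tildeEquiv_apply (a b : C) (T : (tildeSystem P ι α).R a b) (g : G₀) :
    (tildeEquiv P ι α a b T).1 (coset ((system P ι α).Γ a) g) =
      T.1 (coset ((tildeSystem P ι α).Γ a) (α a * ι g * (α b)⁻¹)) := rfl

theorem mapDomain_tildeEquiv (a b : C) (T : (tildeSystem P ι α).R a b) :
    Finsupp.mapDomain (cosetMap P ι α a b) (tildeEquiv P ι α a b T).1 = T.1 :=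
  congrArg Subtype.val ((tildeEquiv P ι α a b).symm_apply_apply T)

/-- Compared after pushing forward along the injective `cosetMap`, which intertwines translation by
`h` with translation by `α_b h α_c⁻¹`. -/
theorem tildeEquiv_compose (a b c : C) (T : (tildeSystem P ι α).R a b)
    (T' : (tildeSystem P ι α).R b c) (T'' : (tildeSystem P ι α).R a c)
    (h : T''.1 = compose T.1 T'.1) :
    (tildeEquiv P ι α a c T'').1 =
      compose (tildeEquiv P ι α a b T).1 (tildeEquiv P ι α b c T').1 := by
  apply Finsupp.mapDomain_injective (cosetMap_injective P ι α a c)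
  rw [mapDomain_tildeEquiv, mapDomain_compose (cosetMap P ι α a b) _ (cosetMap P ι α b c),
    mapDomain_tildeEquiv, mapDomain_tildeEquiv, h]
  intro x
  rw [mapDomain_cosetMap_translate P ι α a b c, mapDomain_tildeEquiv]
  -- The chosen representatives on the two sides differ by an element of `Γ̃_b`, under which `T` is
  -- invariant.
  refine translate_congr T.2 ?_
  rw [← cosetMap_coset]
  have h1 : coset _ x.out = x := Quotient.out_eq x
  rw [h1]
  exact (Quotient.out_eq _).symm

end Isomorphism

/-! ### The map from the Hecke algebra to the system -/

section TildeMap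

variable {C G G₀ : Type*} [CommGroup C] [Group G] [Group G₀] (P : HeckePair G) (ι : G₀ →* G)
  (α : C → G)

/-- The map `Γ̃_a g ↦ K g`. -/
def coarsen (a : C) : CosetSpace ((tildeSystem P ι α).Γ a) → CosetSpace P.Γ :=
  Quotient.lift (fun g => coset P.Γ g) fun g h hgh =>
    coset_eq.mpr (coset_eq.mp (Quotient.sound hgh : coset ((tildeSystem P ι α).Γ a) g =
      coset _ h)).1

theorem coarsen_coset (a : C) (g : G) : coarsen P ι α a (coset _ g) = coset P.Γ g := rfl

/-- The cosets of `Γ̃_a` contained in `Δ̃_{a,b}`. -/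
def tildeCosets (a b : C) : Set (CosetSpace ((tildeSystem P ι α).Γ a)) :=
  {x | x.out ∈ (tildeSystem P ι α).Δ a b}

theorem coset_mem_tildeCosets {a b : C} {g : G} :
    coset _ g ∈ tildeCosets P ι α a b ↔ g ∈ (tildeSystem P ι α).Δ a b := by
  have h1 := coset_eq.mp (Quotient.out_eq (coset ((tildeSystem P ι α).Γ a) g) :
    coset _ (coset ((tildeSystem P ι α).Γ a) g).out = coset _ g)
  have h2 := ((tildeSystem P ι α).Γ a).inv_mem h1
  constructor
  · intro h
    have := (tildeSystem P ι α).left_mul_mem a b _ h1 _ h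
    rwa [inv_mul_cancel_right] at this
  · intro h
    have := (tildeSystem P ι α).left_mul_mem a b _ h2 _ h
    rw [mul_inv_rev, inv_inv, inv_mul_cancel_right] at this
    exact this

/-- The quotient of two elements of `Δ̃_{a,b}` lies in `α_a G₀ α_a⁻¹`; if it also lies in `K`, it
lies in `Γ̃_a`. So a coset of `K` contains at most one coset of `Γ̃_a` from `Δ̃_{a,b}`. -/
theorem coarsen_injOn (a b : C) : Set.InjOn (coarsen P ι α a) (tildeCosets P ι α a b) := by
  intro x hx y hy hxy
  induction x using Quotient.inductionOn with
  | h g =>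
    induction y using Quotient.inductionOn with
    | h h =>
      obtain ⟨-, g', rfl⟩ := (coset_mem_tildeCosets P ι α).mp hx
      obtain ⟨-, h', rfl⟩ := (coset_mem_tildeCosets P ι α).mp hy
      refine coset_eq.mpr ((tildeSystem_mem_Γ P ι α).mpr ⟨coset_eq.mp hxy, h' * g'⁻¹, ?_⟩)
      rw [map_mul, map_inv]
      group

open scoped Classical in
theorem tildeMap_finite (a b : C) (T : CosetSpace P.Γ →₀ ℤ) :
    (Function.support fun x => if x ∈ tildeCosets P ι α a b then T (coarsen P ι α a x) else 0).Finite := by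
  have hsub : ∀ x, x ∈ (Function.support fun x =>
      if x ∈ tildeCosets P ι α a b then T (coarsen P ι α a x) else 0) →
      x ∈ tildeCosets P ι α a b ∧ T (coarsen P ι α a x) ≠ 0 := fun x hx => by
    by_cases h : x ∈ tildeCosets P ι α a b
    · exact ⟨h, by simpa [h] using hx⟩
    · simp [h] at hx
  refine Set.Finite.of_finite_image (f := coarsen P ι α a) (T.support.finite_toSet.subset ?_) ?_
  · rintro _ ⟨x, hx, rfl⟩
    exact Finsupp.mem_support_iff.mpr (hsub x hx).2
  · exact (coarsen_injOn P ι α a b).mono fun x hx => (hsub x hx).1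

open scoped Classical in
/-- The element `∑ aⱼ (K δⱼ ∩ Δ̃_{a,b})` for `T = ∑ aⱼ K δⱼ`. -/
def tildeFun (a b : C) (T : CosetSpace P.Γ →₀ ℤ) : CosetSpace ((tildeSystem P ι α).Γ a) →₀ ℤ :=
  Finsupp.ofSupportFinite _ (tildeMap_finite P ι α a b T)

variable {P ι α} in
theorem tildeFun_of_mem {a b : C} {x : CosetSpace ((tildeSystem P ι α).Γ a)}
    (hx : x ∈ tildeCosets P ι α a b) (T : CosetSpace P.Γ →₀ ℤ) :
    tildeFun P ι α a b T x = T (coarsen P ι α a x) := if_pos hx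

variable {P ι α} in
theorem tildeFun_of_notMem {a b : C} {x : CosetSpace ((tildeSystem P ι α).Γ a)}
    (hx : x ∉ tildeCosets P ι α a b) (T : CosetSpace P.Γ →₀ ℤ) :
    tildeFun P ι α a b T x = 0 := if_neg hx

/-- The map `∑ aⱼ K δⱼ ↦ ∑ aⱼ (K δⱼ ∩ Δ̃_{a,b})`. -/
def tildeMap (a b : C) :
    (CosetSpace P.Γ →₀ ℤ) →ₗ[ℤ] (CosetSpace ((tildeSystem P ι α).Γ a) →₀ ℤ) where
  toFun := tildeFun P ι α a b
  map_add' T T' := Finsupp.ext fun x => by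
    by_cases h : x ∈ tildeCosets P ι α a b
    · simp [tildeFun_of_mem h]
    · simp [tildeFun_of_notMem h]
  map_smul' c T := Finsupp.ext fun x => by
    by_cases h : x ∈ tildeCosets P ι α a b
    · simp [tildeFun_of_mem h]
    · simp [tildeFun_of_notMem h]

variable {P ι α}

theorem tildeMap_of_mem {a b : C} {g : G} (hg : g ∈ (tildeSystem P ι α).Δ a b)
    (T : CosetSpace P.Γ →₀ ℤ) : tildeMap P ι α a b T (coset _ g) = T (coset P.Γ g) :=
  tildeFun_of_mem ((coset_mem_tildeCosets P ι α).mpr hg) T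

theorem tildeMap_of_notMem {a b : C} {g : G} (hg : g ∉ (tildeSystem P ι α).Δ a b)
    (T : CosetSpace P.Γ →₀ ℤ) : tildeMap P ι α a b T (coset _ g) = 0 :=
  tildeFun_of_notMem (fun h => hg ((coset_mem_tildeCosets P ι α).mp h)) T

theorem tildeMap_mem {Δ : Set G} (a b : C) {T : CosetSpace P.Γ →₀ ℤ}
    (hT : T ∈ heckeModule P.Γ P.Γ Δ) : tildeMap P ι α a b T ∈ (tildeSystem P ι α).R a b := by
  refine ⟨fun g hg => ?_, fun g γ hγ => ?_⟩
  · by_contra h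
    exact hg (tildeMap_of_notMem h T)
  · by_cases hg : g ∈ (tildeSystem P ι α).Δ a b
    · rw [tildeMap_of_mem hg, tildeMap_of_mem ((tildeSystem P ι α).mul_right_mem a b g hg γ hγ)]
      exact hT.2 g γ hγ.1
    · rw [tildeMap_of_notMem hg, tildeMap_of_notMem]
      intro h
      have := (tildeSystem P ι α).mul_right_mem a b _ h _ (Subgroup.inv_mem _ hγ)
      rw [mul_inv_cancel_right] at this
      exact hg this

theorem support_subset_tildeCosets {a b : C} {U : CosetSpace ((tildeSystem P ι α).Γ a) →₀ ℤ}
    (hU : U ∈ (tildeSystem P ι α).R a b) : (U.support : Set _) ⊆ tildeCosets P ι α a b := by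
  intro x hx
  induction x using Quotient.inductionOn with
  | h g => exact (coset_mem_tildeCosets P ι α).mpr (hU.1 g (Finsupp.mem_support_iff.mp hx))

theorem mapDomain_coarsen_of_mem {a b : C} {U : CosetSpace ((tildeSystem P ι α).Γ a) →₀ ℤ}
    (hU : U ∈ (tildeSystem P ι α).R a b) {g : G} (hg : g ∈ (tildeSystem P ι α).Δ a b) :
    Finsupp.mapDomain (coarsen P ι α a) U (coset P.Γ g) = U (coset _ g) :=
  Finsupp.mapDomain_apply' _ U (support_subset_tildeCosets hU) (coarsen_injOn P ι α a b)
    ((coset_mem_tildeCosets P ι α).mpr hg)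

theorem tildeMap_mapDomain {a b : C} {U : CosetSpace ((tildeSystem P ι α).Γ a) →₀ ℤ}
    (hU : U ∈ (tildeSystem P ι α).R a b) :
    tildeMap P ι α a b (Finsupp.mapDomain (coarsen P ι α a) U) = U := by
  refine Finsupp.ext fun x => ?_
  induction x using Quotient.inductionOn with
  | h g =>
    by_cases hg : g ∈ (tildeSystem P ι α).Δ a b
    · exact (tildeMap_of_mem hg _).trans (mapDomain_coarsen_of_mem hU hg)
    · refine (tildeMap_of_notMem hg _).trans ?_
      by_contra h
      exact hg (hU.1 g (Ne.symm h))

theorem coarsen_mulRight (a : C) (h : G) (x : CosetSpace ((tildeSystem P ι α).Γ a)) :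
    coarsen P ι α a (mulRight h x) = mulRight h (coarsen P ι α a x) := by
  induction x using Quotient.inductionOn with
  | h g =>
    have := coarsen_coset P ι α a (g * h)
    rw [← mulRight_coset, ← mulRight_coset] at this
    exact this

theorem tildeMap_one (a : C) (h1 : (1 : G) ∈ P.Δ) :
    tildeMap P ι α a a (Finsupp.single (coset P.Γ 1) 1) =
      Finsupp.single (coset ((tildeSystem P ι α).Γ a) 1) 1 := by
  have hone : (1 : G) ∈ (tildeSystem P ι α).Δ a a := ⟨h1, 1, by rw [map_one]; group⟩
  have hmem := single_one_mem (Γ := (tildeSystem P ι α).Γ a) (Δ := (tildeSystem P ι α).Δ a a)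
    fun γ hγ => by
      have := (tildeSystem P ι α).left_mul_mem a a γ hγ 1 hone
      rwa [mul_one] at this
  have := tildeMap_mapDomain hmem
  rwa [Finsupp.mapDomain_single] at this

/-- A homomorphism `cl` to `C` for which `Δ̃_{a,b}` has degree `a⁻¹ b`, and for which every coset
`K δ` with `δ ∈ Δ` meets `Δ̃_{a, a cl(δ)}`. -/
structure IsClassMap (P : HeckePair G) (ι : G₀ →* G) (α : C → G) (cl : G →* C) : Prop where
  map_Γ : ∀ κ ∈ P.Γ, cl κ = 1
  map_Δ : ∀ a b, ∀ δ ∈ (tildeSystem P ι α).Δ a b, cl δ = a⁻¹ * b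
  exists_mul_mem : ∀ a, ∀ δ ∈ P.Δ, ∃ κ ∈ P.Γ, κ * δ ∈ (tildeSystem P ι α).Δ a (a * cl δ)

/-- The element `α_a⁻¹ δ α_{a cl(δ)}` has trivial class, so the approximation hypothesis writes `δ`
as `κ α_a g α_{a cl(δ)}⁻¹`. -/
theorem isClassMap {cl : G →* C} (hα : ∀ c, cl (α c) = c⁻¹) (hι : ∀ g, cl (ι g) = 1)
    (hK : ∀ κ ∈ P.Γ, cl κ = 1)
    (happrox : ∀ c y, cl y = 1 → ∃ κ ∈ P.Γ, ∃ g, α c * y = κ * α c * ι g) :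
    IsClassMap P ι α cl where
  map_Γ := hK
  map_Δ := by
    rintro a b δ ⟨-, g, rfl⟩
    rw [map_mul, map_mul, map_inv, hα, hα, hι, mul_one, inv_inv]
  exists_mul_mem := by
    intro a δ hδ
    obtain ⟨κ, hκ, g, h⟩ := happrox a ((α a)⁻¹ * δ * α (a * cl δ)) (by
      rw [map_mul, map_mul, map_inv, hα, hα, inv_inv, mul_inv_cancel])
    refine ⟨κ⁻¹, P.Γ.inv_mem hκ, P.isTriple.left_mul_mem _ (P.Γ.inv_mem hκ) _ hδ, g, ?_⟩
    have h1 : δ = κ * α a * ι g * (α (a * cl δ))⁻¹ := by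
      rw [← h]; group
    rw [eq_mul_inv_iff_mul_eq] at h1 ⊢
    rw [mul_assoc, h1]
    group

/-- The elements of `Δ` of a given degree. -/
def degreePart (P : HeckePair G) (cl : G →* C) (c : C) : Set G := {δ | δ ∈ P.Δ ∧ cl δ = c}

namespace IsClassMap

variable {cl : G →* C}

theorem exists_mem_of_degreePart (h : IsClassMap P ι α cl) (a : C) {c : C} {δ : G}
    (hδ : δ ∈ degreePart P cl c) : ∃ κ ∈ P.Γ, κ * δ ∈ (tildeSystem P ι α).Δ a (a * c) := by
  obtain ⟨hδ, rfl⟩ := hδ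
  exact h.exists_mul_mem a δ hδ

theorem mapDomain_tildeMap (h : IsClassMap P ι α cl) (a c : C) {T : CosetSpace P.Γ →₀ ℤ}
    (hT : T ∈ heckeModule P.Γ P.Γ (degreePart P cl c)) :
    Finsupp.mapDomain (coarsen P ι α a) (tildeMap P ι α a (a * c) T) = T := by
  classical
  have hmem := tildeMap_mem (ι := ι) (α := α) a (a * c) hT
  refine Finsupp.ext fun y => ?_
  by_cases hy : ∃ g ∈ (tildeSystem P ι α).Δ a (a * c), coset P.Γ g = y
  · obtain ⟨g, hg, rfl⟩ := hy
    rw [mapDomain_coarsen_of_mem hmem hg, tildeMap_of_mem hg]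
  · trans 0
    · by_contra hne
      obtain ⟨x, hx, rfl⟩ := Finset.mem_image.mp
        (Finsupp.mapDomain_support (Finsupp.mem_support_iff.mpr hne))
      induction x using Quotient.inductionOn with
      | h g => exact hy ⟨g, hmem.1 g (Finsupp.mem_support_iff.mp hx), rfl⟩
    · by_contra hne
      induction y using Quotient.inductionOn with
      | h δ =>
        obtain ⟨κ, hκ, hg⟩ := h.exists_mem_of_degreePart a (hT.1 δ (Ne.symm hne))
        exact hy ⟨_, hg, coset_mul_left hκ δ⟩

/-- Coarsening visibly respects composition and is inverted by `tildeMap` on the element `h1` of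
`R(Γ̃_a, Γ̃_{acd}, Δ̃_{a,acd})`, so `tildeMap` respects composition too. -/
theorem tildeMap_compose (h : IsClassMap P ι α cl) (a c d : C) {T T' : CosetSpace P.Γ →₀ ℤ}
    (hT : T ∈ heckeModule P.Γ P.Γ (degreePart P cl c))
    (hT' : T' ∈ heckeModule P.Γ P.Γ (degreePart P cl d)) :
    tildeMap P ι α a (a * c * d) (compose T T') =
      compose (tildeMap P ι α a (a * c) T) (tildeMap P ι α (a * c) (a * c * d) T') := by
  have h1 := compose_mem (tildeMap_mem (ι := ι) (α := α) a (a * c) hT)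
    (tildeMap_mem (ι := ι) (α := α) (a * c) (a * c * d) hT')
    ((tildeSystem P ι α).mul_mem a (a * c) (a * c * d))
  rw [← tildeMap_mapDomain h1, mapDomain_compose (coarsen P ι α a) _ (coarsen P ι α (a * c)),
    h.mapDomain_tildeMap a c hT, h.mapDomain_tildeMap (a * c) d hT']
  intro x
  rw [mapDomain_translate _ (coarsen P ι α a) (coarsen_mulRight a x.out),
    h.mapDomain_tildeMap a c hT]
  refine translate_congr hT ?_
  rw [← coarsen_coset P ι α (a * c)]
  have h2 : coset _ x.out = x := Quotient.out_eq x
  rw [h2]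
  exact (Quotient.out_eq _).symm

theorem tildeMap_eq_zero (h : IsClassMap P ι α cl) (a : C) {c d : C} (hcd : d ≠ c)
    {T : CosetSpace P.Γ →₀ ℤ} (hT : T ∈ heckeModule P.Γ P.Γ (degreePart P cl c)) :
    tildeMap P ι α a (a * d) T = 0 := by
  refine Finsupp.ext fun x => ?_
  induction x using Quotient.inductionOn with
  | h g =>
    by_cases hg : g ∈ (tildeSystem P ι α).Δ a (a * d)
    · refine (tildeMap_of_mem hg T).trans ?_
      by_contra hne
      have h1 := (hT.1 g hne).2
      rw [h.map_Δ _ _ g hg, inv_mul_cancel_left] at h1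
      exact hcd h1
    · exact tildeMap_of_notMem hg T

theorem apply_eq_zero (h : IsClassMap P ι α cl) (a : C) {T : CosetSpace P.Γ →₀ ℤ} {δ : G}
    (hδ : δ ∈ P.Δ) (hT : tildeMap P ι α a (a * cl δ) T = 0) : T (coset P.Γ δ) = 0 := by
  obtain ⟨κ, hκ, hg⟩ := h.exists_mul_mem a δ hδ
  rw [← coset_mul_left hκ, ← tildeMap_of_mem hg, hT]
  rfl

end IsClassMap

end TildeMap

/-! ### Units and isomorphisms of Hecke systems -/

namespace HeckeSystem

variable {C G G₁ : Type*} [CommGroup C] [Group G] [Group G₁] (H : HeckeSystem C G)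
  (H₁ : HeckeSystem C G₁)

/-- The unit, which exists if `1 ∈ Δ_{a,a}` for all `a`. -/
def one (h : ∀ a, (1 : G) ∈ H.Δ a a) : H.Alg :=
  H.of 1 fun c => ⟨Finsupp.single (coset (H.Γ c) 1) 1, by
    rw [mul_one]
    refine single_one_mem fun γ hγ => ?_
    have := H.left_mul_mem c c γ hγ 1 (h c)
    rwa [mul_one] at this⟩

theorem one_mul (h : ∀ a, (1 : G) ∈ H.Δ a a) (x : H.Alg) : H.one h * x = x := by
  induction x using H.induction with
  | h0 => rw [mul_zero]
  | hadd x y hx hy => rw [mul_add, hx, hy]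
  | hof c x =>
    rw [one, of_mul_of]
    refine H.of_congr (_root_.one_mul c) _ _ fun c' => ?_
    -- The indices `c' * 1` and `c'` are equal but not definitionally, so the middle index is made a
    -- variable `b`.
    have key : ∀ b, b = c' → ∀ U : CosetSpace (H.Γ c') →₀ ℤ,
        U = Finsupp.single (coset (H.Γ c') 1) 1 → compose U (x b).1 = (x c').1 := by
      rintro b rfl U rfl
      exact one_compose _
    exact key _ (mul_one c') _ rfl

theorem mul_one (h : ∀ a, (1 : G) ∈ H.Δ a a) (x : H.Alg) : x * H.one h = x := by
  induction x using H.induction with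
  | h0 => rw [zero_mul]
  | hadd x y hx hy => rw [add_mul, hx, hy]
  | hof c x =>
    rw [one, of_mul_of]
    exact H.of_congr (_root_.mul_one c) _ _ fun c' => compose_one (x c').2

variable {H H₁}

/-- The additive isomorphism of the algebras given by isomorphisms of the components. -/
def algAddEquiv (θ : ∀ a b, H.R a b ≃ₗ[ℤ] H₁.R a b) : H.Alg ≃+ H₁.Alg :=
  DFinsupp.mapRange.addEquiv fun c => AddEquiv.piCongrRight fun c' => (θ c' (c' * c)).toAddEquiv

theorem algAddEquiv_of (θ : ∀ a b, H.R a b ≃ₗ[ℤ] H₁.R a b) (c : C) (x : H.Component c) :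
    algAddEquiv θ (H.of c x) = H₁.of c fun c' => θ c' (c' * c) (x c') := by
  classical
  exact DFinsupp.mapRange_single (f := fun c (x : H.Component c) =>
    (fun c' => θ c' (c' * c) (x c') : H₁.Component c))
    (hf := fun c => funext fun c' => map_zero (θ c' (c' * c)))

/-- The isomorphism of algebras given by isomorphisms of the components which are compatible with
the compositions. -/
def algEquiv (θ : ∀ a b, H.R a b ≃ₗ[ℤ] H₁.R a b)
    (hθ : ∀ a b c (T : H.R a b) (T' : H.R b c) (T'' : H.R a c), T''.1 = compose T.1 T'.1 →
      (θ a c T'').1 = compose (θ a b T).1 (θ b c T').1) : H.Alg ≃+* H₁.Alg :=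
  { algAddEquiv θ with
    map_mul' := fun x y => by
      change algAddEquiv θ (x * y) = algAddEquiv θ x * algAddEquiv θ y
      induction x using H.induction with
      | h0 => rw [zero_mul, map_zero, zero_mul]
      | hadd x x' hx hx' => rw [add_mul, map_add, map_add, add_mul, hx, hx']
      | hof c x =>
        induction y using H.induction with
        | h0 => rw [mul_zero, map_zero, mul_zero]
        | hadd y y' hy hy' => rw [mul_add, map_add, map_add, mul_add, hy, hy']
        | hof d y =>
          rw [of_mul_of, algAddEquiv_of, algAddEquiv_of, algAddEquiv_of, of_mul_of]
          refine congrArg _ (funext fun c' => Subtype.ext ?_)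
          have key : ∀ b, b = c' * c * d → ∀ T'' : H.R c' b,
              T''.1 = compose (x c').1 (y (c' * c)).1 → (θ c' b T'').1 =
                compose (θ c' (c' * c) (x c')).1 (θ (c' * c) (c' * c * d) (y (c' * c))).1 := by
            rintro b rfl T'' h
            exact hθ _ _ _ _ _ _ h
          exact key _ (mul_assoc c' c d).symm _ rfl }

theorem algEquiv_of (θ : ∀ a b, H.R a b ≃ₗ[ℤ] H₁.R a b)
    (hθ : ∀ a b c (T : H.R a b) (T' : H.R b c) (T'' : H.R a c), T''.1 = compose T.1 T'.1 →
      (θ a c T'').1 = compose (θ a b T).1 (θ b c T').1) (c : C) (x : H.Component c) :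
    algEquiv θ hθ (H.of c x) = H₁.of c fun c' => θ c' (c' * c) (x c') :=
  algAddEquiv_of θ c x

/-- The component of index `c`. -/
def component (H : HeckeSystem C G) (c : C) : H.Alg →+ H.Component c :=
  DFinsupp.evalAddMonoidHom (β := H.Component) c

theorem component_of_same (c : C) (x : H.Component c) : H.component c (H.of c x) = x := by
  classical
  exact DirectSum.of_eq_same (β := H.Component) c x

theorem component_of_ne {c d : C} (h : c ≠ d) (x : H.Component c) :
    H.component d (H.of c x) = 0 := by
  classical
  exact DirectSum.of_eq_of_ne (β := H.Component) c d x h.symm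

end HeckeSystem

/-! ### The grading and the algebra homomorphism -/

section Grading

variable {C G G₀ : Type*} [CommGroup C] [Group G] [Group G₀] (P : HeckePair G) (ι : G₀ →* G)
  (α : C → G) (cl : G →* C)

/-- The inclusion of the elements of a given degree. -/
def degreeIncl (c : C) : heckeModule P.Γ P.Γ (degreePart P cl c) →+ P.R :=
  (Submodule.inclusion (heckeModule_mono fun _ hδ => hδ.1 :
    heckeModule P.Γ P.Γ (degreePart P cl c) ≤ heckeModule P.Γ P.Γ (P.Δ : Set _))).toAddMonoidHom

variable {P cl}

/-- The degree is constant on cosets of `K`, so the projection to a degree can be defined by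
filtering on representatives. -/
theorem cl_out (hK : ∀ κ ∈ P.Γ, cl κ = 1) (g : G) : cl (coset P.Γ g).out = cl g := by
  have h := hK _ (coset_eq.mp (Quotient.out_eq (coset P.Γ g) :
    coset P.Γ (coset P.Γ g).out = coset P.Γ g))
  rw [map_mul, map_inv, mul_inv_eq_one] at h
  exact h.symm

open scoped Classical in
theorem filter_coset (hK : ∀ κ ∈ P.Γ, cl κ = 1) (c : C) (T : CosetSpace P.Γ →₀ ℤ) (g : G) :
    T.filter (fun x => cl x.out = c) (coset P.Γ g) = if cl g = c then T (coset P.Γ g) else 0 := by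
  rw [Finsupp.filter_apply, cl_out hK]

open scoped Classical in
/-- The projection to the elements of a given degree. -/
def degreeProj (hK : ∀ κ ∈ P.Γ, cl κ = 1) (c : C) :
    P.R →+ heckeModule P.Γ P.Γ (degreePart P cl c) :=
  AddMonoidHom.mk' (fun T => ⟨T.1.filter fun x => cl x.out = c, fun g hg => by
      rw [filter_coset hK] at hg
      split_ifs at hg with h
      · exact ⟨T.2.1 g hg, h⟩
      · exact absurd rfl hg, fun g γ hγ => by
      rw [filter_coset hK, filter_coset hK, map_mul, hK γ hγ, mul_one]
      exact if_congr Iff.rfl (T.2.2 g γ hγ) rfl⟩)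
    fun _ _ => Subtype.ext Finsupp.filter_add

theorem degreeProj_degreeIncl (hK : ∀ κ ∈ P.Γ, cl κ = 1) (c : C)
    (T : heckeModule P.Γ P.Γ (degreePart P cl c)) :
    degreeProj hK c (degreeIncl P cl c T) = T := by
  refine Subtype.ext (Finsupp.ext fun x => ?_)
  induction x using Quotient.inductionOn with
  | h g =>
    refine (filter_coset hK c T.1 g).trans ?_
    split_ifs with h
    · rfl
    · by_contra hne
      exact h (T.2.1 g (Ne.symm hne)).2

theorem degreeProj_degreeIncl_of_ne (hK : ∀ κ ∈ P.Γ, cl κ = 1) {c d : C} (hcd : c ≠ d)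
    (T : heckeModule P.Γ P.Γ (degreePart P cl c)) :
    degreeProj hK d (degreeIncl P cl c T) = 0 := by
  refine Subtype.ext (Finsupp.ext fun x => ?_)
  induction x using Quotient.inductionOn with
  | h g =>
    refine (filter_coset hK d T.1 g).trans ?_
    split_ifs with h
    · by_contra hne
      exact hcd ((T.2.1 g hne).2.symm.trans h)
    · rfl

theorem sum_degreeIncl_degreeProj [Fintype C] (hK : ∀ κ ∈ P.Γ, cl κ = 1) (T : P.R) :
    ∑ c, degreeIncl P cl c (degreeProj hK c T) = T := by
  have h0 : ∀ (s : Finset C) (f : C → P.R), (∑ c ∈ s, f c).1 = ∑ c ∈ s, (f c).1 := fun s f =>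
    map_sum (heckeModule P.Γ P.Γ (P.Δ : Set G)).subtype f s
  refine Subtype.ext ((h0 _ _).trans (Finsupp.ext fun x => ?_))
  rw [Finsupp.finsetSum_apply]
  induction x using Quotient.inductionOn with
  | h g =>
    classical
    exact (Finset.sum_congr rfl fun c _ => filter_coset hK c T.1 g).trans
      ((Finset.sum_ite_eq Finset.univ (cl g) fun _ => T.1 (coset P.Γ g)).trans
        (if_pos (Finset.mem_univ _)))

theorem degree_induction [Fintype C] (hK : ∀ κ ∈ P.Γ, cl κ = 1) {p : P.R → Prop} (h0 : p 0)
    (hadd : ∀ S T, p S → p T → p (S + T)) (h : ∀ c T, p (degreeIncl P cl c T)) (T : P.R) : p T := by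
  rw [← sum_degreeIncl_degreeProj hK T]
  exact Finset.sum_induction _ p hadd h0 fun c _ => h c _

open scoped Classical in
theorem isInternal_degreeIncl [Fintype C] (hK : ∀ κ ∈ P.Γ, cl κ = 1) :
    DirectSum.IsInternal fun c : C => (degreeIncl P cl c).range := by
  let ℳ : C → AddSubgroup P.R := fun c => (degreeIncl P cl c).range
  let D : P.R →+ DirectSum C fun c => ℳ c :=
    ∑ c, (DirectSum.of (fun c => ℳ c) c).comp
      ((degreeIncl P cl c).rangeRestrict.comp (degreeProj hK c))
  have hD : ∀ T, D T = ∑ c, DirectSum.of (fun c => ℳ c) c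
      ((degreeIncl P cl c).rangeRestrict (degreeProj hK c T)) := fun T =>
    AddMonoidHom.finsetSum_apply _ _ _
  refine @DirectSum.Decomposition.isInternal _ _ _ _ _ _ _ ℳ
    (DirectSum.Decomposition.ofAddHom ℳ D ?_ ?_)
  · refine AddMonoidHom.ext fun T => ?_
    rw [AddMonoidHom.comp_apply, hD, map_sum]
    simp only [DirectSum.coeAddMonoidHom_of]
    exact sum_degreeIncl_degreeProj hK T
  · refine DirectSum.addHom_ext fun c => ?_
    rintro ⟨_, T, rfl⟩
    rw [AddMonoidHom.comp_apply, DirectSum.coeAddMonoidHom_of, hD, Finset.sum_eq_single c]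
    · rw [degreeProj_degreeIncl]
      rfl
    · intro d _ hd
      rw [degreeProj_degreeIncl_of_ne hK hd.symm, map_zero, map_zero]
    · exact fun h => absurd (Finset.mem_univ c) h

variable (P) in
/-- The map `∑ aⱼ K δⱼ ↦ ∑ aⱼ (K δⱼ ∩ Δ̃_{a,b})`. -/
def tildeLin {Δ : Set G} (a b : C) : heckeModule P.Γ P.Γ Δ →ₗ[ℤ] (tildeSystem P ι α).R a b :=
  ((tildeMap P ι α a b).comp (Submodule.subtype _)).codRestrict _
    fun T => tildeMap_mem (ι := ι) (α := α) a b T.2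

variable (P) in
/-- The map from the Hecke algebra to the component of index `c`. -/
def tildeComponent (c : C) : P.R →+ (tildeSystem P ι α).Component c :=
  AddMonoidHom.mk' (fun T c' => tildeLin P ι α (Δ := (P.Δ : Set G)) c' (c' * c) T) fun S T =>
    funext fun c' => map_add (tildeLin P ι α (Δ := (P.Δ : Set G)) c' (c' * c)) S T

variable (P) in
/-- The additive map underlying the homomorphism from the Hecke algebra to the system. -/
def tildeAddHom [Fintype C] : P.R →+ (tildeSystem P ι α).Alg :=
  ∑ c, ((tildeSystem P ι α).of c).comp (tildeComponent P ι α c)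

variable {ι α}

theorem tildeAddHom_apply [Fintype C] (T : P.R) : tildeAddHom P ι α T =
    ∑ c, (tildeSystem P ι α).of c (tildeComponent P ι α c T) :=
  AddMonoidHom.finsetSum_apply _ _ _

theorem component_tildeAddHom [Fintype C] (c : C) (T : P.R) :
    (tildeSystem P ι α).component c (tildeAddHom P ι α T) = tildeComponent P ι α c T := by
  rw [tildeAddHom_apply, map_sum, Finset.sum_eq_single c]
  · exact HeckeSystem.component_of_same _ _
  · exact fun d _ hd => HeckeSystem.component_of_ne hd _
  · exact fun h => absurd (Finset.mem_univ c) h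

namespace IsClassMap

/-- The additive map uses all components without projecting first. Elements of `Δ̃_{c',c'd}` have
degree `d`, so only the component `d = c` survives. -/
theorem tildeAddHom_degreeIncl [Fintype C] (h : IsClassMap P ι α cl) (c : C)
    (T : heckeModule P.Γ P.Γ (degreePart P cl c)) :
    tildeAddHom P ι α (degreeIncl P cl c T) =
      (tildeSystem P ι α).of c fun c' => tildeLin P ι α c' (c' * c) T := by
  rw [tildeAddHom_apply, Finset.sum_eq_single c]
  · rfl
  · intro d _ hd
    have : tildeComponent P ι α d (degreeIncl P cl c T) = 0 :=
      funext fun c' => Subtype.ext (h.tildeMap_eq_zero c' hd T.2)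
    rw [this, map_zero]
  · exact fun h => absurd (Finset.mem_univ c) h

theorem tildeAddHom_mul [Fintype C] (h : IsClassMap P ι α cl) (S T : P.R) :
    tildeAddHom P ι α (S * T) = tildeAddHom P ι α S * tildeAddHom P ι α T := by
  induction S using degree_induction h.map_Γ with
  | h0 => rw [zero_mul, map_zero, zero_mul]
  | hadd S S' hS hS' => rw [add_mul, map_add, map_add, add_mul, hS, hS']
  | h c S =>
    induction T using degree_induction h.map_Γ with
    | h0 => rw [mul_zero, map_zero, mul_zero]
    | hadd T T' hT hT' => rw [mul_add, map_add, map_add, mul_add, hT, hT']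
    | h d T =>
      have hST : compose S.1 T.1 ∈ heckeModule P.Γ P.Γ (degreePart P cl (c * d)) :=
        compose_mem S.2 T.2 fun δ hδ δ' hδ' =>
          ⟨P.Δ.mul_mem hδ.1 hδ'.1, by rw [map_mul, hδ.2, hδ'.2]⟩
      have h1 : degreeIncl P cl c S * degreeIncl P cl d T =
          degreeIncl P cl (c * d) ⟨_, hST⟩ := rfl
      rw [h1, h.tildeAddHom_degreeIncl, h.tildeAddHom_degreeIncl, h.tildeAddHom_degreeIncl,
        HeckeSystem.of_mul_of]
      refine congrArg _ (funext fun c' => Subtype.ext ?_)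
      have h2 : tildeMap P ι α c' (c' * (c * d)) (compose S.1 T.1) =
          compose (tildeMap P ι α c' (c' * c) S.1)
            (tildeMap P ι α (c' * c) (c' * c * d) T.1) := by
        rw [← mul_assoc c' c d]
        exact h.tildeMap_compose c' c d S.2 T.2
      exact h2

/-- The homomorphism from the Hecke algebra to the algebra of the system. -/
def tildeHom [Fintype C] (h : IsClassMap P ι α cl) : P.R →ₙ+* (tildeSystem P ι α).Alg :=
  { tildeAddHom P ι α with
    map_mul' := h.tildeAddHom_mul
    map_zero' := map_zero (tildeAddHom P ι α) }

theorem tildeHom_injective [Fintype C] (h : IsClassMap P ι α cl) :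
    Function.Injective h.tildeHom := by
  refine (injective_iff_map_eq_zero (tildeAddHom P ι α)).mpr fun T hT => ?_
  refine Subtype.ext (Finsupp.ext fun x => ?_)
  induction x using Quotient.inductionOn with
  | h δ =>
    by_contra hne
    -- The coefficient at `K δ` can be read off in the component of index `cl δ`, with any `c'`;
    -- here `c' = 1`.
    refine hne (h.apply_eq_zero 1 (T.2.1 δ hne) ?_)
    have h1 := component_tildeAddHom (ι := ι) (α := α) (cl δ) T
    rw [hT, map_zero] at h1
    exact congrArg Subtype.val (congrFun h1 1).symm

theorem tildeLin_injective (h : IsClassMap P ι α cl) (c c' : C) :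
    Function.Injective
      (tildeLin P ι α (Δ := degreePart P cl c) c' (c' * c)) := by
  refine (injective_iff_map_eq_zero _).mpr fun T hT => ?_
  refine Subtype.ext (Finsupp.ext fun x => ?_)
  induction x using Quotient.inductionOn with
  | h δ =>
    by_contra hne
    have h1 := T.2.1 δ hne
    refine hne (h.apply_eq_zero c' h1.1 ?_)
    rw [h1.2]
    exact congrArg Subtype.val hT

end IsClassMap

theorem mem_cosetSet {Γ : Subgroup G} {g x : G} :
    x ∈ cosetSet Γ g ↔ coset Γ x = coset Γ g := by
  rw [eq_comm, coset_eq]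
  constructor
  · rintro ⟨γ, hγ, rfl⟩
    rwa [mul_inv_cancel_right]
  · exact fun h => ⟨_, h, (inv_mul_cancel_right x g).symm⟩

theorem cosetSet_inter_tildeSystem {a b : C} {δ δ' : G} (hδ' : δ' ∈ (tildeSystem P ι α).Δ a b)
    (h : coset P.Γ δ' = coset P.Γ δ) :
    cosetSet P.Γ δ ∩ (tildeSystem P ι α).Δ a b = cosetSet ((tildeSystem P ι α).Γ a) δ' := by
  ext x
  rw [Set.mem_inter_iff, mem_cosetSet, mem_cosetSet, ← h, ← coset_mem_tildeCosets]
  constructor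
  · rintro ⟨h1, h2⟩
    exact coarsen_injOn P ι α a b h2 ((coset_mem_tildeCosets P ι α).mpr hδ') h1
  · intro h1
    rw [h1]
    exact ⟨congrArg (coarsen P ι α a) h1, (coset_mem_tildeCosets P ι α).mpr hδ'⟩

/-- The preimage of the corresponding statement for `Δ̃` under `x ↦ α_a x α_b⁻¹`, where injectivity
of `cosetMap` identifies the cosets. -/
theorem preimage_cosetSet_inter_system {a b : C} {δ : G} {g : G₀}
    (hg : g ∈ (system P ι α).Δ a b)
    (h : coset P.Γ (α a * ι g * (α b)⁻¹) = coset P.Γ δ) :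
    {x | α a * ι x * (α b)⁻¹ ∈ cosetSet P.Γ δ} ∩ (system P ι α).Δ a b =
      cosetSet ((system P ι α).Γ a) g := by
  ext x
  have h1 := Set.ext_iff.mp (cosetSet_inter_tildeSystem (P := P) (ι := ι) (α := α) (a := a) (b := b)
    ⟨hg, g, rfl⟩ h) (α a * ι x * (α b)⁻¹)
  rw [mem_cosetSet, ← (cosetMap_injective P ι α a b).eq_iff]
  refine Iff.trans ?_ (h1.trans mem_cosetSet)
  exact ⟨fun h => ⟨h.1, h.2, x, rfl⟩, fun h => ⟨h.1, h.2.1⟩⟩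

end Grading

/-! ### The homomorphism into the algebra over the small group, and its units -/

section Homomorphism

variable {C G G₀ : Type*} [CommGroup C] [Group G] [Group G₀] {P : HeckePair G} {ι : G₀ →* G}
  {α : C → G} {cl : G →* C}

variable (P ι α) in
/-- The isomorphism between the algebras of the two systems. -/
def tildeAlgEquiv : (tildeSystem P ι α).Alg ≃+* (system P ι α).Alg :=
  HeckeSystem.algEquiv (tildeEquiv P ι α) (tildeEquiv_compose P ι α)

theorem tildeAlgEquiv_of (c : C) (x : (tildeSystem P ι α).Component c) :
    tildeAlgEquiv P ι α ((tildeSystem P ι α).of c x) =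
      (system P ι α).of c fun c' => tildeEquiv P ι α c' (c' * c) (x c') :=
  HeckeSystem.algEquiv_of _ _ c x

namespace IsClassMap

theorem exists_cosetSet_inter_tildeSystem (h : IsClassMap P ι α cl) (c c' : C) {δ : G}
    (hδ : δ ∈ degreePart P cl c) : ∃ δ' ∈ (tildeSystem P ι α).Δ c' (c' * c),
      cosetSet P.Γ δ ∩ (tildeSystem P ι α).Δ c' (c' * c) =
        cosetSet ((tildeSystem P ι α).Γ c') δ' ∧
      ∀ T : heckeModule P.Γ P.Γ (degreePart P cl c),
        (tildeLin P ι α c' (c' * c) T).1 (coset ((tildeSystem P ι α).Γ c') δ') =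
          T.1 (coset P.Γ δ) := by
  obtain ⟨κ, hκ, hmem⟩ := h.exists_mem_of_degreePart c' hδ
  refine ⟨_, hmem, cosetSet_inter_tildeSystem hmem (coset_mul_left hκ δ), fun T => ?_⟩
  exact (tildeMap_of_mem hmem T.1).trans (congrArg T.1 (coset_mul_left hκ δ))

theorem exists_preimage_cosetSet_inter_system (h : IsClassMap P ι α cl) (c c' : C) {δ : G}
    (hδ : δ ∈ degreePart P cl c) : ∃ g ∈ (system P ι α).Δ c' (c' * c),
      {x | α c' * ι x * (α (c' * c))⁻¹ ∈ cosetSet P.Γ δ} ∩ (system P ι α).Δ c' (c' * c) =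
        cosetSet ((system P ι α).Γ c') g ∧
      ∀ T : heckeModule P.Γ P.Γ (degreePart P cl c),
        (tildeEquiv P ι α c' (c' * c) (tildeLin P ι α c' (c' * c) T)).1
          (coset ((system P ι α).Γ c') g) = T.1 (coset P.Γ δ) := by
  obtain ⟨κ, hκ, hmem⟩ := h.exists_mem_of_degreePart c' hδ
  obtain ⟨hΔ, g, hg⟩ := hmem
  have h1 : coset P.Γ (α c' * ι g * (α (c' * c))⁻¹) = coset P.Γ δ := by
    rw [← hg, coset_mul_left hκ]
  have h2 : g ∈ (system P ι α).Δ c' (c' * c) := by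
    rw [system_mem, ← hg]
    exact hΔ
  refine ⟨g, h2, preimage_cosetSet_inter_system h2 h1, fun T => ?_⟩
  exact (tildeMap_of_mem ⟨h2, g, rfl⟩ T.1).trans (congrArg T.1 h1)

variable [Fintype C]

/-- The homomorphism from the Hecke algebra to the algebra of the system in `G₀`. -/
def systemHom (h : IsClassMap P ι α cl) : P.R →ₙ+* (system P ι α).Alg :=
  (tildeAlgEquiv P ι α : (tildeSystem P ι α).Alg →ₙ+* (system P ι α).Alg).comp h.tildeHom

theorem systemHom_apply (h : IsClassMap P ι α cl) (T : P.R) :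
    h.systemHom T = tildeAlgEquiv P ι α (h.tildeHom T) := rfl

theorem systemHom_injective (h : IsClassMap P ι α cl) : Function.Injective h.systemHom :=
  (tildeAlgEquiv P ι α).injective.comp h.tildeHom_injective

/-- The unit is the coset `K`, of degree one. Its intersection with `Δ̃_{c,c}` is `Γ̃_c`, so it maps
to the unit of the second algebra, and the isomorphism transports this to the third. -/
theorem exists_unit (h : IsClassMap P ι α cl) (h1 : 1 ∈ P.Δ) : ∃ e : P.R,
    (∀ T, e * T = T ∧ T * e = T) ∧
    (∀ x, h.tildeHom e * x = x ∧ x * h.tildeHom e = x) ∧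
    ∀ x, h.systemHom e * x = x ∧ x * h.systemHom e = x := by
  have hmem : Finsupp.single (coset P.Γ 1) 1 ∈ heckeModule P.Γ P.Γ (degreePart P cl 1) :=
    single_one_mem fun γ hγ => ⟨by simpa using P.isTriple.left_mul_mem γ hγ 1 h1, h.map_Γ γ hγ⟩
  have hone : ∀ a, (1 : G) ∈ (tildeSystem P ι α).Δ a a := fun a =>
    ⟨h1, 1, by rw [map_one]; group⟩
  let e : P.R := degreeIncl P cl 1 ⟨_, hmem⟩
  have he : h.tildeHom e = (tildeSystem P ι α).one hone := by
    refine (h.tildeAddHom_degreeIncl 1 ⟨_, hmem⟩).trans ?_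
    refine congrArg ((tildeSystem P ι α).of 1) (funext fun c => Subtype.ext ?_)
    have h2 : tildeMap P ι α c (c * 1) (Finsupp.single (coset P.Γ 1) 1) =
        Finsupp.single (coset ((tildeSystem P ι α).Γ c) 1) 1 := by
      rw [mul_one c, tildeMap_one c h1]
    exact h2
  have hx : ∀ x, h.tildeHom e * x = x ∧ x * h.tildeHom e = x := fun x => by
    rw [he]
    exact ⟨HeckeSystem.one_mul _ hone x, HeckeSystem.mul_one _ hone x⟩
  refine ⟨e, fun T => ⟨Subtype.ext (one_compose T.1), Subtype.ext (compose_one T.2)⟩, hx,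
    fun x => ?_⟩
  obtain ⟨y, rfl⟩ := (tildeAlgEquiv P ι α).surjective x
  rw [systemHom_apply, ← map_mul, ← map_mul, (hx y).1, (hx y).2]
  exact ⟨rfl, rfl⟩

/-- A two-sided unit is unique, so an arbitrary one has the image of the explicit unit. -/
theorem systemHom_unit (h : IsClassMap P ι α cl) (h1 : 1 ∈ P.Δ)
    (hone : ∀ a, (1 : G₀) ∈ (system P ι α).Δ a a) {e : P.R}
    (he : ∀ T, e * T = T ∧ T * e = T) : h.systemHom e = (system P ι α).one hone := by
  obtain ⟨e', h2, -, h3⟩ := h.exists_unit h1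
  have h4 : e = e' := (h2 e).2.symm.trans (he e').1
  rw [h4]
  exact (HeckeSystem.mul_one _ hone _).symm.trans (h3 _).1

end IsClassMap

end Homomorphism

/-! ### The action of the Hecke algebra on cohomology -/

section AdelicAction

variable {k : Type u} [CommRing k] {V : Type u} [AddCommGroup V] [Module k V]
  {C : Type*} {G : Type*} {G₀ : Type u} [CommGroup C] [Group G] [Group G₀] {P : HeckePair G}
  {ι : G₀ →* G} {α : C → G} {cl : G →* C} [Fintype C]

theorem IsClassMap.exists_act (h : IsClassMap P ι α cl) (S : Submonoid G₀)
    (hΔ : ∀ a b, ∀ δ ∈ (system P ι α).Δ a b, δ ∈ S)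
    (hΓ : ∀ c, ∀ γ ∈ (system P ι α).Γ c, γ ∈ S) (σ : S →* (Module.End k V)ᵐᵒᵖ) (r : ℕ) :
    ∃ act : (system P ι α).Alg →ₙ+* (Module.End k (totalCohomology (system P ι α) σ hΓ r))ᵐᵒᵖ,
      IsDoubleCosetAction (system P ι α) σ hΓ r act ∧
      (∀ act', IsDoubleCosetAction (system P ι α) σ hΓ r act' → act' = act) ∧
      ∃ ρ : P.R →ₙ+* (Module.End k (totalCohomology (system P ι α) σ hΓ r))ᵐᵒᵖ,
        ρ = act.comp h.systemHom ∧
        ∀ e : P.R, 1 ∈ P.Δ → (∀ T, e * T = T ∧ T * e = T) → ρ e = 1 := by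
  have hact := act_isDoubleCosetAction σ (system P ι α) hΔ hΓ r
  refine ⟨_, hact, fun act' h' => h'.unique hact, _, rfl, fun e h1 he => ?_⟩
  have hone : ∀ a, (1 : G₀) ∈ (system P ι α).Δ a a := fun a => by
    rw [system_mem, map_one, mul_one, mul_inv_cancel]
    exact h1
  rw [NonUnitalRingHom.comp_apply, h.systemHom_unit h1 hone he]
  exact act_of_one σ (system P ι α) hΔ hΓ r _ fun c => rfl

end AdelicAction

theorem isGradedByClass {F : Type*} [Field F] [NumberField F] {n : ℕ}
    {P : HeckePair (GL (Fin n) (Adele F))} (hK : ∀ κ ∈ P.Γ, detClass F n κ = 1) :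
    IsGradedByClass P := by
  refine ⟨isInternal_degreeIncl (cl := detClass F n) hK, fun c d T T' => ?_⟩
  have hmem : compose T.1 T'.1 ∈ heckeModule P.Γ P.Γ (degreePart P (detClass F n) (c * d)) :=
    compose_mem (Δ := degreePart P (detClass F n) c) (Δ' := degreePart P (detClass F n) d) T.2 T'.2
      fun δ hδ δ' hδ' => ⟨P.Δ.mul_mem hδ.1 hδ'.1, by rw [map_mul, hδ.2, hδ'.2]⟩
  exact ⟨⟨_, hmem⟩, rfl⟩

end AdelicHecke

end

theorem mainTheorem4 {F : Type u} [Field F] [NumberField F] (n : ℕ)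
    (α : ClassGroup (𝓞 F) → GL (Fin n) (Adele F))
    (hα : ∀ c, ideleClass (Matrix.GeneralLinearGroup.det (α c)) = c⁻¹)
    (P : HeckePair (GL (Fin n) (Adele F)))
    (hopen : IsOpen (P.Γ : Set (GL (Fin n) (Adele F))))
    (hprincipal : ∀ κ ∈ P.Γ, ideleClass (Matrix.GeneralLinearGroup.det κ) = 1)
    (hdet : ∀ x : (Adele F)ˣ, ∃ (c : ClassGroup (𝓞 F)) (g : GL (Fin n) F), ∃ κ ∈ P.Γ,
      Matrix.GeneralLinearGroup.det (α c * diagonalGL F n g * κ) = x) :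
    -- both families consist of Hecke triples, and `R(K, Δ)` is graded
    (∀ a b, IsTriple ((adelicTilde P α).Γ a) ((adelicTilde P α).Γ b) ((adelicTilde P α).Δ a b)) ∧
    (∀ a b, IsTriple ((adelicSystem P α).Γ a) ((adelicSystem P α).Γ b)
      ((adelicSystem P α).Δ a b)) ∧
    IsGradedByClass P ∧
    ∃ (φ : ∀ c c', classR P c →ₗ[ℤ] (adelicTilde P α).R c' (c' * c))
      (θ : ∀ a b, (adelicTilde P α).R a b ≃ₗ[ℤ] (adelicSystem P α).R a b)
      (Φt : P.R →ₙ+* (adelicTilde P α).Alg)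
      (Θ : (adelicTilde P α).Alg ≃+* (adelicSystem P α).Alg)
      (Φ : P.R →ₙ+* (adelicSystem P α).Alg),
      -- the maps `∑ aⱼ K δⱼ ↦ ∑ aⱼ (K δⱼ ∩ Δ̃_{c',c'c})` are injective
      (∀ c c', Function.Injective (φ c c')) ∧
      (∀ c c', ∀ δ ∈ classPart P c, ∃ δ' ∈ (adelicTilde P α).Δ c' (c' * c),
        cosetSet P.Γ δ ∩ (adelicTilde P α).Δ c' (c' * c)
          = cosetSet ((adelicTilde P α).Γ c') δ' ∧
        ∀ T : classR P c,
          (φ c c' T).1 (coset ((adelicTilde P α).Γ c') δ') = T.1 (coset P.Γ δ)) ∧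
      -- the isomorphisms `Γ̃_a δ ↦ Γ_a α_a⁻¹ δ α_b`
      (∀ a b (T : (adelicTilde P α).R a b) (g : GL (Fin n) F),
        (θ a b T).1 (coset ((adelicSystem P α).Γ a) g)
          = T.1 (coset ((adelicTilde P α).Γ a) (α a * diagonalGL F n g * (α b)⁻¹))) ∧
      -- the composites `∑ aⱼ K δⱼ ↦ ∑ aⱼ (α_{c'}⁻¹ K δⱼ α_{c'c} ∩ Δ_{c',c'c})` are injective
      (∀ c c', Function.Injective fun T => θ c' (c' * c) (φ c c' T)) ∧
      (∀ c c', ∀ δ ∈ classPart P c, ∃ g ∈ (adelicSystem P α).Δ c' (c' * c),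
        {x | α c' * diagonalGL F n x * (α (c' * c))⁻¹ ∈ cosetSet P.Γ δ}
            ∩ (adelicSystem P α).Δ c' (c' * c)
          = cosetSet ((adelicSystem P α).Γ c') g ∧
        ∀ T : classR P c, (θ c' (c' * c) (φ c c' T)).1 (coset ((adelicSystem P α).Γ c') g)
          = T.1 (coset P.Γ δ)) ∧
      -- together they form injective algebra homomorphisms
      (∀ c (T : classR P c), Φt (classIncl P c T) = (adelicTilde P α).of c fun c' => φ c c' T) ∧
      (∀ c (x : (adelicTilde P α).Component c),
        Θ ((adelicTilde P α).of c x) = (adelicSystem P α).of c fun c' => θ c' (c' * c) (x c')) ∧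
      (∀ T, Φ T = Θ (Φt T)) ∧
      Function.Injective Φt ∧ Function.Injective Φ ∧
      -- which are unital if `1 ∈ Δ`
      (1 ∈ P.Δ → ∃ e : P.R, (∀ T, e * T = T ∧ T * e = T) ∧
        (∀ x, Φt e * x = x ∧ x * Φt e = x) ∧ ∀ x, Φ e * x = x ∧ x * Φ e = x) ∧
      -- the action of `R(K, Δ)` on `⨁_c H^r(Γ_c, V)`
      ∀ {k : Type u} [CommRing k] {V : Type u} [AddCommGroup V] [Module k V]
        (S : Submonoid (GL (Fin n) F))
        (_ : ∀ a b, ∀ δ ∈ (adelicSystem P α).Δ a b, δ ∈ S)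
        (hΓ : ∀ c, ∀ γ ∈ (adelicSystem P α).Γ c, γ ∈ S)
        (σ : S →* (Module.End k V)ᵐᵒᵖ) (r : ℕ),
        ∃ act : (adelicSystem P α).Alg →ₙ+*
            (Module.End k (totalCohomology (adelicSystem P α) σ hΓ r))ᵐᵒᵖ,
          IsDoubleCosetAction (adelicSystem P α) σ hΓ r act ∧
          (∀ act', IsDoubleCosetAction (adelicSystem P α) σ hΓ r act' → act' = act) ∧
          ∃ ρ : P.R →ₙ+* (Module.End k (totalCohomology (adelicSystem P α) σ hΓ r))ᵐᵒᵖ,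
            ρ = act.comp Φ ∧
            ∀ e : P.R, 1 ∈ P.Δ → (∀ T, e * T = T ∧ T * e = T) → ρ e = 1 := by
  -- The openness of `K` and the surjectivity of the determinant enter only here, through strong
  -- approximation with `β = α c`.
  have h : IsClassMap P (diagonalGL F n) α (detClass F n) :=
    isClassMap hα (fun g => detClass_diagonalGL g) hprincipal fun c y hy =>
      exists_mul_diagonalGL_of_detClass hα hopen hprincipal hdet (α c) y hy
  refine ⟨tildeSystem_isTriple P _ α, system_isTriple P _ α, ?_⟩
  refine ⟨isGradedByClass hprincipal, ?_⟩
  refine ⟨fun c c' => tildeLin P (diagonalGL F n) α c' (c' * c), tildeEquiv P (diagonalGL F n) α,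
    h.tildeHom, tildeAlgEquiv P (diagonalGL F n) α, h.systemHom, ?_⟩
  refine ⟨h.tildeLin_injective, ?_⟩
  refine ⟨fun c c' δ hδ => h.exists_cosetSet_inter_tildeSystem c c' hδ, ?_⟩
  refine ⟨tildeEquiv_apply P (diagonalGL F n) α, ?_⟩
  refine ⟨fun c c' => (tildeEquiv P (diagonalGL F n) α c' (c' * c)).injective.comp
      (h.tildeLin_injective c c'), ?_⟩
  refine ⟨fun c c' δ hδ => h.exists_preimage_cosetSet_inter_system c c' hδ, ?_⟩
  refine ⟨h.tildeAddHom_degreeIncl, ?_⟩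
  refine ⟨tildeAlgEquiv_of, ?_⟩
  refine ⟨h.systemHom_apply, ?_⟩
  refine ⟨h.tildeHom_injective, ?_⟩
  refine ⟨h.systemHom_injective, ?_⟩
  refine ⟨h.exists_unit, ?_⟩
  exact h.exists_act
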